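/- Let $M$ be a $C^\infty$ Riemannian manifold of dimension $n\ge 2$, and give $M\times\mathbb R$ the product metric $\langle\,,\rangle_M+dt^2$. Let $\Sigma$ be an (immersed) oriented smooth hypersurface of $M\times\mathbb R$ with unit normal field $N$, shape operator $AX=-\overline\nabla_XN$, height function $\xi=\pi_{\mathbb R}|_\Sigma$ and angle function $\theta=\langle N,\partial_t\rangle$. Suppose that $\Sigma$ is a *vertical helicoid*: $\theta^2\neq 1$ everywhere, $\theta$ is nonconstant, every horizontal section $\Sigma_t=\Sigma\cap(M\times\{t\})$ is a minimal hypersurface of $M\times\{t\}$, and $\langle A\nabla\xi,\nabla\xi\rangle=0$ on $\Sigma$. Suppose moreover that $\theta$ vanishes nowhere. (1) Assume that each horizontal section $\Sigma_t$ is totally geodesic in $M\times\{t\}$. Then for every $x_0\in\Sigma$, with $t_0=\xi(x_0)$, there exist a connected open set $\Sigma'\ni x_0$ of $\Sigma$ (embedded injectively in $M\times\mathbb R$, with $\pi_M(\Sigma')$ open in $M$), an $\epsilon>0$, an embedded hypersurface $\mathfrak L_0$ of $M$ with $\mathfrak L_0\subset\pi_M(\Sigma')$, and a local one-parameter group of isometries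 $$\Gamma_t:\pi_M(\Sigma')\to\Gamma_t(\pi_M(\Sigma'))\subset M,\qquad t\in(-\epsilon,\epsilon)$$ (smooth in $(t,p)$, each $\Gamma_t$ injective and preserving the Riemannian metric, $\Gamma_0=\mathrm{id}$, and $\Gamma_{s+t}(p)=\Gamma_s(\Gamma_t(p))$ whenever $s,t,s+t\in(-\epsilon,\epsilon)$ and $p,\Gamma_t(p)\in\pi_M(\Sigma')$), such that, up to the vertical translation by $t_0$, $\Sigma'$ is the $1$-pitched twisting of $\mathfrak L_0$ determined by $\{\Gamma_t\}$, that is, $$\Sigma'=\{(\Gamma_t(p),\,t_0+t)\;;\;p\in\mathfrak L_0,\ t\in(-\epsilon,\epsilon)\}.$$ (2) If $n=2$, then (without assuming that the horizontal sections are totally geodesic) the conclusion of (1) holds for every $x_0\in\Sigma$, with $\mathfrak L_0$ the trace of a nonconstant geodesic $\gamma:(-\delta,\delta)\to M$. -/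

import Mathlib

open Set Bundle
open scoped Manifold ContDiff

noncomputable section

namespace VerticalHelicoid

section Connection

variable {E : Type*} [NormedAddCommGroup E] [NormedSpace ℝ E]
  {H : Type*} [TopologicalSpace H] (I : ModelWithCorners ℝ E H)
  {P : Type*} [TopologicalSpace P] [ChartedSpace H P] [IsManifold I 1 P]
  {E' : Type*} [NormedAddCommGroup E'] [NormedSpace ℝ E']
  {H' : Type*} [TopologicalSpace H'] (J : ModelWithCorners ℝ E' H')
  {S : Type*} [TopologicalSpace S] [ChartedSpace H' S]

/-- The component `g(∂_u, ∂_w)` of a metric `g` in the preferred chart at `p₀`, as a function of the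
coordinates. Here `∂_u` is the coordinate vector field of that chart with constant components `u`,
given by the trivialization of the tangent bundle that the chart induces. -/
def coordMetric (g : ∀ p : P, TangentSpace I p → TangentSpace I p → ℝ) (p₀ : P) (u w : E) :
    E → ℝ := fun y =>
  g ((extChartAt I p₀).symm y)
    ((trivializationAt E (TangentSpace I : P → Type _) p₀).symmL ℝ ((extChartAt I p₀).symm y) u)
    ((trivializationAt E (TangentSpace I : P → Type _) p₀).symmL ℝ ((extChartAt I p₀).symm y) w)

/-- The Christoffel symbol of the first kind `⟨∇_{∂_u} ∂_w, ∂_z⟩` of the Levi-Civita connection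
of `g`, at the point `p₀`, in the preferred chart at `p₀`. -/
def christoffel (g : ∀ p : P, TangentSpace I p → TangentSpace I p → ℝ) (p₀ : P) (u w z : E) : ℝ :=
  (fderiv ℝ (coordMetric I g p₀ w z) (extChartAt I p₀ p₀) u
    + fderiv ℝ (coordMetric I g p₀ u z) (extChartAt I p₀ p₀) w
    - fderiv ℝ (coordMetric I g p₀ u w) (extChartAt I p₀ p₀) z) / 2

/-- `⟨∇_v V, z⟩`, where `∇` is the Levi-Civita connection of the metric `g` on `P`, `V` is a vector
field along the map `f : S → P`, `v` is tangent to `S` at `x` and `z` is tangent to `P` at `f x`: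
the derivative of the components of `V` plus the Christoffel term, in the preferred chart at
`f x`. (The tangent space at `f x` is identified with `E` by that very chart.) -/
def covAlong (g : ∀ p : P, TangentSpace I p → TangentSpace I p → ℝ) (f : S → P)
    (V : ∀ y : S, TangentSpace I (f y)) (x : S) (v : TangentSpace J x)
    (z : TangentSpace I (f x)) : ℝ :=
  g (f x)
    (mfderiv J 𝓘(ℝ, E)
      (fun y => (trivializationAt E (TangentSpace I : P → Type _) (f x) ⟨f y, V y⟩).2) x v) z
    + christoffel I g (f x) (mfderiv J I f x v) (V x) z

/-- `⟨A v, w⟩` for the shape operator `A X = -∇_X N` of an immersed hypersurface `f : S → (P, g)`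
with unit normal field `N`. -/
def shapeForm (g : ∀ p : P, TangentSpace I p → TangentSpace I p → ℝ) (f : S → P)
    (N : ∀ y : S, TangentSpace I (f y)) (x : S) (v w : TangentSpace J x) : ℝ :=
  - covAlong I J g f N x v (mfderiv J I f x w)

end Connection

section Product

variable {n : ℕ} {M : Type*} [TopologicalSpace M] [ChartedSpace (EuclideanSpace ℝ (Fin n)) M]
  [IsManifold (𝓡 n) ∞ M] [RiemannianBundle (fun p : M => TangentSpace (𝓡 n) p)]
  {S : Type*} [TopologicalSpace S] [ChartedSpace (EuclideanSpace ℝ (Fin n)) S]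

/-- The Riemannian metric of `M`. -/
def metric (p : M) (v w : TangentSpace (𝓡 n) p) : ℝ := inner ℝ v w

/-- The product metric `⟨ , ⟩_M + dt²` of `M × ℝ`. -/
def prodMetric (q : M × ℝ) (v w : TangentSpace ((𝓡 n).prod 𝓘(ℝ, ℝ)) q) : ℝ :=
  metric q.1 (v.1 : TangentSpace (𝓡 n) q.1) (w.1 : TangentSpace (𝓡 n) q.1)
    + (v.2 : ℝ) * (w.2 : ℝ)

/-- The vertical field `∂_t` of `M × ℝ`. -/
def vertical (q : M × ℝ) : TangentSpace ((𝓡 n).prod 𝓘(ℝ, ℝ)) q :=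
  ((0, 1) : EuclideanSpace ℝ (Fin n) × ℝ)

/-- `f : S → M × ℝ` is a smooth immersed hypersurface, oriented by the smooth unit normal field
`N` (a vector field along `f`). The manifold `S` has dimension `n = dim M`. -/
structure IsOrientedHypersurface (f : S → M × ℝ)
    (N : ∀ x : S, TangentSpace ((𝓡 n).prod 𝓘(ℝ, ℝ)) (f x)) : Prop where
  smooth : ContMDiff (𝓡 n) ((𝓡 n).prod 𝓘(ℝ, ℝ)) ∞ f
  immersion : ∀ x, Function.Injective (mfderiv (𝓡 n) ((𝓡 n).prod 𝓘(ℝ, ℝ)) f x)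
  normal_smooth : ContMDiff (𝓡 n) ((𝓡 n).prod 𝓘(ℝ, ℝ)).tangent ∞
    (fun x => (⟨f x, N x⟩ : TangentBundle ((𝓡 n).prod 𝓘(ℝ, ℝ)) (M × ℝ)))
  normal_unit : ∀ x, prodMetric (f x) (N x) (N x) = 1
  normal_orthogonal : ∀ x (v : TangentSpace (𝓡 n) x),
    prodMetric (f x) (N x) (mfderiv (𝓡 n) ((𝓡 n).prod 𝓘(ℝ, ℝ)) f x v) = 0

/-- The angle function `θ = ⟨N, ∂_t⟩`. -/
def angle (f : S → M × ℝ) (N : ∀ x : S, TangentSpace ((𝓡 n).prod 𝓘(ℝ, ℝ)) (f x)) (x : S) : ℝ :=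
  prodMetric (f x) (N x) (vertical (f x))

/-- The projection `π_M ∘ f` of the hypersurface to `M`. -/
def proj (f : S → M × ℝ) (x : S) : M := (f x).1

/-- The height function `ξ = π_ℝ ∘ f`. -/
def height (f : S → M × ℝ) (x : S) : ℝ := (f x).2

/-- The differential `dξ_x(v)` of the height function. -/
def dheight (f : S → M × ℝ) (x : S) (v : TangentSpace (𝓡 n) x) : ℝ :=
  mfderiv (𝓡 n) 𝓘(ℝ, ℝ) (height f) x v

/-- `v` is the gradient `∇ξ` of the height function at `x`, for the metric that `f` induces. -/
def IsHeightGradient (f : S → M × ℝ) (x : S) (v : TangentSpace (𝓡 n) x) : Prop :=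
  ∀ w : TangentSpace (𝓡 n) x,
    prodMetric (f x) (mfderiv (𝓡 n) ((𝓡 n).prod 𝓘(ℝ, ℝ)) f x v)
      (mfderiv (𝓡 n) ((𝓡 n).prod 𝓘(ℝ, ℝ)) f x w) = dheight f x w

/-- The unit normal `η = -(1 - θ²)^(-1/2) (N - θ ∂_t)` of the horizontal sections
`Σ_t = {ξ = t}`; it is horizontal, hence a vector field along `π_M ∘ f`. -/
def sectionNormal (f : S → M × ℝ) (N : ∀ x : S, TangentSpace ((𝓡 n).prod 𝓘(ℝ, ℝ)) (f x))
    (x : S) : TangentSpace (𝓡 n) (proj f x) :=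
  (-(√(1 - angle f N x ^ 2))⁻¹) •
    ((N x - angle f N x • vertical (f x)).1 : TangentSpace (𝓡 n) (proj f x))

/-- `⟨A_η v, w⟩` for the shape operator of the horizontal section through `x`, as a hypersurface of
`M × {t}`, which is identified with `M`. It is only used for `v`, `w` in the tangent space
`ker dξ_x` of the section; for such `v` the derivative `∇_v η` only sees `η` along the section. -/
def sectionShapeForm (f : S → M × ℝ)
    (N : ∀ x : S, TangentSpace ((𝓡 n).prod 𝓘(ℝ, ℝ)) (f x)) (x : S)
    (v w : TangentSpace (𝓡 n) x) : ℝ :=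
  shapeForm (𝓡 n) (𝓡 n) metric (proj f) (sectionNormal f N) x v w

/-- Every horizontal section `Σ_t` is totally geodesic in `M × {t}`. -/
def TotallyGeodesicSections (f : S → M × ℝ)
    (N : ∀ x : S, TangentSpace ((𝓡 n).prod 𝓘(ℝ, ℝ)) (f x)) : Prop :=
  ∀ (x : S) (v w : TangentSpace (𝓡 n) x), dheight f x v = 0 → dheight f x w = 0 →
    sectionShapeForm f N x v w = 0

/-- Every horizontal section `Σ_t` is minimal in `M × {t}`: the trace of its shape operator,
computed in any orthonormal basis of its tangent space, vanishes. -/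
def MinimalSections (f : S → M × ℝ)
    (N : ∀ x : S, TangentSpace ((𝓡 n).prod 𝓘(ℝ, ℝ)) (f x)) : Prop :=
  ∀ (x : S) (e : Fin (n - 1) → TangentSpace (𝓡 n) x),
    (∀ i, dheight f x (e i) = 0) →
    (∀ i j, prodMetric (f x) (mfderiv (𝓡 n) ((𝓡 n).prod 𝓘(ℝ, ℝ)) f x (e i))
      (mfderiv (𝓡 n) ((𝓡 n).prod 𝓘(ℝ, ℝ)) f x (e j)) = if i = j then 1 else 0) →
    ∑ i, sectionShapeForm f N x (e i) (e i) = 0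

/-- Vertical helicoids in `M × ℝ`. -/
structure IsVerticalHelicoid (f : S → M × ℝ)
    (N : ∀ x : S, TangentSpace ((𝓡 n).prod 𝓘(ℝ, ℝ)) (f x)) : Prop where
  hypersurface : IsOrientedHypersurface f N
  no_horizontal_point : ∀ x, angle f N x ^ 2 ≠ 1
  angle_nonconstant : ∃ x y, angle f N x ≠ angle f N y
  minimal_sections : MinimalSections f N
  asymptotic : ∀ (x : S) (v : TangentSpace (𝓡 n) x), IsHeightGradient f x v →
    shapeForm ((𝓡 n).prod 𝓘(ℝ, ℝ)) (𝓡 n) prodMetric f N x v v = 0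

/-- `L` is an embedded smooth hypersurface of `M`: locally a regular level set. -/
def IsHypersurface (L : Set M) : Prop :=
  ∀ p ∈ L, ∃ (U : Set M) (F : M → ℝ), IsOpen U ∧ p ∈ U ∧ ContMDiffOn (𝓡 n) 𝓘(ℝ, ℝ) ∞ F U ∧
    (∀ q ∈ U, mfderiv (𝓡 n) 𝓘(ℝ, ℝ) F q ≠ 0) ∧ L ∩ U = {q ∈ U | F q = 0}

/-- `Γ_t`, `t ∈ (-ε, ε)`, is a (local) one-parameter group of isometries, each of them defined on the
open set `Ω` and mapping it isometrically (in the Riemannian sense) onto its image. -/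
structure IsLocalIsometryGroup (Ω : Set M) (ε : ℝ) (Γ : ℝ → M → M) : Prop where
  isOpen : IsOpen Ω
  smooth : ContMDiffOn (𝓘(ℝ, ℝ).prod (𝓡 n)) (𝓡 n) ∞ (fun q : ℝ × M => Γ q.1 q.2)
    (Ioo (-ε) ε ×ˢ Ω)
  injOn : ∀ t ∈ Ioo (-ε) ε, InjOn (Γ t) Ω
  isometry : ∀ t ∈ Ioo (-ε) ε, ∀ p ∈ Ω, ∀ v w : TangentSpace (𝓡 n) p,
    metric (Γ t p) (mfderiv (𝓡 n) (𝓡 n) (Γ t) p v) (mfderiv (𝓡 n) (𝓡 n) (Γ t) p w)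
      = metric p v w
  zero : ∀ p ∈ Ω, Γ 0 p = p
  add : ∀ s ∈ Ioo (-ε) ε, ∀ t ∈ Ioo (-ε) ε, s + t ∈ Ioo (-ε) ε →
    ∀ p ∈ Ω, Γ t p ∈ Ω → Γ (s + t) p = Γ s (Γ t p)

/-- The `a`-pitched twisting of `L` determined by `Γ_s`, `s ∈ (-ε, ε)`, starting at height `t₀`. -/
def pitchedTwisting (a t₀ : ℝ) (L : Set M) (ε : ℝ) (Γ : ℝ → M → M) : Set (M × ℝ) :=
  {q | ∃ p ∈ L, ∃ s ∈ Ioo (-ε) ε, q = (Γ s p, t₀ + a * s)}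

/-- The connected open piece `S'` of the hypersurface `f : S → M × ℝ` is the `1`-pitched twisting,
starting at height `t₀`, of the hypersurface `L ⊆ π_M(S')` of `M` determined by a one-parameter
group of isometries `Γ_t : π_M(S') → Γ_t(π_M(S'))`. -/
structure IsTwistingPiece (f : S → M × ℝ) (S' : Set S) (t₀ : ℝ) (L : Set M) (ε : ℝ)
    (Γ : ℝ → M → M) : Prop where
  isOpen : IsOpen S'
  isConnected : IsConnected S'
  injOn : InjOn f S'
  eps_pos : 0 < ε
  hypersurface : IsHypersurface (n := n) L
  subset : L ⊆ proj f '' S'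
  group : IsLocalIsometryGroup (n := n) (proj f '' S') ε Γ
  eq_twisting : f '' S' = pitchedTwisting 1 t₀ L ε Γ

/-- The velocity `γ'(t)` of a curve in `M`. -/
def velocity (γ : ℝ → M) (t : ℝ) : TangentSpace (𝓡 n) (γ t) :=
  mfderiv 𝓘(ℝ, ℝ) (𝓡 n) γ t (1 : ℝ)

/-- `γ` is a (nonconstant) geodesic of `M` on the interval `(-δ, δ)`: `∇_{γ'} γ' = 0`. -/
structure IsGeodesic (γ : ℝ → M) (δ : ℝ) : Prop where
  smooth : ContMDiffOn 𝓘(ℝ, ℝ) (𝓡 n) ∞ γ (Ioo (-δ) δ)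
  velocity_ne_zero : ∀ t ∈ Ioo (-δ) δ, velocity (n := n) γ t ≠ 0
  geodesic : ∀ t ∈ Ioo (-δ) δ, ∀ z : TangentSpace (𝓡 n) (γ t),
    covAlong (𝓡 n) 𝓘(ℝ, ℝ) metric γ (velocity γ) t (1 : ℝ) z = 0

end Product

end VerticalHelicoid

end

open Set Bundle
open scoped Manifold ContDiff

noncomputable section

namespace VerticalHelicoid

-- Let Y be the horizontal part of N. Since θ never vanishes, the projection of Σ to M is a local
-- diffeomorphism, so Σ is locally the graph of a function u on an open set of M. The conditions N ⊥
-- TΣ and |N| = 1 become g(Y, ·) = -θ du and |Y|² = 1 - θ², and the level sets of u are the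
-- projected horizontal sections.
--
-- The generator of the isometries is X = -θ/(1 - θ²) Y, which is ∇u/|∇u|²; in particular du(X) = 1.
-- It is a Killing field (`lieForm_killing`). On the complement of Y, L_X g is a multiple of the
-- second fundamental form of the level sets, which vanishes. Since ∇ξ = ∂_t - θN, the condition
-- ⟨A∇ξ, ∇ξ⟩ = 0 amounts to dθ(Y) = 0 (`fderiv_angle_eq_zero`); together with the derivatives of the
-- two identities for Y and the symmetry of D²u, this gives (L_X g)(·, Y) = 0.
--
-- So the flow Γ_t of X consists of isometries (`flow_isometry`) and u ∘ Γ_t = u + t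
-- (`flow_height`). The graph of u is therefore swept out from the level set L₀ = {u = t₀} by the
-- points (Γ_t(p), t₀ + t). This is `IsLocalSection.exists_isTwistingPiece`, which serves both
-- parts: it only needs the quadratic forms of the sections to vanish and some parametrization of
-- L₀. In dimension 2 the sections are curves, for which minimal, totally geodesic and geodesic mean
-- the same (`sectionShape_eq_zero_of_minimal`, `geodesic_equation`).
--
-- Two technical points shape the file. The smooth dependence of flows on the initial value is
-- proved from the inverse function theorem in a space of continuous curves
-- (`exists_contDiffOn_flow`). The connection is defined through the chart centred at the point in
-- question, so identities are proved at the centre of a chart and carried elsewhere by the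
-- naturality of the Lie derivative (`lieForm_change`).

universe u

/-! ### Smooth flows of compactly supported fields, by the inverse function theorem. -/

section Flow

open Metric Filter Topology

/-- A version of the inverse function theorem in which the local inverse is smooth on its whole
domain. -/
theorem exists_openPartialHomeomorph_contDiffOn {E F : Type*} [NormedAddCommGroup E]
    [NormedSpace ℝ E] [CompleteSpace E] [NormedAddCommGroup F] [NormedSpace ℝ F] {f : E → F}
    {s : Set E} (hs : IsOpen s) (hf : ContDiffOn ℝ ∞ f s) {a : E} (ha : a ∈ s) {e : E ≃L[ℝ] F}
    (he : HasFDerivAt f (e : E →L[ℝ] F) a) :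
    ∃ h : OpenPartialHomeomorph E F, a ∈ h.source ∧ h.source ⊆ s ∧ (∀ x, h x = f x) ∧
      ContDiffOn ℝ ∞ h.symm h.target := by
  have hfa : ContDiffAt ℝ ∞ f a := hf.contDiffAt (hs.mem_nhds ha)
  set h₀ := hfa.toOpenPartialHomeomorph f he (by simp) with hh₀
  have hcoe : ∀ x, h₀ x = f x := fun x => rfl
  -- Invertibility of the derivative is an open condition. Shrinking the source to the points where
  -- it holds makes the inverse smooth at every point of the target, not only at the image of `a`.
  set V := s ∩ (fderiv ℝ f) ⁻¹' range ((↑) : (E ≃L[ℝ] F) → E →L[ℝ] F) with hV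
  have hVo : IsOpen V :=
    (hf.continuousOn_fderiv_of_isOpen hs (by simp)).isOpen_inter_preimage hs
      ContinuousLinearEquiv.isOpen
  have haV : a ∈ V := ⟨ha, e, he.fderiv.symm⟩
  refine ⟨h₀.restrOpen V hVo, ⟨hfa.mem_toOpenPartialHomeomorph_source he (by simp), haV⟩,
    fun x hx => hx.2.1, fun x => rfl, fun z hz => ?_⟩
  have hz' := (h₀.restrOpen V hVo).map_target hz
  obtain ⟨e', he'⟩ := hz'.2.2
  have hd : ContDiffAt ℝ ∞ f ((h₀.restrOpen V hVo).symm z) :=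
    hf.contDiffAt (hs.mem_nhds hz'.2.1)
  refine ((h₀.restrOpen V hVo).contDiffAt_symm (f₀' := e') hz ?_ hd).contDiffWithinAt
  rw [he']
  exact (hd.differentiableAt (by simp)).hasFDerivAt

set_option synthInstance.maxHeartbeats 200000 in
/-- A continuous family of linear maps acts on continuous maps. -/
def familyApply (K : Type*) [TopologicalSpace K] [CompactSpace K] (E F : Type*)
    [NormedAddCommGroup E] [NormedSpace ℝ E] [NormedAddCommGroup F] [NormedSpace ℝ F] :
    C(K, E →L[ℝ] F) →L[ℝ] C(K, E) →L[ℝ] C(K, F) :=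
  LinearMap.mkContinuous₂
    (LinearMap.mk₂ ℝ (fun (A : C(K, E →L[ℝ] F)) (h : C(K, E)) =>
      (⟨fun k => A k (h k), by fun_prop⟩ : C(K, F)))
      (fun _ _ _ => by ext; simp) (fun _ _ _ => by ext; simp) (fun _ _ _ => by ext; simp)
      (fun _ _ _ => by ext; simp)) 1
    (fun A h => by
      rw [ContinuousMap.norm_le _ (by positivity)]
      intro k
      change ‖A k (h k)‖ ≤ _
      calc ‖A k (h k)‖ ≤ ‖A k‖ * ‖h k‖ := (A k).le_opNorm _
        _ ≤ ‖A‖ * ‖h‖ := by gcongr <;> exact ContinuousMap.norm_coe_le_norm _ _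
        _ = 1 * ‖A‖ * ‖h‖ := by ring)

set_option synthInstance.maxHeartbeats 200000 in
set_option synthInstance.maxHeartbeats 200000 in
/-- Postcomposition with a smooth map of compact support is differentiable on spaces of continuous
maps. -/
theorem hasFDerivAt_postcomp {K : Type*} [TopologicalSpace K] [CompactSpace K] {E F : Type*}
    [NormedAddCommGroup E] [NormedSpace ℝ E] [NormedAddCommGroup F] [NormedSpace ℝ F] {X : E → F}
    (hX : ContDiff ℝ ∞ X) (hc : HasCompactSupport X) (α : C(K, E)) :
    HasFDerivAt (fun α : C(K, E) => (⟨X, hX.continuous⟩ : C(E, F)).comp α)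
      (familyApply K E F
        ((⟨fderiv ℝ X, hX.continuous_fderiv (by simp)⟩ : C(E, E →L[ℝ] F)).comp α)) α := by
  obtain ⟨C, hC⟩ := ContDiff.lipschitzWith_of_hasCompactSupport (hc.fderiv ℝ)
    (hX.fderiv_right (m := ∞) (by simp)) (by simp)
  rw [hasFDerivAt_iff_isLittleO_nhds_zero]
  -- The remainder is O(‖h‖²) uniformly in k, because compact support makes `fderiv ℝ X` globally
  -- Lipschitz.
  refine Asymptotics.IsBigO.trans_isLittleO (g := fun h : C(K, E) => ‖h‖ ^ 2) ?_ ?_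
  · refine Asymptotics.IsBigO.of_bound C (Eventually.of_forall fun h => ?_)
    rw [ContinuousMap.norm_le _ (by positivity)]
    intro k
    have key := (convex_closedBall (α k) ‖h k‖).norm_image_sub_le_of_norm_hasFDerivWithin_le'
      (f := X) (f' := fderiv ℝ X) (φ := fderiv ℝ X (α k)) (C := C * ‖h k‖) (x := α k)
      (y := α k + h k)
      (fun x _ => (hX.differentiable (by simp) x).hasFDerivAt.hasFDerivWithinAt)
      (fun x hx => by
        rw [← dist_eq_norm]
        refine (hC.dist_le_mul _ _).trans ?_
        gcongr
        exact hx)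
      (by simp) (by simp)
    simp only [add_sub_cancel_left] at key
    have hk : ‖h k‖ ≤ ‖h‖ := ContinuousMap.norm_coe_le_norm _ _
    change ‖X (α k + h k) - X (α k) - fderiv ℝ X (α k) (h k)‖ ≤ _
    calc ‖X (α k + h k) - X (α k) - fderiv ℝ X (α k) (h k)‖ ≤ C * ‖h k‖ * ‖h k‖ := key
      _ ≤ C * ‖h‖ * ‖h‖ := by gcongr
      _ = C * ‖‖h‖ ^ 2‖ := by rw [norm_pow, norm_norm]; ring
  · have := Asymptotics.isLittleO_norm_pow_id (E' := C(K, E)) (n := 2) (by norm_num)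
    simpa using this

set_option synthInstance.maxHeartbeats 200000 in
-- The derivative of α ↦ X ∘ α is α ↦ DX ∘ α followed by the bounded linear map `familyApply`, and
-- DX is again smooth with compact support; hence induction on the order of differentiability. The
-- induction replaces F by `E →L[ℝ] F`, which is why E and F live in the same universe.
theorem contDiff_postcomp {K : Type*} [TopologicalSpace K] [CompactSpace K]
    {E : Type u} [NormedAddCommGroup E] [NormedSpace ℝ E] (n : ℕ) :
    ∀ {F : Type u} [NormedAddCommGroup F] [NormedSpace ℝ F] {X : E → F}
      (hX : ContDiff ℝ ∞ X) (_hc : HasCompactSupport X),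
      ContDiff ℝ n (fun α : C(K, E) => (⟨X, hX.continuous⟩ : C(E, F)).comp α) := by
  induction n with
  | zero =>
    intro F _ _ X hX hc
    exact contDiff_zero.2 (ContinuousMap.continuous_postcomp _)
  | succ n ih =>
    intro F _ _ X hX hc
    push_cast
    rw [contDiff_succ_iff_hasFDerivAt]
    refine ⟨_, ?_, hasFDerivAt_postcomp hX hc⟩
    exact (familyApply K E F).contDiff.comp
      (ih (hX.fderiv_right (m := ∞) (by simp)) (hc.fderiv ℝ))

/-- The operator `α ↦ ∫₀ˢ α` on continuous maps on `[-1, 1]`. -/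
def primitive (E : Type*) [NormedAddCommGroup E] [NormedSpace ℝ E] :
    C(Icc (-1 : ℝ) 1, E) →L[ℝ] C(Icc (-1 : ℝ) 1, E) :=
  LinearMap.mkContinuous
    { toFun := fun α => ⟨fun s => ∫ r in (0 : ℝ)..s, IccExtend (by norm_num : (-1 : ℝ) ≤ 1) α r,
        (intervalIntegral.continuous_primitive
          (fun a b => (α.continuous.Icc_extend' (h := by norm_num)).intervalIntegrable a b) 0).comp
          continuous_subtype_val⟩
      map_add' := fun α β => by
        ext s
        exact intervalIntegral.integral_add
          ((α.continuous.Icc_extend' (h := by norm_num)).intervalIntegrable _ _)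
          ((β.continuous.Icc_extend' (h := by norm_num)).intervalIntegrable _ _)
      map_smul' := fun c α => by
        ext s
        exact intervalIntegral.integral_smul c _ }
    1
    (fun α => by
      rw [ContinuousMap.norm_le _ (by positivity)]
      intro s
      refine (intervalIntegral.norm_integral_le_of_norm_le_const (C := ‖α‖)
        (fun r _ => ContinuousMap.norm_coe_le_norm α _)).trans ?_
      have : |(s : ℝ) - 0| ≤ 1 := by rw [sub_zero, abs_le]; exact ⟨s.2.1, s.2.2⟩
      rw [mul_comm]
      gcongr)

theorem primitive_apply {E : Type*} [NormedAddCommGroup E] [NormedSpace ℝ E]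
    (α : C(Icc (-1 : ℝ) 1, E)) (s : Icc (-1 : ℝ) 1) :
    primitive E α s = ∫ r in (0 : ℝ)..s, IccExtend (by norm_num : (-1 : ℝ) ≤ 1) α r := rfl

theorem norm_primitive_le {E : Type*} [NormedAddCommGroup E] [NormedSpace ℝ E]
    (α : C(Icc (-1 : ℝ) 1, E)) : ‖primitive E α‖ ≤ ‖α‖ := by
  have h : ‖primitive E‖ ≤ 1 := LinearMap.mkContinuous_norm_le _ (by norm_num) _
  calc ‖primitive E α‖ ≤ ‖primitive E‖ * ‖α‖ := (primitive E).le_opNorm α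
    _ ≤ 1 * ‖α‖ := by gcongr
    _ = ‖α‖ := one_mul _

/-- Constant maps, as a continuous linear map. -/
def constMap (K : Type*) [TopologicalSpace K] [CompactSpace K] (E : Type*)
    [NormedAddCommGroup E] [NormedSpace ℝ E] : E →L[ℝ] C(K, E) :=
  LinearMap.mkContinuous
    { toFun := fun y => ContinuousMap.const K y
      map_add' := fun _ _ => rfl
      map_smul' := fun _ _ => rfl } 1
    (fun y => by
      rw [ContinuousMap.norm_le _ (by positivity)]
      intro k
      exact (one_mul ‖y‖).ge)

@[simp] theorem constMap_apply {K : Type*} [TopologicalSpace K] [CompactSpace K] {E : Type*}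
    [NormedAddCommGroup E] [NormedSpace ℝ E] (y : E) (k : K) : constMap K E y k = y := rfl

/-- Solutions of the integral equation `α = y + λ ∫ X ∘ α` are unique for small `λ`. -/
theorem integralEquation_unique {E : Type*} [NormedAddCommGroup E] [NormedSpace ℝ E] {X : C(E, E)}
    {C : NNReal} (hC : LipschitzWith C X) {l : ℝ} (hl : |l| * C < 1) {y : E}
    {α β : C(Icc (-1 : ℝ) 1, E)} (hα : α = constMap _ E y + l • primitive E (X.comp α))
    (hβ : β = constMap _ E y + l • primitive E (X.comp β)) : α = β := by
  have h1 : ‖X.comp α - X.comp β‖ ≤ C * ‖α - β‖ := by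
    rw [ContinuousMap.norm_le _ (by positivity)]
    intro k
    have := hC.dist_le_mul (α k) (β k)
    rw [dist_eq_norm, dist_eq_norm] at this
    refine this.trans ?_
    gcongr
    exact ContinuousMap.norm_coe_le_norm (α - β) k
  have h2 : α - β = l • primitive E (X.comp α - X.comp β) := by
    rw [map_sub, smul_sub]
    nth_rewrite 1 [hα, hβ]
    abel
  have h3 : ‖α - β‖ ≤ |l| * C * ‖α - β‖ := by
    calc ‖α - β‖ = |l| * ‖primitive E (X.comp α - X.comp β)‖ := by
          nth_rewrite 1 [h2]; rw [norm_smul, Real.norm_eq_abs]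
      _ ≤ |l| * (C * ‖α - β‖) := by gcongr; exact (norm_primitive_le _).trans h1
      _ = _ := by ring
  have h4 : ‖α - β‖ = 0 := by nlinarith [norm_nonneg (α - β)]
  exact sub_eq_zero.1 (norm_eq_zero.1 h4)

/-- A smooth vector field of compact support has a local flow that depends smoothly on time and on
the initial value. -/
theorem exists_contDiffOn_flow {E : Type*} [NormedAddCommGroup E] [NormedSpace ℝ E]
    [CompleteSpace E] {X : E → E} (hX : ContDiff ℝ ∞ X) (hc : HasCompactSupport X) (y₀ : E) :
    ∃ a > 0, ∃ r > 0, ∃ Fl : ℝ → E → E,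
      ContDiffOn ℝ ∞ (fun q : ℝ × E => Fl q.1 q.2) (Ioo (-a) a ×ˢ ball y₀ r) ∧
      (∀ y ∈ ball y₀ r, Fl 0 y = y) ∧
      ∀ y ∈ ball y₀ r, ∀ t ∈ Ioo (-a) a, HasDerivAt (fun t => Fl t y) (X (Fl t y)) t := by
  set XC : C(E, E) := ⟨X, hX.continuous⟩ with hXC
  obtain ⟨C, hC⟩ := ContDiff.lipschitzWith_of_hasCompactSupport hc hX (by simp)
  let K := Icc (-1 : ℝ) 1
  -- The equation for α on [-1, 1] is α' = λ X(α), α(0) = y, in integrated form: T(λ, y, α) = (λ, y,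
  -- 0). Rescaling time turns the time of the flow into the parameter λ, so that smoothness in both
  -- λ and y comes from inverting T near λ = 0.
  let T : (ℝ × E) × C(K, E) → (ℝ × E) × C(K, E) := fun z =>
    (z.1, z.2 - constMap K E z.1.2 - z.1.1 • primitive E (XC.comp z.2))
  have hN : ContDiff ℝ ∞ (fun α : C(K, E) => XC.comp α) :=
    contDiff_infty.2 fun n => contDiff_postcomp n hX hc
  have hT : ContDiff ℝ ∞ T := by
    refine contDiff_fst.prodMk ((contDiff_snd.sub
      ((constMap K E).contDiff.comp (contDiff_snd.comp contDiff_fst))).sub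
      ((contDiff_fst.comp contDiff_fst).smul
        ((primitive E).contDiff.comp (hN.comp contDiff_snd))))
  set P₀ := primitive E (XC.comp (constMap K E y₀)) with hP₀
  let z₀ : (ℝ × E) × C(K, E) := ((0, y₀), constMap K E y₀)
  let L₀ : (ℝ × E) →L[ℝ] C(K, E) :=
    (constMap K E).comp (ContinuousLinearMap.snd ℝ ℝ E) +
      (ContinuousLinearMap.fst ℝ ℝ E).smulRight P₀
  let p₁ := ContinuousLinearMap.fst ℝ (ℝ × E) C(K, E)
  let p₂ := ContinuousLinearMap.snd ℝ (ℝ × E) C(K, E)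
  -- At λ = 0 the nonlinear term contributes only through its factor λ, so the derivative of T is
  -- (l, v, h) ↦ (l, v, h - v - l P₀), a triangular map with an explicit inverse.
  let e : ((ℝ × E) × C(K, E)) ≃L[ℝ] ((ℝ × E) × C(K, E)) :=
    ContinuousLinearEquiv.equivOfInverse (p₁.prod (p₂ - L₀.comp p₁)) (p₁.prod (p₂ + L₀.comp p₁))
      (fun z => by ext <;> simp [p₁, p₂]) (fun z => by ext <;> simp [p₁, p₂])
  have he : HasFDerivAt T (e : _ →L[ℝ] _) z₀ := by
    have h1 : HasFDerivAt (fun z : (ℝ × E) × C(K, E) => primitive E (XC.comp z.2))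
        (fderiv ℝ (fun z : (ℝ × E) × C(K, E) => primitive E (XC.comp z.2)) z₀) z₀ :=
      (((primitive E).contDiff.comp (hN.comp contDiff_snd)).differentiable (by simp)
        z₀).hasFDerivAt
    have h2 : HasFDerivAt (fun z : (ℝ × E) × C(K, E) => z.1.1)
        ((ContinuousLinearMap.fst ℝ ℝ E).comp p₁) z₀ :=
      ((ContinuousLinearMap.fst ℝ ℝ E).comp p₁).hasFDerivAt
    have h3 : HasFDerivAt (fun z : (ℝ × E) × C(K, E) => constMap K E z.1.2)
        ((constMap K E).comp ((ContinuousLinearMap.snd ℝ ℝ E).comp p₁)) z₀ :=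
      ((constMap K E).comp ((ContinuousLinearMap.snd ℝ ℝ E).comp p₁)).hasFDerivAt
    refine (p₁.hasFDerivAt.prodMk ((p₂.hasFDerivAt.sub h3).sub (h2.smul h1))).congr_fderiv ?_
    apply ContinuousLinearMap.ext
    rintro ⟨⟨l, v⟩, h⟩
    simp [e, p₁, p₂, L₀, z₀, P₀, sub_sub]
  obtain ⟨h, hz₀, -, hh, hsymm⟩ := exists_openPartialHomeomorph_contDiffOn isOpen_univ
    hT.contDiffOn (mem_univ z₀) he
  have hT₀ : T z₀ = ((0, y₀), 0) := by simp [T, z₀]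
  have hmem : ∀ᶠ q : ℝ × E in 𝓝 (0, y₀), (q, (0 : C(K, E))) ∈ h.target := by
    have hc : ContinuousAt (fun q : ℝ × E => (q, (0 : C(K, E)))) (0, y₀) := by fun_prop
    refine hc.eventually (h.open_target.mem_nhds ?_)
    have := h.map_source hz₀
    rwa [hh, hT₀] at this
  have hsmall : ∀ᶠ q : ℝ × E in 𝓝 (0, y₀), |q.1| * C < 1 := by
    have hc : ContinuousAt (fun q : ℝ × E => |q.1| * (C : ℝ)) (0, y₀) := by fun_prop
    exact hc.eventually (Iio_mem_nhds (by simp))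
  obtain ⟨r, hr, hball⟩ := Metric.eventually_nhds_iff_ball.1 (hmem.and hsmall)
  have hbox : ∀ l ∈ Ioo (-r) r, ∀ y ∈ ball y₀ r,
      ((l, y), (0 : C(K, E))) ∈ h.target ∧ |l| * C < 1 := by
    intro l hl y hy
    refine hball (l, y) ?_
    rw [← ball_prod_same]
    exact ⟨by rw [mem_ball_zero_iff, Real.norm_eq_abs, abs_lt]; exact hl, hy⟩
  let α : ℝ × E → C(K, E) := fun q => (h.symm (q, 0)).2
  have hα : ∀ l ∈ Ioo (-r) r, ∀ y ∈ ball y₀ r,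
      α (l, y) = constMap K E y + l • primitive E (XC.comp (α (l, y))) := by
    intro l hl y hy
    have h1 := h.right_inv (hbox l hl y hy).1
    rw [hh] at h1
    have h2 : (h.symm ((l, y), 0)).1 = (l, y) := congrArg Prod.fst h1
    have h3 := congrArg Prod.snd h1
    simp only [T, h2] at h3
    rw [sub_sub, sub_eq_zero] at h3
    exact h3
  have hn1 : (1 : ℝ) ∈ K := by simp [K]
  have hle : (-1 : ℝ) ≤ 1 := by norm_num
  have hextend : ∀ β : C(K, E), Continuous (IccExtend hle (XC.comp β)) :=
    fun β => (XC.comp β).continuous.Icc_extend'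
  -- The solution with parameter sl at time 1 is the solution with parameter l at time s: both solve
  -- the integral equation with parameter sl, whose solution is unique for small parameters. The
  -- interval [-1, 1] allows negative s as well.
  have hscale : ∀ l ∈ Ioo (-r) r, ∀ y ∈ ball y₀ r, ∀ s : K,
      α (s * l, y) ⟨1, hn1⟩ = α (l, y) s := by
    intro l hl y hy s
    have hs : |(s : ℝ)| ≤ 1 := abs_le.2 ⟨s.2.1, s.2.2⟩
    have hsl : |(s : ℝ) * l| ≤ |l| := by
      rw [abs_mul]; exact mul_le_of_le_one_left (abs_nonneg l) hs
    have hsl' : (s : ℝ) * l ∈ Ioo (-r) r := abs_lt.1 (hsl.trans_lt (abs_lt.2 hl))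
    have hmul : ∀ k : K, (s : ℝ) * k ∈ K := fun k => abs_le.1 (by
      rw [abs_mul]; exact mul_le_one₀ hs (abs_nonneg _) (abs_le.2 ⟨k.2.1, k.2.2⟩))
    let β : C(K, E) := ⟨fun k => α (l, y) ⟨s * k, hmul k⟩, by fun_prop⟩
    have hβ : β = constMap K E y + ((s : ℝ) * l) • primitive E (XC.comp β) := by
      ext k
      have h1 := congrArg (fun γ : C(K, E) => γ ⟨s * k, hmul k⟩) (hα l hl y hy)
      have h2 : primitive E (XC.comp (α (l, y))) ⟨s * k, hmul k⟩
          = (s : ℝ) • primitive E (XC.comp β) k := by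
        rw [primitive_apply, primitive_apply]
        have := intervalIntegral.smul_integral_comp_mul_left (a := 0) (b := (k : ℝ))
          (IccExtend hle (XC.comp (α (l, y)))) (s : ℝ)
        rw [mul_zero] at this
        rw [← this]
        congr 1
        refine intervalIntegral.integral_congr fun x hx => ?_
        have hx' : x ∈ K := by
          have h0 : (0 : ℝ) ∈ K := by simp [K]
          exact (Set.uIcc_subset_Icc h0 k.2) hx
        have hsx : (s : ℝ) * x ∈ K := hmul ⟨x, hx'⟩
        simp only [IccExtend_of_mem hle _ hx', IccExtend_of_mem hle _ hsx]
        rfl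
      have h3 : β k = α (l, y) ⟨s * k, hmul k⟩ := rfl
      simp only [ContinuousMap.add_apply, ContinuousMap.smul_apply, constMap_apply] at h1 ⊢
      rw [h3, h1, h2, smul_smul, mul_comm l]
    have hunique := integralEquation_unique hC (hbox _ hsl' y hy).2 (hα _ hsl' y hy) hβ
    rw [hunique]
    change α (l, y) ⟨s * 1, _⟩ = _
    congr 1
    exact Subtype.ext (mul_one _)
  -- The flow at time t is the solution with parameter t, evaluated at 1. Halving r makes the single
  -- parameter r/2 admissible, and all times |t| < r/2 are then read off from that one solution at
  -- t/(r/2), to which the fundamental theorem of calculus applies.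
  refine ⟨r / 2, by positivity, r, hr, fun t y => α (t, y) ⟨1, hn1⟩, ?_, ?_, ?_⟩
  · have h1 : ContDiffOn ℝ ∞ (fun q : ℝ × E => h.symm (q, (0 : C(K, E))))
        (Ioo (-(r / 2)) (r / 2) ×ˢ ball y₀ r) := by
      refine hsymm.comp (contDiff_id.prodMk contDiff_const).contDiffOn ?_
      rintro ⟨l, y⟩ ⟨hl, hy⟩
      exact (hbox l ⟨by linarith [hl.1], by linarith [hl.2]⟩ y hy).1
    exact (ContinuousMap.evalCLM ℝ (⟨1, hn1⟩ : K)).contDiff.comp_contDiffOn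
      (contDiff_snd.comp_contDiffOn h1)
  · intro y hy
    have h1 := hα 0 ⟨by linarith, hr⟩ y hy
    rw [zero_smul, add_zero] at h1
    change α (0, y) _ = y
    rw [h1]
    rfl
  · intro y hy t ht
    have hr2 : r / 2 ∈ Ioo (-r) r := ⟨by linarith, by linarith⟩
    set β := α (r / 2, y) with hβ
    have hFl : ∀ τ ∈ Ioo (-(r / 2)) (r / 2), α (τ, y) ⟨1, hn1⟩
        = y + (r / 2) • ∫ x in (0 : ℝ)..(τ / (r / 2)), IccExtend hle (XC.comp β) x := by
      intro τ hτ
      have hτ' : τ / (r / 2) ∈ K := by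
        constructor
        · rw [le_div_iff₀ (by positivity)]; linarith [hτ.1]
        · rw [div_le_iff₀ (by positivity)]; linarith [hτ.2]
      have h1 := hscale _ hr2 y hy ⟨_, hτ'⟩
      rw [show τ / (r / 2) * (r / 2) = τ by field_simp] at h1
      rw [h1, hα _ hr2 y hy]
      rfl
    have ht' : t / (r / 2) ∈ K := by
      constructor
      · rw [le_div_iff₀ (by positivity)]; linarith [ht.1]
      · rw [div_le_iff₀ (by positivity)]; linarith [ht.2]
    have hval : X (α (t, y) ⟨1, hn1⟩) = IccExtend hle (XC.comp β) (t / (r / 2)) := by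
      have h1 := hscale _ hr2 y hy ⟨_, ht'⟩
      rw [show t / (r / 2) * (r / 2) = t by field_simp] at h1
      rw [h1, IccExtend_of_mem hle _ ht']
      rfl
    have hd := intervalIntegral.integral_hasDerivAt_right
      ((hextend β).intervalIntegrable 0 (t / (r / 2)))
      ((hextend β).stronglyMeasurableAtFilter _ _) (hextend β).continuousAt
    have hd2 := hd.scomp t ((hasDerivAt_id t).div_const (r / 2))
    have hd3 := (hd2.const_smul (r / 2)).const_add y
    rw [smul_smul, show r / 2 * (1 / (r / 2)) = 1 by field_simp, one_smul, ← hval] at hd3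
    refine hd3.congr_of_eventuallyEq ?_
    filter_upwards [Ioo_mem_nhds ht.1 ht.2] with τ hτ
    exact hFl τ hτ

end Flow

/-! ### Local flows, Lie derivatives and the Killing equation in coordinates. -/

section Calculus

set_option synthInstance.maxHeartbeats 200000
set_option maxHeartbeats 1000000

open Metric Filter Topology

variable {E : Type*} [NormedAddCommGroup E] [NormedSpace ℝ E]

/-- A smooth vector field on an open set of a finite-dimensional space has a smooth local flow. -/
theorem exists_local_flow [FiniteDimensional ℝ E] {X : E → E} {U : Set E} (hU : IsOpen U)
    (hX : ContDiffOn ℝ ∞ X U) {y₀ : E} (hy₀ : y₀ ∈ U) :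
    ∃ a > 0, ∃ r > 0, ∃ Fl : ℝ → E → E, ball y₀ r ⊆ U ∧
      ContDiffOn ℝ ∞ (fun q : ℝ × E => Fl q.1 q.2) (Ioo (-a) a ×ˢ ball y₀ r) ∧
      (∀ y ∈ ball y₀ r, Fl 0 y = y) ∧
      (∀ y ∈ ball y₀ r, ∀ t ∈ Ioo (-a) a, Fl t y ∈ U) ∧
      (∀ y ∈ ball y₀ r, ∀ t ∈ Ioo (-a) a, HasDerivAt (fun t => Fl t y) (X (Fl t y)) t) ∧
      (∀ y ∈ ball y₀ r, ∀ s ∈ Ioo (-a) a, ∀ t ∈ Ioo (-a) a, s + t ∈ Ioo (-a) a →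
        Fl t y ∈ ball y₀ r → Fl (s + t) y = Fl s (Fl t y)) ∧
      ∀ t ∈ Ioo (-a) a, InjOn (Fl t) (ball y₀ r) := by
  have : CompleteSpace E := FiniteDimensional.complete ℝ E
  obtain ⟨R, hR, hRU⟩ := nhds_basis_closedBall.mem_iff.1 (hU.mem_nhds hy₀)
  -- The field is cut off to be globally Lipschitz without change on the ball of radius R/2. Below,
  -- `a'` and `r'` are so small that orbits stay in that ball, where both fields agree.
  let b : ContDiffBump y₀ := ⟨R / 2, R, by positivity, by linarith⟩
  let X' : E → E := fun y => b y • X y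
  have hX' : ContDiff ℝ ∞ X' := by
    rw [contDiff_iff_contDiffAt]
    intro y
    by_cases hy : y ∈ U
    · exact b.contDiff.contDiffAt.smul (hX.contDiffAt (hU.mem_nhds hy))
    · have h0 : ∀ᶠ z in 𝓝 y, X' z = 0 := by
        have hyc : y ∈ (closedBall y₀ R)ᶜ := fun h => hy (hRU h)
        filter_upwards [isClosed_closedBall.isOpen_compl.mem_nhds hyc] with z hz
        have : b z = 0 := b.zero_of_le_dist (by
          have : ¬ dist z y₀ ≤ R := hz
          exact (not_le.1 this).le)
        simp [X', this]
      exact contDiffAt_const.congr_of_eventuallyEq h0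
  have hc' : HasCompactSupport X' := b.hasCompactSupport.smul_right
  have hXX' : ∀ y ∈ ball y₀ (R / 2), X' y = X y := by
    intro y hy
    simp [X', b.one_of_mem_closedBall (ball_subset_closedBall hy)]
  obtain ⟨C, hC⟩ := ContDiff.lipschitzWith_of_hasCompactSupport hc' hX' (by simp)
  obtain ⟨a, ha, r, hr, Fl, hsm, h0, hd⟩ := exists_contDiffOn_flow hX' hc' y₀
  have hcont : ContinuousAt (fun q : ℝ × E => Fl q.1 q.2) (0, y₀) := by
    refine hsm.continuousOn.continuousAt ?_
    exact prod_mem_nhds (Ioo_mem_nhds (by linarith) ha) (ball_mem_nhds _ hr)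
  have hev : ∀ᶠ q : ℝ × E in 𝓝 (0, y₀), Fl q.1 q.2 ∈ ball y₀ (R / 2) := by
    refine hcont.eventually ?_
    simp only [h0 y₀ (mem_ball_self hr)]
    exact ball_mem_nhds _ (by positivity)
  obtain ⟨ρ, hρ, hball⟩ := Metric.eventually_nhds_iff_ball.1 hev
  set a' := min a ρ with ha'
  set r' := min r (min ρ (R / 2)) with hr'
  have ha'0 : 0 < a' := lt_min ha hρ
  have hr'0 : 0 < r' := lt_min hr (lt_min hρ (by positivity))
  have hIoo : Ioo (-a') a' ⊆ Ioo (-a) a :=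
    Ioo_subset_Ioo (neg_le_neg (min_le_left _ _)) (min_le_left _ _)
  have hbr : ball y₀ r' ⊆ ball y₀ r := ball_subset_ball (min_le_left _ _)
  have hin : ∀ y ∈ ball y₀ r', ∀ t ∈ Ioo (-a') a', Fl t y ∈ ball y₀ (R / 2) := by
    intro y hy t ht
    refine hball (t, y) ?_
    rw [← ball_prod_same]
    refine ⟨?_, ball_subset_ball ((min_le_right _ _).trans (min_le_left _ _)) hy⟩
    rw [mem_ball_zero_iff, Real.norm_eq_abs, abs_lt]
    exact ⟨by linarith [ht.1, min_le_right a ρ], by linarith [ht.2, min_le_right a ρ]⟩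
  have hhalf : ball y₀ (R / 2) ⊆ U := fun y hy => hRU (ball_subset_closedBall
    (ball_subset_ball (by linarith) hy))
  have hbU : ball y₀ r' ⊆ ball y₀ (R / 2) :=
    ball_subset_ball ((min_le_right _ _).trans (min_le_right _ _))
  have huniq : ∀ (f g : ℝ → E) (A B t₀ : ℝ), t₀ ∈ Ioo A B →
      (∀ t ∈ Ioo A B, HasDerivAt f (X' (f t)) t) → (∀ t ∈ Ioo A B, HasDerivAt g (X' (g t)) t) →
      f t₀ = g t₀ → EqOn f g (Ioo A B) := by
    intro f g A B t₀ ht₀ hf hg hfg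
    exact ODE_solution_unique_of_mem_Ioo (v := fun _ => X') (s := fun _ => univ) (K := C)
      (fun t _ => hC.lipschitzOnWith) ht₀ (fun t ht => ⟨hf t ht, mem_univ _⟩)
      (fun t ht => ⟨hg t ht, mem_univ _⟩) hfg
  refine ⟨a', ha'0, r', hr'0, Fl, hbU.trans hhalf, hsm.mono (prod_mono hIoo hbr),
    fun y hy => h0 y (hbr hy), fun y hy t ht => hhalf (hin y hy t ht), ?_, ?_, ?_⟩
  · intro y hy t ht
    rw [← hXX' _ (hin y hy t ht)]
    exact hd y (hbr hy) t (hIoo ht)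
  · intro y hy s hs t ht hst hFt
    -- The interval consists of the τ with both τ and τ + t in (-a', a'), so both orbits are defined
    -- on it. They agree at τ = 0.
    have key := huniq (fun τ => Fl (τ + t) y) (fun τ => Fl τ (Fl t y))
      (max (-a') (-a' - t)) (min a' (a' - t)) 0
      ⟨max_lt (by linarith) (by linarith [ht.1]), lt_min ha'0 (by linarith [ht.2])⟩
      (fun τ hτ => by
        have h1 : τ + t ∈ Ioo (-a') a' :=
          ⟨by linarith [(max_lt_iff.1 hτ.1).2], by linarith [(lt_min_iff.1 hτ.2).2]⟩
        exact (hd y (hbr hy) (τ + t) (hIoo h1)).comp_add_const τ t)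
      (fun τ hτ => hd _ (hbr hFt) τ (hIoo ⟨(max_lt_iff.1 hτ.1).1, (lt_min_iff.1 hτ.2).1⟩))
      (by simp only [zero_add]; exact (h0 _ (hbr hFt)).symm)
    exact key ⟨max_lt hs.1 (by linarith [hst.1]), lt_min hs.2 (by linarith [hst.2])⟩
  · intro t ht y hy z hz hyz
    have key := huniq (fun τ => Fl τ y) (fun τ => Fl τ z) (-a') a' t ht
      (fun τ hτ => hd y (hbr hy) τ (hIoo hτ)) (fun τ hτ => hd z (hbr hz) τ (hIoo hτ)) hyz
    have := key (x := 0) ⟨by linarith, ha'0⟩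
    simpa [h0 y (hbr hy), h0 z (hbr hz)] using this

/-- The Lie derivative `(L_X G)(a, b)` at `y` of the bilinear form `G` along `X`, in coordinates. -/
def lieForm (G : E → E →L[ℝ] E →L[ℝ] ℝ) (X : E → E) (y a b : E) : ℝ :=
  fderiv ℝ G y (X y) a b + G y (fderiv ℝ X y a) b + G y a (fderiv ℝ X y b)

/-- The Christoffel symbols of the first kind, in coordinates. -/
def chris (G : E → E →L[ℝ] E →L[ℝ] ℝ) (y u w z : E) : ℝ :=
  (fderiv ℝ G y u w z + fderiv ℝ G y w u z - fderiv ℝ G y z u w) / 2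

theorem hasFDerivAt_bilin {F : Type*} [NormedAddCommGroup F] [NormedSpace ℝ F]
    {G : F → E →L[ℝ] E →L[ℝ] ℝ} {V W : F → E} {y : F}
    (hG : DifferentiableAt ℝ G y) (hV : DifferentiableAt ℝ V y) (hW : DifferentiableAt ℝ W y)
    (a : F) : fderiv ℝ (fun z => G z (V z) (W z)) y a
      = fderiv ℝ G y a (V y) (W y) + G y (fderiv ℝ V y a) (W y) + G y (V y) (fderiv ℝ W y a) := by
  have h := ((hG.hasFDerivAt.clm_apply hV.hasFDerivAt).clm_apply hW.hasFDerivAt).fderiv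
  rw [h]
  simp
  ring

theorem hasDerivAt_bilin {G : E → E →L[ℝ] E →L[ℝ] ℝ} {c V W : ℝ → E} {c' V' W' : E} {t : ℝ}
    (hG : DifferentiableAt ℝ G (c t)) (hc : HasDerivAt c c' t) (hV : HasDerivAt V V' t)
    (hW : HasDerivAt W W' t) : HasDerivAt (fun s => G (c s) (V s) (W s))
      (fderiv ℝ G (c t) c' (V t) (W t) + G (c t) V' (W t) + G (c t) (V t) W') t := by
  have h1 : HasDerivAt (fun s => G (c s)) (fderiv ℝ G (c t) c') t :=
    HasFDerivAt.comp_hasDerivAt (l := G) t hG.hasFDerivAt hc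
  have h := (h1.clm_apply hV).clm_apply hW
  refine h.congr_deriv ?_
  simp

/-- The flow of a Killing field consists of isometries. -/
theorem flow_isometry {G : E → E →L[ℝ] E →L[ℝ] ℝ} {X : E → E} {U B : Set E} {a : ℝ}
    {Fl : ℝ → E → E} (hU : IsOpen U) (hB : IsOpen B) (hG : DifferentiableOn ℝ G U)
    (hX : DifferentiableOn ℝ X U) (hK : ∀ y ∈ U, ∀ v w, lieForm G X y v w = 0)
    (hsm : ContDiffOn ℝ ∞ (fun q : ℝ × E => Fl q.1 q.2) (Ioo (-a) a ×ˢ B))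
    (h0 : ∀ y ∈ B, Fl 0 y = y) (hin : ∀ y ∈ B, ∀ t ∈ Ioo (-a) a, Fl t y ∈ U)
    (hd : ∀ y ∈ B, ∀ t ∈ Ioo (-a) a, HasDerivAt (fun t => Fl t y) (X (Fl t y)) t)
    {t : ℝ} (ht : t ∈ Ioo (-a) a) {y : E} (hy : y ∈ B) (v w : E) :
    G (Fl t y) (fderiv ℝ (Fl t) y v) (fderiv ℝ (Fl t) y w) = G y v w := by
  set F : ℝ × E → E := fun q => Fl q.1 q.2 with hF
  have hO : IsOpen (Ioo (-a) a ×ˢ B) := isOpen_Ioo.prod hB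
  have hFat : ∀ s ∈ Ioo (-a) a, ∀ z ∈ B, ContDiffAt ℝ ∞ F (s, z) :=
    fun s hs z hz => hsm.contDiffAt (hO.mem_nhds ⟨hs, hz⟩)
  have hFd : ∀ s ∈ Ioo (-a) a, ∀ z ∈ B, HasFDerivAt F (fderiv ℝ F (s, z)) (s, z) :=
    fun s hs z hz => ((hFat s hs z hz).differentiableAt (by simp)).hasFDerivAt
  have hpart : ∀ s ∈ Ioo (-a) a, ∀ v, fderiv ℝ (Fl s) y v = fderiv ℝ F (s, y) (0, v) := by
    intro s hs v
    have h1 : HasFDerivAt (fun z : E => (s, z)) (ContinuousLinearMap.inr ℝ ℝ E) y :=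
      hasFDerivAt_prodMk_right s y
    have h2 := ((hFd s hs y hy).comp y h1).fderiv
    have h3 : fderiv ℝ (Fl s) y = (fderiv ℝ F (s, y)).comp (ContinuousLinearMap.inr ℝ ℝ E) := h2
    rw [h3]
    simp
  have htime : ∀ s ∈ Ioo (-a) a, ∀ z ∈ B, fderiv ℝ F (s, z) (1, 0) = X (F (s, z)) := by
    intro s hs z hz
    have h1 : HasDerivAt (fun τ : ℝ => (τ, z)) ((1, 0) : ℝ × E) s :=
      (hasDerivAt_id s).prodMk (hasDerivAt_const s z)
    have h2 : HasDerivAt (fun τ : ℝ => Fl τ z) (fderiv ℝ F (s, z) (1, 0)) s :=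
      HasFDerivAt.comp_hasDerivAt (f := fun τ : ℝ => (τ, z)) s (hFd s hs z hz) h1
    exact h2.unique (hd z hz s hs)
  have hvar : ∀ s ∈ Ioo (-a) a, ∀ v, HasDerivAt (fun τ => fderiv ℝ F (τ, y) (0, v))
      (fderiv ℝ X (Fl s y) (fderiv ℝ F (s, y) (0, v))) s := by
    intro s hs v
    have hFF : DifferentiableAt ℝ (fderiv ℝ F) (s, y) :=
      ((hFat s hs y hy).fderiv_right (m := ∞) (by simp)).differentiableAt (by simp)
    have h1 : HasDerivAt (fun τ : ℝ => (τ, y)) ((1, 0) : ℝ × E) s :=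
      (hasDerivAt_id s).prodMk (hasDerivAt_const s y)
    have h1' : HasDerivAt (fun τ : ℝ => fderiv ℝ F (τ, y))
        (fderiv ℝ (fderiv ℝ F) (s, y) (1, 0)) s :=
      HasFDerivAt.comp_hasDerivAt (f := fun τ : ℝ => (τ, y)) s hFF.hasFDerivAt h1
    have h2 := h1'.clm_apply (hasDerivAt_const s ((0, v) : ℝ × E))
    refine h2.congr_deriv ?_
    -- The mixed derivatives in time and space commute, and the time derivative of the flow is X
    -- along the flow. This yields the variational equation d/ds DFl_s(v) = DX(DFl_s(v)).
    have hsymm := (((hFat s hs y hy).of_le (m := 2) (WithTop.coe_le_coe.2 le_top)).isSymmSndFDerivAt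
      (by simp)).eq (1, 0) (0, v)
    rw [map_zero, add_zero, hsymm]
    have h3 : (fun q => fderiv ℝ F q (1, 0)) =ᶠ[𝓝 (s, y)] fun q => X (F q) := by
      filter_upwards [hO.mem_nhds (show (s, y) ∈ _ from ⟨hs, hy⟩)] with q hq
      exact htime q.1 hq.1 q.2 hq.2
    have h4 := h3.fderiv_eq (𝕜 := ℝ)
    have hXd : DifferentiableAt ℝ X (F (s, y)) :=
      (hX _ (hin y hy s hs)).differentiableAt (hU.mem_nhds (hin y hy s hs))
    have h5 : HasFDerivAt (fun q => X (F q))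
        ((fderiv ℝ X (F (s, y))).comp (fderiv ℝ F (s, y))) (s, y) :=
      hXd.hasFDerivAt.comp _ (hFd s hs y hy)
    rw [h5.fderiv] at h4
    have h6 := (hFF.hasFDerivAt.clm_apply (hasFDerivAt_const ((1, 0) : ℝ × E) (s, y))).fderiv
    rw [h6] at h4
    have h7 := congrArg (fun A : ℝ × E →L[ℝ] E => A (0, v)) h4
    simpa using h7
  let φ : ℝ → ℝ := fun s => G (Fl s y) (fderiv ℝ F (s, y) (0, v)) (fderiv ℝ F (s, y) (0, w))
  have hφ : ∀ s ∈ Ioo (-a) a, HasDerivAt φ 0 s := by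
    intro s hs
    have hGd : DifferentiableAt ℝ G (Fl s y) :=
      (hG _ (hin y hy s hs)).differentiableAt (hU.mem_nhds (hin y hy s hs))
    -- By the product rule and the variational equation, the derivative of the pulled back metric is
    -- the Lie form of X on the transported vectors.
    refine (hasDerivAt_bilin hGd (hd y hy s hs) (hvar s hs v) (hvar s hs w)).congr_deriv ?_
    exact hK _ (hin y hy s hs) _ _
  have h0a : (0 : ℝ) ∈ Ioo (-a) a := by
    have := ht.1.trans ht.2
    exact ⟨by linarith, by linarith⟩
  have hconst : φ t = φ 0 := isOpen_Ioo.is_const_of_deriv_eq_zero isPreconnected_Ioo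
    (fun s hs => (hφ s hs).differentiableAt.differentiableWithinAt)
    (fun s hs => (hφ s hs).deriv) ht h0a
  have hid : ∀ v, fderiv ℝ F (0, y) (0, v) = v := by
    intro v
    rw [← hpart 0 h0a]
    have : Fl 0 =ᶠ[𝓝 y] id := by
      filter_upwards [hB.mem_nhds hy] with z hz using h0 z hz
    rw [this.fderiv_eq]
    simp
  rw [hpart t ht, hpart t ht]
  change φ t = _
  rw [hconst]
  simp only [φ, hid, h0 y hy]

/-- Lie derivatives of bilinear forms are compatible with changes of coordinates. -/
theorem lieForm_change {G G' : E → E →L[ℝ] E →L[ℝ] ℝ} {X X' : E → E} {τ : E → E} {y : E}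
    (hτ : ContDiffAt ℝ 2 τ y) (hG' : DifferentiableAt ℝ G' (τ y)) (hX : DifferentiableAt ℝ X y)
    (hG : DifferentiableAt ℝ G y)
    (hX' : DifferentiableAt ℝ X' (τ y))
    (hGG' : ∀ᶠ z in 𝓝 y, ∀ a b, G z a b = G' (τ z) (fderiv ℝ τ z a) (fderiv ℝ τ z b))
    (hXX' : ∀ᶠ z in 𝓝 y, X' (τ z) = fderiv ℝ τ z (X z)) (a b : E) :
    lieForm G X y a b = lieForm G' X' (τ y) (fderiv ℝ τ y a) (fderiv ℝ τ y b) := by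
  have hτd : DifferentiableAt ℝ τ y := hτ.differentiableAt (by simp)
  have hττ : DifferentiableAt ℝ (fderiv ℝ τ) y :=
    (hτ.fderiv_right (m := 1) (by norm_num)).differentiableAt (by simp)
  have hsymm := (hτ.isSymmSndFDerivAt (by simp)).eq
  have hGτ : HasFDerivAt (fun z => G' (τ z)) ((fderiv ℝ G' (τ y)).comp (fderiv ℝ τ y)) y :=
    HasFDerivAt.comp (g := G') y hG'.hasFDerivAt hτd.hasFDerivAt
  have happ : ∀ a, HasFDerivAt (fun z => fderiv ℝ τ z a) ((fderiv ℝ (fderiv ℝ τ) y).flip a) y := by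
    intro a
    refine (hττ.hasFDerivAt.clm_apply (hasFDerivAt_const a y)).congr_fderiv ?_
    ext v
    simp
  have e1 : ∀ v, fderiv ℝ G y v a b = fderiv ℝ G' (τ y) (fderiv ℝ τ y v) (fderiv ℝ τ y a)
      (fderiv ℝ τ y b) + G' (τ y) (fderiv ℝ (fderiv ℝ τ) y v a) (fderiv ℝ τ y b)
      + G' (τ y) (fderiv ℝ τ y a) (fderiv ℝ (fderiv ℝ τ) y v b) := by
    intro v
    have h1 : fderiv ℝ (fun z => G z a b) y v = fderiv ℝ G y v a b := by
      rw [hasFDerivAt_bilin hG (differentiableAt_const a) (differentiableAt_const b)]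
      simp
    have h2 : (fun z => G z a b) =ᶠ[𝓝 y]
        fun z => G' (τ z) (fderiv ℝ τ z a) (fderiv ℝ τ z b) := by
      filter_upwards [hGG'] with z hz using hz a b
    rw [← h1, h2.fderiv_eq, hasFDerivAt_bilin (G := fun z => G' (τ z)) hGτ.differentiableAt
      (happ a).differentiableAt (happ b).differentiableAt, hGτ.fderiv, (happ a).fderiv,
      (happ b).fderiv]
    simp
  have e2 : ∀ v, fderiv ℝ X' (τ y) (fderiv ℝ τ y v)
      = fderiv ℝ (fderiv ℝ τ) y v (X y) + fderiv ℝ τ y (fderiv ℝ X y v) := by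
    intro v
    have h1 : HasFDerivAt (fun z => X' (τ z)) ((fderiv ℝ X' (τ y)).comp (fderiv ℝ τ y)) y :=
      hX'.hasFDerivAt.comp y hτd.hasFDerivAt
    have h2 := hττ.hasFDerivAt.clm_apply hX.hasFDerivAt
    have hE : (fun z => X' (τ z)) =ᶠ[𝓝 y] fun z => fderiv ℝ τ z (X z) := hXX'
    have h3 := hE.fderiv_eq (𝕜 := ℝ)
    rw [h1.fderiv, h2.fderiv] at h3
    have h4 := congrArg (fun A : E →L[ℝ] E => A v) h3
    simpa [add_comm] using h4
  have e3 : X' (τ y) = fderiv ℝ τ y (X y) := hXX'.self_of_nhds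
  have e0 := hGG'.self_of_nhds
  unfold lieForm
  -- The second derivatives of τ coming from G = τ*G' and from the relation between the fields occur
  -- in pairs D²τ(X, a) and D²τ(a, X), and cancel by symmetry.
  rw [e1, e2, e2, e3, e0, e0, hsymm (X y) a, hsymm (X y) b]
  simp only [map_add, add_apply]
  ring

/-- The field `-θ / (1 - θ²) Y`, written in coordinates. -/
def killing (θ : E → ℝ) (Y : E → E) : E → E := fun z => (-θ z / (1 - θ z ^ 2)) • Y z

/-- If `g(Y, ·) = -θ du`, `|Y|² = 1 - θ²`, `θ` is constant along `Y`, and `L_Y g` vanishes on the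
orthogonal complement of `Y`, then `-θ / (1 - θ²) Y` is a Killing field. -/
theorem lieForm_killing {G : E → E →L[ℝ] E →L[ℝ] ℝ} {Y : E → E} {θ u : E → ℝ} {y : E}
    (hG : DifferentiableAt ℝ G y) (hY : DifferentiableAt ℝ Y y) (hθ : DifferentiableAt ℝ θ y)
    (hu : ContDiffAt ℝ 2 u y) (hsymm : ∀ᶠ z in 𝓝 y, ∀ a b, G z a b = G z b a)
    (hunit : ∀ᶠ z in 𝓝 y, G z (Y z) (Y z) = 1 - θ z ^ 2)
    (hdu : ∀ᶠ z in 𝓝 y, ∀ a, G z (Y z) a + θ z * fderiv ℝ u z a = 0)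
    (hθ0 : θ y ≠ 0) (hθ1 : 1 - θ y ^ 2 ≠ 0) (hθY : fderiv ℝ θ y (Y y) = 0)
    (hperp : ∀ a b, G y (Y y) a = 0 → G y (Y y) b = 0 → lieForm G Y y a b = 0) (a b : E) :
    lieForm G (killing θ Y) y a b = 0 := by
  have hG0 := hsymm.self_of_nhds
  have hG's : ∀ v a b, fderiv ℝ G y v a b = fderiv ℝ G y v b a := by
    intro v a b
    have h : (fun z => G z a b) =ᶠ[𝓝 y] fun z => G z b a := by
      filter_upwards [hsymm] with z hz using hz a b
    have h1 := congrArg (fun A : E →L[ℝ] ℝ => A v) h.fderiv_eq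
    simp only [hasFDerivAt_bilin hG (differentiableAt_const _) (differentiableAt_const _)] at h1
    simpa using h1
  -- The derivative of |Y|² = 1 - θ².
  have e1 : ∀ a, fderiv ℝ G y a (Y y) (Y y) + 2 * G y (fderiv ℝ Y y a) (Y y)
      = -2 * θ y * fderiv ℝ θ y a := by
    intro a
    have h : (fun z => G z (Y z) (Y z)) =ᶠ[𝓝 y] fun z => 1 - θ z ^ 2 := hunit
    have h1 := congrArg (fun A : E →L[ℝ] ℝ => A a) h.fderiv_eq
    simp only [hasFDerivAt_bilin hG hY hY] at h1
    rw [((hθ.hasFDerivAt.pow 2).const_sub 1).fderiv] at h1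
    simp at h1
    rw [hG0 (Y y) (fderiv ℝ Y y a)] at h1
    linarith
  have hu2 : DifferentiableAt ℝ (fderiv ℝ u) y :=
    (hu.fderiv_right (m := 1) (by norm_num)).differentiableAt (by simp)
  have hus := (hu.isSymmSndFDerivAt (by simp)).eq
  -- The derivative of g(Y, b) + θ du(b) = 0 in the direction a. It is used below for (Y, a) and (a,
  -- Y), so that the terms with D²u cancel.
  have e2 : ∀ a b, fderiv ℝ G y a (Y y) b + G y (fderiv ℝ Y y a) b
      + fderiv ℝ θ y a * fderiv ℝ u y b + θ y * fderiv ℝ (fderiv ℝ u) y a b = 0 := by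
    intro a b
    have h : (fun z => G z (Y z) b + θ z * fderiv ℝ u z b) =ᶠ[𝓝 y] fun _ => (0 : ℝ) := by
      filter_upwards [hdu] with z hz using hz b
    have hub : HasFDerivAt (fun z => fderiv ℝ u z b) ((fderiv ℝ (fderiv ℝ u) y).flip b) y := by
      refine (hu2.hasFDerivAt.clm_apply (hasFDerivAt_const b y)).congr_fderiv ?_
      ext v
      simp
    have hGd : DifferentiableAt ℝ (fun z => G z (Y z) b) y :=
      ((hG.hasFDerivAt.clm_apply hY.hasFDerivAt).clm_apply
        (hasFDerivAt_const b y)).differentiableAt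
    have h1 := congrArg (fun A : E →L[ℝ] ℝ => A a) h.fderiv_eq
    have h2 := (hGd.hasFDerivAt.add (hθ.hasFDerivAt.mul hub)).fderiv
    have h3 : fderiv ℝ (fun z => G z (Y z) b + θ z * fderiv ℝ u z b) y = _ := h2
    rw [h3] at h1
    simp [hasFDerivAt_bilin hG hY (differentiableAt_const _)] at h1
    linarith
  have e3 := hdu.self_of_nhds
  have e4 := hunit.self_of_nhds
  have huY : fderiv ℝ u y (Y y) = -(1 - θ y ^ 2) / θ y := by
    have := e3 (Y y)
    rw [e4] at this
    field_simp
    linarith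
  have hLY : ∀ a, lieForm G Y y a (Y y) = -fderiv ℝ θ y a * (1 + θ y ^ 2) / θ y := by
    intro a
    have h1 := e2 (Y y) a
    have h2 := e2 a (Y y)
    have h3 := e1 a
    rw [hθY, zero_mul, add_zero] at h1
    rw [huY, hus a (Y y)] at h2
    unfold lieForm
    rw [hG's (Y y) a (Y y), hG0 a (fderiv ℝ Y y (Y y))]
    field_simp at h2 ⊢
    linear_combination θ y * h1 - h2 + θ y * h3
  have hk : HasFDerivAt (fun z => -θ z / (1 - θ z ^ 2))
      ((-(1 + θ y ^ 2) / (1 - θ y ^ 2) ^ 2) • fderiv ℝ θ y) y := by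
    have h1 : HasDerivAt (fun x : ℝ => -x / (1 - x ^ 2))
        (-(1 + θ y ^ 2) / (1 - θ y ^ 2) ^ 2) (θ y) := by
      refine ((hasDerivAt_neg' (θ y)).fun_div
        ((hasDerivAt_pow 2 (θ y)).const_sub 1) hθ1).congr_deriv ?_
      field_simp
      ring
    exact h1.comp_hasFDerivAt y hθ.hasFDerivAt
  have hX : ∀ v, fderiv ℝ (killing θ Y) y v = (-θ y / (1 - θ y ^ 2)) • fderiv ℝ Y y v
      + (-(1 + θ y ^ 2) / (1 - θ y ^ 2) ^ 2 * fderiv ℝ θ y v) • Y y := by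
    intro v
    have h1 : fderiv ℝ (killing θ Y) y = _ := (hk.smul hY.hasFDerivAt).fderiv
    rw [h1]
    simp
  -- The rule L_{kY} g = k L_Y g + dk ⊗ Y♭ + Y♭ ⊗ dk for k = -θ/(1 - θ²), with dk = -(1 + θ²)/(1 -
  -- θ²)² dθ.
  have hL : ∀ a b, lieForm G (killing θ Y) y a b = (-θ y / (1 - θ y ^ 2)) * lieForm G Y y a b
      + -(1 + θ y ^ 2) / (1 - θ y ^ 2) ^ 2 *
        (fderiv ℝ θ y a * G y (Y y) b + fderiv ℝ θ y b * G y (Y y) a) := by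
    intro a b
    unfold lieForm
    rw [hX, hX, hG0 (Y y) a]
    simp only [killing, map_add, map_smul, add_apply, smul_apply, smul_eq_mul]
    ring
  -- With dθ(Y) = 0 the two contributions are ±(1 + θ²)/(1 - θ²) dθ(a). Their cancellation is what
  -- singles out the factor k.
  have hLXY : ∀ a, lieForm G (killing θ Y) y a (Y y) = 0 := by
    intro a
    rw [hL, hLY, e4, hθY]
    field_simp
    ring
  have hlieS : ∀ a b, lieForm G (killing θ Y) y a b = lieForm G (killing θ Y) y b a := by
    intro a b
    unfold lieForm
    rw [hG's, hG0 (fderiv ℝ _ y a) b, hG0 a]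
    ring
  have hadd : ∀ a a' c b, lieForm G (killing θ Y) y (a + (c : ℝ) • a') b
      = lieForm G (killing θ Y) y a b + c * lieForm G (killing θ Y) y a' b := by
    intro a a' c b
    unfold lieForm
    simp only [map_add, map_smul, add_apply, smul_apply, smul_eq_mul]
    ring
  have hperpL : ∀ a b, G y (Y y) a = 0 → G y (Y y) b = 0 →
      lieForm G (killing θ Y) y a b = 0 := by
    intro a b ha hb
    rw [hL, hperp a b ha hb, ha, hb]
    ring
  -- By bilinearity it remains to split both arguments along Y and its orthogonal complement.
  have hdec : ∀ a, ∃ a' c, G y (Y y) a' = 0 ∧ a = a' + (c : ℝ) • Y y := by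
    intro a
    refine ⟨a - (G y (Y y) a / (1 - θ y ^ 2)) • Y y, G y (Y y) a / (1 - θ y ^ 2), ?_, by abel⟩
    rw [map_sub, map_smul, e4, smul_eq_mul]
    field_simp
    ring
  obtain ⟨a', c, ha', rfl⟩ := hdec a
  obtain ⟨b', d, hb', rfl⟩ := hdec b
  rw [hadd, hlieS a', hlieS (Y y), hadd, hadd, hlieS b', hperpL a' b' ha' hb', hlieS (Y y) a',
    hLXY, hLXY, hLXY]
  ring

/-- The condition `⟨A ∇ξ, ∇ξ⟩ = 0` says that `θ` is constant along `Y`. -/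
theorem fderiv_angle_eq_zero {G : E → E →L[ℝ] E →L[ℝ] ℝ} {Y : E → E} {θ : E → ℝ} {y : E}
    (hG : DifferentiableAt ℝ G y) (hY : DifferentiableAt ℝ Y y) (hθ : DifferentiableAt ℝ θ y)
    (hsymm : ∀ a b, G y a b = G y b a)
    (hunit : ∀ᶠ z in 𝓝 y, G z (Y z) (Y z) = 1 - θ z ^ 2) (hθ0 : θ y ≠ 0)
    (hA : G y (fderiv ℝ Y y (-θ y • Y y)) (-θ y • Y y)
      + chris G y (-θ y • Y y) (Y y) (-θ y • Y y)
      + fderiv ℝ θ y (-θ y • Y y) * (1 - θ y ^ 2) = 0) : fderiv ℝ θ y (Y y) = 0 := by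
  have h : (fun z => G z (Y z) (Y z)) =ᶠ[𝓝 y] fun z => 1 - θ z ^ 2 := hunit
  have h1 := congrArg (fun A : E →L[ℝ] ℝ => A (Y y)) h.fderiv_eq
  simp only [hasFDerivAt_bilin hG hY hY] at h1
  rw [((hθ.hasFDerivAt.pow 2).const_sub 1).fderiv] at h1
  simp at h1
  rw [hsymm (Y y) (fderiv ℝ Y y (Y y))] at h1
  unfold chris at hA
  simp only [map_smul, smul_apply, smul_eq_mul] at hA
  -- In `hA` the vector -θY is the horizontal part of ∇ξ and 1 - θ² its vertical part. Since ⟨∇_Y Y,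
  -- Y⟩ is half the derivative of |Y|², that is -θ dθ(Y), the left side of `hA` equals -θ³ dθ(Y) -
  -- θ(1 - θ²) dθ(Y) = -θ dθ(Y).
  have h2 : θ y * fderiv ℝ θ y (Y y) = 0 := by
    linear_combination θ y ^ 2 / 2 * h1 - hA
  exact (mul_eq_zero.1 h2).resolve_left hθ0

end Calculus

/-! ### Tangent vectors and the metric of M in the preferred charts. -/

section Charts

set_option linter.unusedSectionVars false

open Metric Filter Topology

variable {n : ℕ} {M : Type*} [TopologicalSpace M] [ChartedSpace (EuclideanSpace ℝ (Fin n)) M]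
  [IsManifold (𝓡 n) ∞ M]

/-- The components of the tangent vector `v` at `p` in the preferred chart at `p₀`. -/
def comp (p₀ p : M) (v : EuclideanSpace ℝ (Fin n)) : EuclideanSpace ℝ (Fin n) :=
  (trivializationAt (EuclideanSpace ℝ (Fin n)) (TangentSpace (𝓡 n) : M → Type _) p₀
    ⟨p, (v : TangentSpace (𝓡 n) p)⟩).2

/-- The differential at `p` of the preferred chart at `p₀`. -/
def dchart (p₀ p : M) : EuclideanSpace ℝ (Fin n) →L[ℝ] EuclideanSpace ℝ (Fin n) :=
  mfderiv (𝓡 n) 𝓘(ℝ, EuclideanSpace ℝ (Fin n)) (extChartAt (𝓡 n) p₀) p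

/-- The differential at `y` of the inverse of the preferred chart at `p₀`. -/
def dchartSymm (p₀ : M) (y : EuclideanSpace ℝ (Fin n)) :
    EuclideanSpace ℝ (Fin n) →L[ℝ] EuclideanSpace ℝ (Fin n) :=
  mfderiv 𝓘(ℝ, EuclideanSpace ℝ (Fin n)) (𝓡 n) (extChartAt (𝓡 n) p₀).symm y

/-- The trivialization of the tangent bundle is induced by the chart. This bridge turns the bundle
components in the definitions into ordinary derivatives. -/
theorem comp_eq_dchart {p₀ p : M} (hp : p ∈ (extChartAt (𝓡 n) p₀).source)
    (v : EuclideanSpace ℝ (Fin n)) : comp p₀ p v = dchart p₀ p v := by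
  have : IsManifold (𝓡 n) 1 M := .of_le (n := ∞) (by simp)
  have hp' : p ∈ (chartAt (EuclideanSpace ℝ (Fin n)) p₀).source := by simpa using hp
  have h1 := TangentBundle.continuousLinearMapAt_trivializationAt (𝕜 := ℝ) (I := 𝓡 n) hp'
  have h2 : ∀ v : TangentSpace (𝓡 n) p, (trivializationAt (EuclideanSpace ℝ (Fin n))
      (TangentSpace (𝓡 n) : M → Type _) p₀).continuousLinearMapAt ℝ p v = comp p₀ p v := by
    intro v
    rw [Trivialization.continuousLinearMapAt_apply, Trivialization.linearMapAt_apply, if_pos]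
    · rfl
    · simpa using hp
  exact (h2 v).symm.trans (congrArg (fun A : TangentSpace (𝓡 n) p →L[ℝ] EuclideanSpace ℝ (Fin n) =>
    A (v : TangentSpace (𝓡 n) p)) h1)

theorem symmL_eq_dchartSymm {p₀ : M} {y : EuclideanSpace ℝ (Fin n)}
    (hy : y ∈ (extChartAt (𝓡 n) p₀).target) (a : EuclideanSpace ℝ (Fin n)) :
    (trivializationAt (EuclideanSpace ℝ (Fin n)) (TangentSpace (𝓡 n) : M → Type _) p₀).symmL ℝ
      ((extChartAt (𝓡 n) p₀).symm y) a = dchartSymm p₀ y a := by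
  have : IsManifold (𝓡 n) 1 M := .of_le (n := ∞) (by simp)
  have hp := (extChartAt (𝓡 n) p₀).map_target hy
  have hp' : (extChartAt (𝓡 n) p₀).symm y ∈ (chartAt (EuclideanSpace ℝ (Fin n)) p₀).source := by
    simpa using hp
  have h1 := TangentBundle.symmL_trivializationAt (𝕜 := ℝ) (I := 𝓡 n) hp'
  rw [(extChartAt (𝓡 n) p₀).right_inv hy] at h1
  have hr : range (𝓡 n) = univ := (𝓡 n).range_eq_univ
  rw [hr, mfderivWithin_univ] at h1
  exact congrArg (fun A : EuclideanSpace ℝ (Fin n) →L[ℝ] EuclideanSpace ℝ (Fin n) => A a) h1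

theorem dchart_dchartSymm {p₀ : M} {y : EuclideanSpace ℝ (Fin n)}
    (hy : y ∈ (extChartAt (𝓡 n) p₀).target) (a : EuclideanSpace ℝ (Fin n)) :
    dchart p₀ ((extChartAt (𝓡 n) p₀).symm y) (dchartSymm p₀ y a) = a := by
  have : IsManifold (𝓡 n) 1 M := .of_le (n := ∞) (by simp)
  have h := mfderiv_extChartAt_comp_mfderivWithin_extChartAt_symm (I := 𝓡 n) hy
  have hr : range (𝓡 n) = univ := (𝓡 n).range_eq_univ
  rw [hr, mfderivWithin_univ] at h
  exact congrArg (fun A : EuclideanSpace ℝ (Fin n) →L[ℝ] EuclideanSpace ℝ (Fin n) => A a) h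

theorem dchartSymm_dchart {p₀ p : M} (hp : p ∈ (extChartAt (𝓡 n) p₀).source)
    (v : EuclideanSpace ℝ (Fin n)) :
    dchartSymm p₀ (extChartAt (𝓡 n) p₀ p) (dchart p₀ p v) = v := by
  have : IsManifold (𝓡 n) 1 M := .of_le (n := ∞) (by simp)
  have h := mfderivWithin_extChartAt_symm_comp_mfderiv_extChartAt' (I := 𝓡 n) hp
  have hr : range (𝓡 n) = univ := (𝓡 n).range_eq_univ
  rw [hr, mfderivWithin_univ] at h
  exact congrArg (fun A : EuclideanSpace ℝ (Fin n) →L[ℝ] EuclideanSpace ℝ (Fin n) => A v) h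

theorem dchart_self (p : M) (v : EuclideanSpace ℝ (Fin n)) : dchart p p v = v := by
  have : IsManifold (𝓡 n) 1 M := .of_le (n := ∞) (by simp)
  have h := mfderiv_extChartAt_self (I := 𝓡 n) (x := p)
  exact congrArg (fun A : EuclideanSpace ℝ (Fin n) →L[ℝ] EuclideanSpace ℝ (Fin n) => A v) h

theorem dchartSymm_self (p : M) (v : EuclideanSpace ℝ (Fin n)) :
    dchartSymm p (extChartAt (𝓡 n) p p) v = v := by
  have h := dchartSymm_dchart (mem_extChartAt_source (I := 𝓡 n) p) v
  rwa [dchart_self] at h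

theorem contMDiffAt_extChartAt_symm {p₀ : M} {y : EuclideanSpace ℝ (Fin n)}
    (hy : y ∈ (extChartAt (𝓡 n) p₀).target) :
    ContMDiffAt 𝓘(ℝ, EuclideanSpace ℝ (Fin n)) (𝓡 n) ∞ (extChartAt (𝓡 n) p₀).symm y :=
  (contMDiffOn_extChartAt_symm p₀).contMDiffAt ((isOpen_extChartAt_target p₀).mem_nhds hy)

theorem contMDiffAt_extChartAt_of_mem {p₀ p : M} (hp : p ∈ (extChartAt (𝓡 n) p₀).source) :
    ContMDiffAt (𝓡 n) 𝓘(ℝ, EuclideanSpace ℝ (Fin n)) ∞ (extChartAt (𝓡 n) p₀) p :=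
  contMDiffAt_extChartAt' (by simpa using hp)

/-- The change of coordinates from the preferred chart at `p` to that at `q`. -/
def transition (p q : M) (y : EuclideanSpace ℝ (Fin n)) : EuclideanSpace ℝ (Fin n) :=
  extChartAt (𝓡 n) q ((extChartAt (𝓡 n) p).symm y)

theorem contDiffAt_transition {p q : M} {y : EuclideanSpace ℝ (Fin n)}
    (hy : y ∈ (extChartAt (𝓡 n) p).target)
    (hq : (extChartAt (𝓡 n) p).symm y ∈ (extChartAt (𝓡 n) q).source) :
    ContDiffAt ℝ ∞ (transition p q) y := by
  rw [← contMDiffAt_iff_contDiffAt]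
  exact (contMDiffAt_extChartAt_of_mem hq).comp y (contMDiffAt_extChartAt_symm hy)

theorem fderiv_transition {p q : M} {y : EuclideanSpace ℝ (Fin n)}
    (hy : y ∈ (extChartAt (𝓡 n) p).target)
    (hq : (extChartAt (𝓡 n) p).symm y ∈ (extChartAt (𝓡 n) q).source)
    (a : EuclideanSpace ℝ (Fin n)) : fderiv ℝ (transition p q) y a
      = dchart q ((extChartAt (𝓡 n) p).symm y) (dchartSymm p y a) := by
  have h := mfderiv_comp y ((contMDiffAt_extChartAt_of_mem hq).mdifferentiableAt (by simp))
    ((contMDiffAt_extChartAt_symm hy).mdifferentiableAt (by simp))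
  have h' : fderiv ℝ (transition p q) y = _ := mfderiv_eq_fderiv.symm.trans h
  rw [h']
  rfl

variable [RiemannianBundle (fun p : M => TangentSpace (𝓡 n) p)]

/-- The metric at `p`, on the model space. -/
def metricForm (p : M) : EuclideanSpace ℝ (Fin n) →ₗ[ℝ] EuclideanSpace ℝ (Fin n) →ₗ[ℝ] ℝ :=
  LinearMap.mk₂ ℝ (fun a b => metric p (a : TangentSpace (𝓡 n) p) (b : TangentSpace (𝓡 n) p))
    (fun a b c => inner_add_left (𝕜 := ℝ) (E := TangentSpace (𝓡 n) p) a b c)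
    (fun r a b => inner_smul_left (𝕜 := ℝ) (E := TangentSpace (𝓡 n) p) a b r)
    (fun a b c => inner_add_right (𝕜 := ℝ) (E := TangentSpace (𝓡 n) p) a b c)
    (fun r a b => inner_smul_right (𝕜 := ℝ) (E := TangentSpace (𝓡 n) p) a b r)

theorem metricForm_symm (p : M) (v w : EuclideanSpace ℝ (Fin n)) :
    metricForm p v w = metricForm p w v :=
  real_inner_comm (F := TangentSpace (𝓡 n) p) w v

theorem metricForm_pos (p : M) {v : EuclideanSpace ℝ (Fin n)} (hv : v ≠ 0) :
    0 < metricForm p v v :=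
  real_inner_self_pos (F := TangentSpace (𝓡 n) p).2 hv

/-- The metric in the preferred chart at `p₀`, as a family of bilinear forms. -/
def gram (p₀ : M) (y : EuclideanSpace ℝ (Fin n)) :
    EuclideanSpace ℝ (Fin n) →L[ℝ] EuclideanSpace ℝ (Fin n) →L[ℝ] ℝ :=
  LinearMap.toContinuousBilinearMap
    ((metricForm ((extChartAt (𝓡 n) p₀).symm y)).compl₁₂
      (dchartSymm p₀ y).toLinearMap (dchartSymm p₀ y).toLinearMap)

theorem gram_apply (p₀ : M) (y a b : EuclideanSpace ℝ (Fin n)) : gram p₀ y a b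
    = metricForm ((extChartAt (𝓡 n) p₀).symm y) (dchartSymm p₀ y a) (dchartSymm p₀ y b) := rfl

theorem gram_symm (p₀ : M) (y a b : EuclideanSpace ℝ (Fin n)) :
    gram p₀ y a b = gram p₀ y b a := metricForm_symm _ _ _

theorem gram_eq_coordMetric {p₀ : M} {y : EuclideanSpace ℝ (Fin n)}
    (hy : y ∈ (extChartAt (𝓡 n) p₀).target) (a b : EuclideanSpace ℝ (Fin n)) :
    gram p₀ y a b = coordMetric (𝓡 n) (metric (M := M)) p₀ a b y := by
  rw [gram_apply, coordMetric, ← symmL_eq_dchartSymm hy, ← symmL_eq_dchartSymm hy]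
  rfl

theorem gram_pos {p₀ : M} {y : EuclideanSpace ℝ (Fin n)}
    (hy : y ∈ (extChartAt (𝓡 n) p₀).target) {a : EuclideanSpace ℝ (Fin n)} (ha : a ≠ 0) :
    0 < gram p₀ y a a := by
  rw [gram_apply]
  refine metricForm_pos _ fun h => ha ?_
  rw [← dchart_dchartSymm hy a, h, map_zero]

theorem gram_self (p : M) (a b : EuclideanSpace ℝ (Fin n)) :
    gram p (extChartAt (𝓡 n) p p) a b = metricForm p a b := by
  rw [gram_apply, dchartSymm_self, dchartSymm_self, extChartAt_to_inv]

/-- The metric, expressed by the components of the vectors in the preferred chart at `p₀`. -/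
theorem gram_dchart {p₀ p : M} (hp : p ∈ (extChartAt (𝓡 n) p₀).source)
    (v w : EuclideanSpace ℝ (Fin n)) :
    gram p₀ (extChartAt (𝓡 n) p₀ p) (dchart p₀ p v) (dchart p₀ p w) = metricForm p v w := by
  rw [gram_apply, dchartSymm_dchart hp, dchartSymm_dchart hp, (extChartAt (𝓡 n) p₀).left_inv hp]

/-- Both sides measure the same tangent vectors of M. This is the isometry hypothesis of
`lieForm_change` for the change of charts. -/
theorem gram_transition {p q : M} {y : EuclideanSpace ℝ (Fin n)}
    (hy : y ∈ (extChartAt (𝓡 n) p).target)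
    (hq : (extChartAt (𝓡 n) p).symm y ∈ (extChartAt (𝓡 n) q).source)
    (a b : EuclideanSpace ℝ (Fin n)) : gram p y a b = gram q (transition p q y)
      (fderiv ℝ (transition p q) y a) (fderiv ℝ (transition p q) y b) := by
  rw [fderiv_transition hy hq, fderiv_transition hy hq, transition, gram_dchart hq, gram_apply]

/-- Fields with constant components in the trivialization are smooth sections, and a smooth bundle
metric pairs smooth sections smoothly. -/
theorem contDiffOn_gram [IsContMDiffRiemannianBundle (𝓡 n) ∞ (EuclideanSpace ℝ (Fin n))
    (fun p : M => TangentSpace (𝓡 n) p)] (p₀ : M) :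
    ContDiffOn ℝ ∞ (gram p₀) (extChartAt (𝓡 n) p₀).target := by
  rw [contDiffOn_clm_apply]
  intro a
  rw [contDiffOn_clm_apply]
  intro b
  have : IsManifold (𝓡 n) (∞ + 1) M := by simpa
  let e := trivializationAt (EuclideanSpace ℝ (Fin n)) (TangentSpace (𝓡 n) : M → Type _) p₀
  have hsec : ∀ c : EuclideanSpace ℝ (Fin n),
      ContMDiffOn 𝓘(ℝ, EuclideanSpace ℝ (Fin n)) ((𝓡 n).prod 𝓘(ℝ, EuclideanSpace ℝ (Fin n))) ∞
        (fun y => (⟨(extChartAt (𝓡 n) p₀).symm y, e.symmL ℝ ((extChartAt (𝓡 n) p₀).symm y) c⟩ :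
          TangentBundle (𝓡 n) M)) (extChartAt (𝓡 n) p₀).target := by
    intro c
    have hmaps : MapsTo (fun y => (⟨(extChartAt (𝓡 n) p₀).symm y,
        e.symmL ℝ ((extChartAt (𝓡 n) p₀).symm y) c⟩ : TangentBundle (𝓡 n) M))
        (extChartAt (𝓡 n) p₀).target e.source := by
      intro y hy
      rw [e.mem_source]
      simpa [e] using (extChartAt (𝓡 n) p₀).map_target hy
    rw [e.contMDiffOn_iff hmaps]
    refine ⟨contMDiffOn_extChartAt_symm p₀, contMDiffOn_const (c := c) |>.congr fun y hy => ?_⟩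
    have h1 : comp p₀ ((extChartAt (𝓡 n) p₀).symm y) (dchartSymm p₀ y c) = c := by
      rw [comp_eq_dchart ((extChartAt (𝓡 n) p₀).map_target hy), dchart_dchartSymm hy]
    rw [← symmL_eq_dchartSymm hy] at h1
    exact h1
  have h := (hsec a).inner_bundle (hsec b)
  rw [← contMDiffOn_iff_contDiffOn]
  refine h.congr fun y hy => ?_
  rw [gram_eq_coordMetric hy]
  rfl

theorem christoffel_eq_chris [IsContMDiffRiemannianBundle (𝓡 n) ∞ (EuclideanSpace ℝ (Fin n))
    (fun p : M => TangentSpace (𝓡 n) p)] (p : M) (u w z : EuclideanSpace ℝ (Fin n)) :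
    christoffel (𝓡 n) (metric (M := M)) p u w z = chris (gram p) (extChartAt (𝓡 n) p p) u w z := by
  have hd : DifferentiableAt ℝ (gram p) (extChartAt (𝓡 n) p p) :=
    ((contDiffOn_gram p).contDiffAt (extChartAt_target_mem_nhds p)).differentiableAt (by simp)
  have h : ∀ a b c, fderiv ℝ (coordMetric (𝓡 n) (metric (M := M)) p a b)
      (extChartAt (𝓡 n) p p) c = fderiv ℝ (gram p) (extChartAt (𝓡 n) p p) c a b := by
    intro a b c
    have h1 : coordMetric (𝓡 n) (metric (M := M)) p a b =ᶠ[𝓝 (extChartAt (𝓡 n) p p)]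
        fun y => gram p y a b := by
      filter_upwards [extChartAt_target_mem_nhds (I := 𝓡 n) p] with y hy
      exact (gram_eq_coordMetric hy a b).symm
    rw [h1.fderiv_eq, hasFDerivAt_bilin hd (differentiableAt_const a) (differentiableAt_const b)]
    simp
  rw [christoffel, chris, h, h, h]

end Charts

/-! ### Charts, metric and Christoffel symbols of M × ℝ. -/

section ProductCharts

set_option linter.unusedSectionVars false
set_option synthInstance.maxHeartbeats 200000

open Metric Filter Topology

variable {n : ℕ} {M : Type*} [TopologicalSpace M] [ChartedSpace (EuclideanSpace ℝ (Fin n)) M]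
  [IsManifold (𝓡 n) ∞ M]

theorem hasFDerivAt_comp_fst {E F : Type*} [NormedAddCommGroup E] [NormedSpace ℝ E]
    [NormedAddCommGroup F] [NormedSpace ℝ F] {G : E → F} {y : E} (hG : DifferentiableAt ℝ G y)
    (t : ℝ) : HasFDerivAt (fun z : E × ℝ => G z.1)
      ((fderiv ℝ G y).comp (ContinuousLinearMap.fst ℝ E ℝ)) (y, t) :=
  HasFDerivAt.comp (f := Prod.fst) (y, t) hG.hasFDerivAt hasFDerivAt_fst

theorem fderiv_bilin_fst {E : Type*} [NormedAddCommGroup E] [NormedSpace ℝ E]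
    {G : E → E →L[ℝ] E →L[ℝ] ℝ} {y : E} (hG : DifferentiableAt ℝ G y) (t r : ℝ) (a b : E)
    (c : E × ℝ) :
    fderiv ℝ (fun z : E × ℝ => G z.1 a b + r) (y, t) c = fderiv ℝ G y c.1 a b := by
  have h1 : DifferentiableAt ℝ (fun z => G z a b) y :=
    ((hG.hasFDerivAt.clm_apply (hasFDerivAt_const a y)).clm_apply
      (hasFDerivAt_const b y)).differentiableAt
  rw [fderiv_add_const, (hasFDerivAt_comp_fst h1 t).fderiv, ContinuousLinearMap.comp_apply,
    hasFDerivAt_bilin hG (differentiableAt_const a) (differentiableAt_const b)]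
  simp

theorem hasMFDerivAt_prodMk_space {E H P F F' : Type*} [NormedAddCommGroup E] [NormedSpace ℝ E]
    [TopologicalSpace H] {I : ModelWithCorners ℝ E H} [TopologicalSpace P] [ChartedSpace H P]
    [NormedAddCommGroup F] [NormedSpace ℝ F] [NormedAddCommGroup F'] [NormedSpace ℝ F']
    {g : P → F} {h : P → F'} {x : P} {g' : TangentSpace I x →L[ℝ] F}
    {h' : TangentSpace I x →L[ℝ] F'}
    (hg : HasMFDerivAt I 𝓘(ℝ, F) g x g') (hh : HasMFDerivAt I 𝓘(ℝ, F') h x h') :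
    HasMFDerivAt I 𝓘(ℝ, F × F') (fun y => (g y, h y)) x (g'.prod h') := by
  rw [modelWithCornersSelf_prod, ← chartedSpaceSelf_prod]
  exact hg.prodMk hh

theorem extChartAt_prod_real (q₀ : M × ℝ) : extChartAt ((𝓡 n).prod 𝓘(ℝ, ℝ)) q₀
    = (extChartAt (𝓡 n) q₀.1).prod (PartialEquiv.refl ℝ) := by
  rw [extChartAt_prod, extChartAt_model_space_eq_id]

theorem mem_extChartAt_prod_source {q₀ q : M × ℝ} :
    q ∈ (extChartAt ((𝓡 n).prod 𝓘(ℝ, ℝ)) q₀).source ↔ q.1 ∈ (extChartAt (𝓡 n) q₀.1).source := by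
  rw [extChartAt_prod_real]
  exact ⟨fun h => h.1, fun h => ⟨h, mem_univ _⟩⟩

theorem coe_extChartAt_prod (q₀ : M × ℝ) :
    (extChartAt ((𝓡 n).prod 𝓘(ℝ, ℝ)) q₀ : M × ℝ → EuclideanSpace ℝ (Fin n) × ℝ)
      = Prod.map (extChartAt (𝓡 n) q₀.1) (id : ℝ → ℝ) := by
  rw [extChartAt_prod_real]
  rfl

theorem coe_extChartAt_prod_symm (q₀ : M × ℝ) :
    ((extChartAt ((𝓡 n).prod 𝓘(ℝ, ℝ)) q₀).symm : EuclideanSpace ℝ (Fin n) × ℝ → M × ℝ)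
      = Prod.map (extChartAt (𝓡 n) q₀.1).symm (id : ℝ → ℝ) := by
  rw [extChartAt_prod_real]
  rfl

theorem trivializationAt_prod {q₀ q : M × ℝ} (hq : q.1 ∈ (extChartAt (𝓡 n) q₀.1).source)
    (v : TangentSpace ((𝓡 n).prod 𝓘(ℝ, ℝ)) q) :
    (trivializationAt (EuclideanSpace ℝ (Fin n) × ℝ)
      (TangentSpace ((𝓡 n).prod 𝓘(ℝ, ℝ)) : M × ℝ → Type _) q₀ ⟨q, v⟩).2
      = (comp q₀.1 q.1 v.1, v.2) := by
  have hq1 := mem_extChartAt_prod_source.2 hq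
  have hq' : q ∈ (chartAt (ModelProd (EuclideanSpace ℝ (Fin n)) ℝ) q₀).source := by
    rwa [extChartAt_source] at hq1
  have h1 := TangentBundle.continuousLinearMapAt_trivializationAt (𝕜 := ℝ)
    (I := (𝓡 n).prod 𝓘(ℝ, ℝ)) hq'
  have h2 : (trivializationAt (EuclideanSpace ℝ (Fin n) × ℝ)
      (TangentSpace ((𝓡 n).prod 𝓘(ℝ, ℝ)) : M × ℝ → Type _) q₀).continuousLinearMapAt ℝ q v
      = (trivializationAt (EuclideanSpace ℝ (Fin n) × ℝ)
        (TangentSpace ((𝓡 n).prod 𝓘(ℝ, ℝ)) : M × ℝ → Type _) q₀ ⟨q, v⟩).2 := by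
    rw [Trivialization.continuousLinearMapAt_apply, Trivialization.linearMapAt_apply, if_pos]
    rwa [TangentBundle.trivializationAt_baseSet]
  have h4 := (hasMFDerivAt_prodMk_space
    (((contMDiffAt_extChartAt_of_mem hq).mdifferentiableAt (by simp)).hasMFDerivAt.comp q
      (hasMFDerivAt_fst (I := 𝓡 n) (I' := 𝓘(ℝ, ℝ)) q))
    (hasMFDerivAt_snd (I := 𝓡 n) (I' := 𝓘(ℝ, ℝ)) q)).mfderiv
  rw [← h2, comp_eq_dchart hq]
  rw [coe_extChartAt_prod] at h1
  exact congrArg (fun A : EuclideanSpace ℝ (Fin n) × ℝ →L[ℝ] EuclideanSpace ℝ (Fin n) × ℝ => A v)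
    (h1.trans h4)

theorem symmL_prod {q₀ : M × ℝ} {z : EuclideanSpace ℝ (Fin n) × ℝ}
    (hz : z.1 ∈ (extChartAt (𝓡 n) q₀.1).target) (a : EuclideanSpace ℝ (Fin n) × ℝ) :
    (trivializationAt (EuclideanSpace ℝ (Fin n) × ℝ)
      (TangentSpace ((𝓡 n).prod 𝓘(ℝ, ℝ)) : M × ℝ → Type _) q₀).symmL ℝ
        ((extChartAt ((𝓡 n).prod 𝓘(ℝ, ℝ)) q₀).symm z) a = (dchartSymm q₀.1 z.1 a.1, a.2) := by
  have hz' : z ∈ (extChartAt ((𝓡 n).prod 𝓘(ℝ, ℝ)) q₀).target := by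
    rw [extChartAt_prod_real]
    exact ⟨hz, mem_univ _⟩
  have hp := (extChartAt ((𝓡 n).prod 𝓘(ℝ, ℝ)) q₀).map_target hz'
  have hp' : (extChartAt ((𝓡 n).prod 𝓘(ℝ, ℝ)) q₀).symm z
      ∈ (chartAt (ModelProd (EuclideanSpace ℝ (Fin n)) ℝ) q₀).source := by
    rwa [extChartAt_source] at hp
  have h1 := TangentBundle.symmL_trivializationAt (𝕜 := ℝ) (I := (𝓡 n).prod 𝓘(ℝ, ℝ)) hp'
  rw [(extChartAt ((𝓡 n).prod 𝓘(ℝ, ℝ)) q₀).right_inv hz'] at h1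
  have hr : range ((𝓡 n).prod 𝓘(ℝ, ℝ)) = univ := ((𝓡 n).prod 𝓘(ℝ, ℝ)).range_eq_univ
  rw [hr, mfderivWithin_univ, coe_extChartAt_prod_symm] at h1
  have h4 := (((contMDiffAt_extChartAt_symm hz).mdifferentiableAt (by simp)).hasMFDerivAt.comp z
    (hasFDerivAt_fst (𝕜 := ℝ) (p := z)).hasMFDerivAt).prodMk
    (hasFDerivAt_snd (𝕜 := ℝ) (p := z)).hasMFDerivAt |>.mfderiv
  rw [coe_extChartAt_prod_symm]
  exact congrArg (fun A : EuclideanSpace ℝ (Fin n) × ℝ →L[ℝ] EuclideanSpace ℝ (Fin n) × ℝ => A a)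
    (h1.trans h4)

variable [RiemannianBundle (fun p : M => TangentSpace (𝓡 n) p)]

theorem prodMetric_eq (q : M × ℝ) (v w : TangentSpace ((𝓡 n).prod 𝓘(ℝ, ℝ)) q) :
    prodMetric q v w = metricForm q.1 v.1 w.1 + v.2 * w.2 := rfl

theorem coordMetric_prod {q₀ : M × ℝ} {z : EuclideanSpace ℝ (Fin n) × ℝ}
    (hz : z.1 ∈ (extChartAt (𝓡 n) q₀.1).target) (a b : EuclideanSpace ℝ (Fin n) × ℝ) :
    coordMetric ((𝓡 n).prod 𝓘(ℝ, ℝ)) (prodMetric (M := M)) q₀ a b z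
      = gram q₀.1 z.1 a.1 b.1 + a.2 * b.2 := by
  rw [coordMetric, prodMetric_eq, symmL_prod hz, symmL_prod hz, gram_apply,
    coe_extChartAt_prod_symm]
  rfl

/-- In the product chart the summand dt² has constant coefficients, and the coefficients of the
metric of M do not depend on t, so only the horizontal components enter. -/
theorem christoffel_prod [IsContMDiffRiemannianBundle (𝓡 n) ∞ (EuclideanSpace ℝ (Fin n))
    (fun p : M => TangentSpace (𝓡 n) p)] (q : M × ℝ) (u w z : EuclideanSpace ℝ (Fin n) × ℝ) :
    christoffel ((𝓡 n).prod 𝓘(ℝ, ℝ)) (prodMetric (M := M)) q u w z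
      = chris (gram q.1) (extChartAt (𝓡 n) q.1 q.1) u.1 w.1 z.1 := by
  have hd : DifferentiableAt ℝ (gram q.1) (extChartAt (𝓡 n) q.1 q.1) :=
    ((contDiffOn_gram q.1).contDiffAt (extChartAt_target_mem_nhds q.1)).differentiableAt (by simp)
  have hq : extChartAt ((𝓡 n).prod 𝓘(ℝ, ℝ)) q q = (extChartAt (𝓡 n) q.1 q.1, q.2) := by
    rw [coe_extChartAt_prod]
    rfl
  have h : ∀ a b c, fderiv ℝ (coordMetric ((𝓡 n).prod 𝓘(ℝ, ℝ)) (prodMetric (M := M)) q a b)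
      (extChartAt ((𝓡 n).prod 𝓘(ℝ, ℝ)) q q) c
        = fderiv ℝ (gram q.1) (extChartAt (𝓡 n) q.1 q.1) c.1 a.1 b.1 := by
    intro a b c
    rw [hq]
    have h1 : coordMetric ((𝓡 n).prod 𝓘(ℝ, ℝ)) (prodMetric (M := M)) q a b
        =ᶠ[𝓝 (extChartAt (𝓡 n) q.1 q.1, q.2)] fun z => gram q.1 z.1 a.1 b.1 + a.2 * b.2 := by
      filter_upwards [continuousAt_fst (extChartAt_target_mem_nhds (I := 𝓡 n) q.1)] with z hz
      exact coordMetric_prod hz a b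
    rw [h1.fderiv_eq, fderiv_bilin_fst hd]
  rw [christoffel, chris, h, h, h]

end ProductCharts

/-! ### The hypersurface as a local graph: the fields Y, θ and u on M. -/

section Hypersurface

set_option linter.unusedSectionVars false
set_option synthInstance.maxHeartbeats 200000

open Metric Filter Topology

variable {n : ℕ} {M : Type*} [TopologicalSpace M] [ChartedSpace (EuclideanSpace ℝ (Fin n)) M]
  [IsManifold (𝓡 n) ∞ M] [RiemannianBundle (fun p : M => TangentSpace (𝓡 n) p)]
  {S : Type*} [TopologicalSpace S] [ChartedSpace (EuclideanSpace ℝ (Fin n)) S]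
  [IsManifold (𝓡 n) ∞ S]
  {f : S → M × ℝ} {N : ∀ x : S, TangentSpace ((𝓡 n).prod 𝓘(ℝ, ℝ)) (f x)}

/-- The horizontal part of the normal field. -/
def normalH (N : ∀ x : S, TangentSpace ((𝓡 n).prod 𝓘(ℝ, ℝ)) (f x)) (x : S) :
    EuclideanSpace ℝ (Fin n) := (N x).1

/-- The differential of the projection of the hypersurface to `M`. -/
def dproj (f : S → M × ℝ) (x : S) : EuclideanSpace ℝ (Fin n) →L[ℝ] EuclideanSpace ℝ (Fin n) :=
  mfderiv (𝓡 n) (𝓡 n) (proj f) x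

theorem angle_eq (x : S) : angle f N x = (N x).2 := by
  have h : angle f N x = metricForm (f x).1 (N x).1 0 + (N x).2 * 1 := rfl
  rw [h, map_zero, zero_add, mul_one]

namespace IsOrientedHypersurface

theorem contMDiff_proj (hf : IsOrientedHypersurface f N) : ContMDiff (𝓡 n) (𝓡 n) ∞ (proj f) :=
    contMDiff_fst.comp hf.smooth

theorem contMDiff_height (hf : IsOrientedHypersurface f N) : ContMDiff (𝓡 n) 𝓘(ℝ, ℝ) ∞ (height f)
    := contMDiff_snd.comp hf.smooth

theorem metricForm_normalH (hf : IsOrientedHypersurface f N) (x : S) :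
    metricForm (proj f x) (normalH N x) (normalH N x) = 1 - angle f N x ^ 2 := by
  have h := hf.normal_unit x
  rw [prodMetric_eq, ← angle_eq] at h
  have h' : metricForm (proj f x) (normalH N x) (normalH N x) + angle f N x * angle f N x = 1 := h
  linarith

theorem mfderiv_eq (hf : IsOrientedHypersurface f N) (x : S) (v : EuclideanSpace ℝ (Fin n)) :
    mfderiv (𝓡 n) ((𝓡 n).prod 𝓘(ℝ, ℝ)) f x v
      = ((dproj f x v, dheight f x v) : EuclideanSpace ℝ (Fin n) × ℝ) := by
  have h := mfderiv_prodMk ((hf.contMDiff_proj x).mdifferentiableAt (by simp))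
    ((hf.contMDiff_height x).mdifferentiableAt (by simp))
  exact congrArg (fun A : EuclideanSpace ℝ (Fin n) →L[ℝ] EuclideanSpace ℝ (Fin n) × ℝ => A v) h

theorem metricForm_normalH_dproj (hf : IsOrientedHypersurface f N) (x : S)
    (v : EuclideanSpace ℝ (Fin n)) :
    metricForm (proj f x) (normalH N x) (dproj f x v) + angle f N x * dheight f x v = 0 := by
  have h := hf.normal_orthogonal x v
  rw [prodMetric_eq, hf.mfderiv_eq x v, ← angle_eq] at h
  exact h

/-- If v projects to zero in M, then orthogonality to N leaves θ dξ(v) = 0, so v has no vertical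
component either and the immersion kills it. -/
theorem dproj_injective (hf : IsOrientedHypersurface f N) {x : S} (hx : angle f N x ≠ 0) :
    Function.Injective (dproj (n := n) f x) := by
  rw [injective_iff_map_eq_zero]
  intro v hv
  have h := hf.metricForm_normalH_dproj x v
  rw [hv, map_zero, zero_add] at h
  have h1 := (mul_eq_zero.1 h).resolve_left hx
  have h2 := hf.mfderiv_eq x v
  rw [hv, h1] at h2
  exact hf.immersion x (h2.trans (map_zero _).symm)

/-- The horizontal part of N is its image under the tangent map of the projection to M, and tangent
maps of smooth maps are smooth. -/
theorem contMDiff_normalH (hf : IsOrientedHypersurface f N) : ContMDiff (𝓡 n) (𝓡 n).tangent ∞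
    (fun x => (⟨proj f x, normalH N x⟩ : TangentBundle (𝓡 n) M)) := by
  have h := ((contMDiff_fst (I := 𝓡 n) (J := 𝓘(ℝ, ℝ)) (M := M) (N := ℝ)
    (n := ∞)).contMDiff_tangentMap (m := ∞) (by simp)).comp hf.normal_smooth
  refine h.congr fun x => ?_
  simp only [Function.comp, tangentMap, mfderiv_fst]
  rfl

theorem contMDiff_angle (hf : IsOrientedHypersurface f N) : ContMDiff (𝓡 n) 𝓘(ℝ, ℝ) ∞ (angle f N)
    := by
  have h := ((contMDiff_snd (I := 𝓡 n) (J := 𝓘(ℝ, ℝ)) (M := M) (N := ℝ)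
    (n := ∞)).contMDiff_tangentMap (m := ∞) (by simp)).comp hf.normal_smooth
  have h2 := (contMDiff_snd_tangentBundle_modelSpace ℝ 𝓘(ℝ, ℝ) (n := ∞)).comp h
  refine h2.congr fun x => ?_
  simp only [Function.comp, tangentMap, mfderiv_snd]
  exact angle_eq x

theorem contMDiffAt_comp (hf : IsOrientedHypersurface f N) {p₀ : M} {x : S}
    (hx : proj f x ∈ (extChartAt (𝓡 n) p₀).source) :
    ContMDiffAt (𝓡 n) 𝓘(ℝ, EuclideanSpace ℝ (Fin n)) ∞
      (fun x => comp p₀ (proj f x) (normalH N x)) x := by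
  let e := trivializationAt (EuclideanSpace ℝ (Fin n)) (TangentSpace (𝓡 n) : M → Type _) p₀
  have : IsManifold (𝓡 n) (∞ + 1) M := by simpa
  have hx' : (⟨proj f x, normalH N x⟩ : TangentBundle (𝓡 n) M) ∈ e.source := by
    rw [e.mem_source]
    simpa [e] using hx
  have h := (e.contMDiffAt_iff (IB := 𝓡 n) (n := ∞)
    (f := fun x => (⟨proj f x, normalH N x⟩ : TangentBundle (𝓡 n) M)) hx').1 (hf.contMDiff_normalH
      x)
  exact h.2

end IsOrientedHypersurface

/-- The differential of a map from the model space to the hypersurface. -/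
def dsection (σ : EuclideanSpace ℝ (Fin n) → S) (y : EuclideanSpace ℝ (Fin n)) :
    EuclideanSpace ℝ (Fin n) →L[ℝ] EuclideanSpace ℝ (Fin n) :=
  mfderiv 𝓘(ℝ, EuclideanSpace ℝ (Fin n)) (𝓡 n) σ y

/-- A smooth local section `σ` of the projection of the hypersurface to `M`, defined on the open
set `U` of the preferred chart at `p₀`. -/
structure IsLocalSection (f : S → M × ℝ) (p₀ : M) (U : Set (EuclideanSpace ℝ (Fin n)))
    (σ : EuclideanSpace ℝ (Fin n) → S) : Prop where
  isOpen : IsOpen U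
  subset : U ⊆ (extChartAt (𝓡 n) p₀).target
  smooth : ContMDiffOn 𝓘(ℝ, EuclideanSpace ℝ (Fin n)) (𝓡 n) ∞ σ U
  proj_eq : ∀ y ∈ U, proj f (σ y) = (extChartAt (𝓡 n) p₀).symm y

/-- The components of the horizontal part of the normal along a local section. -/
def sectionY (N : ∀ x : S, TangentSpace ((𝓡 n).prod 𝓘(ℝ, ℝ)) (f x)) (p₀ : M)
    (σ : EuclideanSpace ℝ (Fin n) → S) (y : EuclideanSpace ℝ (Fin n)) :
    EuclideanSpace ℝ (Fin n) := comp p₀ (proj f (σ y)) (normalH N (σ y))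

namespace IsLocalSection

variable {p₀ : M} {U : Set (EuclideanSpace ℝ (Fin n))} {σ : EuclideanSpace ℝ (Fin n) → S}

theorem contMDiffAt (hσ : IsLocalSection f p₀ U σ) {y : EuclideanSpace ℝ (Fin n)} (hy : y ∈ U) :
    ContMDiffAt 𝓘(ℝ, EuclideanSpace ℝ (Fin n)) (𝓡 n) ∞ σ y :=
  hσ.smooth.contMDiffAt (hσ.isOpen.mem_nhds hy)

theorem proj_mem (hσ : IsLocalSection f p₀ U σ) {y : EuclideanSpace ℝ (Fin n)} (hy : y ∈ U) :
    proj f (σ y) ∈ (extChartAt (𝓡 n) p₀).source := by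
  rw [hσ.proj_eq y hy]
  exact (extChartAt (𝓡 n) p₀).map_target (hσ.subset hy)

theorem chart_proj (hσ : IsLocalSection f p₀ U σ) {y : EuclideanSpace ℝ (Fin n)} (hy : y ∈ U) :
    extChartAt (𝓡 n) p₀ (proj f (σ y)) = y := by
  rw [hσ.proj_eq y hy, (extChartAt (𝓡 n) p₀).right_inv (hσ.subset hy)]

theorem contDiffOn_Y (hσ : IsLocalSection f p₀ U σ) (hf : IsOrientedHypersurface f N) : ContDiffOn
    ℝ ∞ (sectionY N p₀ σ) U :=
  fun _ hy => (contMDiffAt_iff_contDiffAt.1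
    ((hf.contMDiffAt_comp (hσ.proj_mem hy)).comp _ (hσ.contMDiffAt hy))).contDiffWithinAt

theorem contDiffOn_angle (hσ : IsLocalSection f p₀ U σ) (hf : IsOrientedHypersurface f N) :
    ContDiffOn ℝ ∞ (fun y => angle f N (σ y)) U :=
  fun y hy => (contMDiffAt_iff_contDiffAt.1
    ((hf.contMDiff_angle (σ y)).comp y (hσ.contMDiffAt hy))).contDiffWithinAt

theorem contDiffOn_height (hσ : IsLocalSection f p₀ U σ) (hf : IsOrientedHypersurface f N) :
    ContDiffOn ℝ ∞ (fun y => height f (σ y)) U :=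
  fun y hy => (contMDiffAt_iff_contDiffAt.1
    ((hf.contMDiff_height (σ y)).comp y (hσ.contMDiffAt hy))).contDiffWithinAt

theorem dproj_dsection (hσ : IsLocalSection f p₀ U σ) (hf : IsOrientedHypersurface f N)
    {y : EuclideanSpace ℝ (Fin n)}
    (hy : y ∈ U) (a : EuclideanSpace ℝ (Fin n)) :
    dproj f (σ y) (dsection σ y a) = dchartSymm p₀ y a := by
  have h := mfderiv_comp y ((hf.contMDiff_proj (σ y)).mdifferentiableAt (by simp))
    ((hσ.contMDiffAt hy).mdifferentiableAt (by simp))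
  have h2 : proj f ∘ σ =ᶠ[𝓝 y] (extChartAt (𝓡 n) p₀).symm := by
    filter_upwards [hσ.isOpen.mem_nhds hy] with z hz using hσ.proj_eq z hz
  have h3 := h2.mfderiv_eq (I := 𝓘(ℝ, EuclideanSpace ℝ (Fin n))) (I' := 𝓡 n)
  have h4 : (mfderiv 𝓘(ℝ, EuclideanSpace ℝ (Fin n)) (𝓡 n) (proj f ∘ σ) y :
      EuclideanSpace ℝ (Fin n) →L[ℝ] EuclideanSpace ℝ (Fin n)) = dchartSymm p₀ y := h3
  rw [← h4]
  exact (congrArg (fun A : EuclideanSpace ℝ (Fin n) →L[ℝ] EuclideanSpace ℝ (Fin n) => A a) h).symm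

theorem dheight_dsection (hσ : IsLocalSection f p₀ U σ) (hf : IsOrientedHypersurface f N)
    {y : EuclideanSpace ℝ (Fin n)}
    (hy : y ∈ U) (a : EuclideanSpace ℝ (Fin n)) :
    dheight f (σ y) (dsection σ y a)
      = fderiv ℝ (fun z => height f (σ z)) y a := by
  have h := mfderiv_comp y ((hf.contMDiff_height (σ y)).mdifferentiableAt (by simp))
    ((hσ.contMDiffAt hy).mdifferentiableAt (by simp))
  have h4 : fderiv ℝ (fun z => height f (σ z)) y = _ := mfderiv_eq_fderiv.symm.trans h
  rw [h4]
  rfl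

theorem sectionY_eq (hσ : IsLocalSection f p₀ U σ) {y : EuclideanSpace ℝ (Fin n)} (hy : y ∈ U) :
    sectionY N p₀ σ y = dchart p₀ (proj f (σ y)) (normalH N (σ y)) :=
  comp_eq_dchart (hσ.proj_mem hy) _

theorem gram_Y_Y (hσ : IsLocalSection f p₀ U σ) (hf : IsOrientedHypersurface f N)
    {y : EuclideanSpace ℝ (Fin n)} (hy : y ∈ U) :
    gram p₀ y (sectionY N p₀ σ y) (sectionY N p₀ σ y) = 1 - angle f N (σ y) ^ 2 := by
  have h := gram_dchart (hσ.proj_mem hy) (normalH N (σ y)) (normalH N (σ y))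
  rw [hσ.chart_proj hy, ← hσ.sectionY_eq hy] at h
  rw [h, hf.metricForm_normalH]

/-- With u the height along the section, this is Y = -θ∇u, the orthogonality of N to the graph of u.
Hence, where θ ≠ 0, the complement of Y is the kernel of du, the tangent space of the level sets. -/
theorem gram_Y (hσ : IsLocalSection f p₀ U σ) (hf : IsOrientedHypersurface f N)
    {y : EuclideanSpace ℝ (Fin n)} (hy : y ∈ U)
    (a : EuclideanSpace ℝ (Fin n)) :
    gram p₀ y (sectionY N p₀ σ y) a
      + angle f N (σ y) * fderiv ℝ (fun z => height f (σ z)) y a = 0 := by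
  have h := hf.metricForm_normalH_dproj (σ y) (dsection σ y a)
  rw [hσ.dheight_dsection hf hy, hσ.dproj_dsection hf hy] at h
  have h2 := gram_dchart (hσ.proj_mem hy) (normalH N (σ y)) (dchartSymm p₀ y a)
  rw [hσ.chart_proj hy, ← hσ.sectionY_eq hy, hσ.proj_eq y hy, dchart_dchartSymm (hσ.subset hy),
    ← hσ.proj_eq y hy] at h2
  rw [h2]
  exact h

end IsLocalSection

end Hypersurface

/-! ### The second fundamental form of the sections in terms of Y. -/

section Killing

set_option linter.unusedSectionVars false
set_option synthInstance.maxHeartbeats 200000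

open Metric Filter Topology

variable {n : ℕ} {M : Type*} [TopologicalSpace M] [ChartedSpace (EuclideanSpace ℝ (Fin n)) M]
  [IsManifold (𝓡 n) ∞ M] [RiemannianBundle (fun p : M => TangentSpace (𝓡 n) p)]
  [IsContMDiffRiemannianBundle (𝓡 n) ∞ (EuclideanSpace ℝ (Fin n))
    (fun p : M => TangentSpace (𝓡 n) p)]
  {S : Type*} [TopologicalSpace S] [ChartedSpace (EuclideanSpace ℝ (Fin n)) S]
  [IsManifold (𝓡 n) ∞ S]
  {f : S → M × ℝ} {N : ∀ x : S, TangentSpace ((𝓡 n).prod 𝓘(ℝ, ℝ)) (f x)}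

theorem fderiv_bilin_symm {E : Type*} [NormedAddCommGroup E] [NormedSpace ℝ E]
    {G : E → E →L[ℝ] E →L[ℝ] ℝ} {y : E} (hG : DifferentiableAt ℝ G y)
    (hsymm : ∀ᶠ z in 𝓝 y, ∀ a b, G z a b = G z b a) (v a b : E) :
    fderiv ℝ G y v a b = fderiv ℝ G y v b a := by
  have h : (fun z => G z a b) =ᶠ[𝓝 y] fun z => G z b a := by
    filter_upwards [hsymm] with z hz using hz a b
  have h1 := congrArg (fun A : E →L[ℝ] ℝ => A v) h.fderiv_eq
  simp only [hasFDerivAt_bilin hG (differentiableAt_const _) (differentiableAt_const _)] at h1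
  simpa using h1

/-- The identity L_Y g(a, b) = ⟨∇_a Y, b⟩ + ⟨∇_b Y, a⟩: the connection is torsion free and metric.
It links the Killing equation with shape forms. -/
theorem lieForm_eq_add {E : Type*} [NormedAddCommGroup E] [NormedSpace ℝ E]
    {G : E → E →L[ℝ] E →L[ℝ] ℝ} {Y : E → E} {y : E} (hG : DifferentiableAt ℝ G y)
    (hsymm : ∀ᶠ z in 𝓝 y, ∀ a b, G z a b = G z b a) (a b : E) :
    lieForm G Y y a b = (G y (fderiv ℝ Y y a) b + chris G y a (Y y) b)
      + (G y (fderiv ℝ Y y b) a + chris G y b (Y y) a) := by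
  have hs := fderiv_bilin_symm hG hsymm
  unfold lieForm chris
  rw [hsymm.self_of_nhds a (fderiv ℝ Y y b), hs (Y y) b a, hs a b (Y y), hs b a (Y y)]
  ring

theorem mfderiv_dsection {F : Type*} [NormedAddCommGroup F] [NormedSpace ℝ F] {h : S → F}
    {σ : EuclideanSpace ℝ (Fin n) → S} {y : EuclideanSpace ℝ (Fin n)}
    (hh : MDifferentiableAt (𝓡 n) 𝓘(ℝ, F) h (σ y))
    (hσ : MDifferentiableAt 𝓘(ℝ, EuclideanSpace ℝ (Fin n)) (𝓡 n) σ y)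
    (a : EuclideanSpace ℝ (Fin n)) :
    (mfderiv (𝓡 n) 𝓘(ℝ, F) h (σ y) : EuclideanSpace ℝ (Fin n) →L[ℝ] F) (dsection σ y a)
      = fderiv ℝ (fun z => h (σ z)) y a := by
  have h1 := mfderiv_comp y hh hσ
  have h4 : fderiv ℝ (fun z => h (σ z)) y = _ := mfderiv_eq_fderiv.symm.trans h1
  rw [h4]
  rfl

/-- The unit normal of the sections, with values in the model space. -/
def normalS (N : ∀ x : S, TangentSpace ((𝓡 n).prod 𝓘(ℝ, ℝ)) (f x)) (x : S) :
    EuclideanSpace ℝ (Fin n) := (-(√(1 - angle f N x ^ 2))⁻¹) • normalH N x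

theorem sectionNormal_eq (x : S) : sectionNormal f N x = normalS N x := by
  have h : sectionNormal f N x = (-(√(1 - angle f N x ^ 2))⁻¹) •
      (normalH N x - angle f N x • (0 : EuclideanSpace ℝ (Fin n))) := rfl
  rw [h, smul_zero, sub_zero]
  rfl

/-- The shape form of the sections, on the model space. -/
def sectionShape (N : ∀ x : S, TangentSpace ((𝓡 n).prod 𝓘(ℝ, ℝ)) (f x)) (x : S)
    (v w : EuclideanSpace ℝ (Fin n)) : ℝ := sectionShapeForm f N x v w

/-- The differential of the components of the unit normal of the sections. -/
def dsectionComp (N : ∀ x : S, TangentSpace ((𝓡 n).prod 𝓘(ℝ, ℝ)) (f x)) (x : S) :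
    EuclideanSpace ℝ (Fin n) →L[ℝ] EuclideanSpace ℝ (Fin n) :=
  mfderiv (𝓡 n) 𝓘(ℝ, EuclideanSpace ℝ (Fin n))
    (fun z => comp (proj f x) (proj f z) (normalS N z)) x

theorem sectionShape_eq (x : S) (v w : EuclideanSpace ℝ (Fin n)) :
    sectionShape N x v w = -(metricForm (proj f x) (dsectionComp N x v) (dproj f x w)
      + chris (gram (proj f x)) (extChartAt (𝓡 n) (proj f x) (proj f x)) (dproj f x v)
        (normalS N x) (dproj f x w)) := by
  have key : ∀ V : S → EuclideanSpace ℝ (Fin n), V = normalS N →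
      shapeForm (𝓡 n) (𝓡 n) metric (proj f) V x v w
        = -(metricForm (proj f x) (dsectionComp N x v) (dproj f x w)
          + christoffel (𝓡 n) metric (proj f x) (dproj f x v) (normalS N x) (dproj f x w)) := by
    rintro V rfl
    rfl
  rw [← christoffel_eq_chris]
  exact key (sectionNormal f N) (funext sectionNormal_eq)

theorem sectionShape_smul (x : S) (c : ℝ) (v : EuclideanSpace ℝ (Fin n)) :
    sectionShape N x (c • v) (c • v) = c ^ 2 * sectionShape N x v v := by
  rw [sectionShape_eq, sectionShape_eq]
  unfold chris
  simp only [map_smul, smul_apply, LinearMap.smul_apply, smul_eq_mul]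
  ring

namespace IsOrientedHypersurface

theorem one_sub_angle_sq_pos (hf : IsOrientedHypersurface f N) {x : S} (hx : angle f N x ^ 2 ≠ 1) :
    0 < 1 - angle f N x ^ 2 := by
  have h := hf.metricForm_normalH x
  by_cases h0 : normalH N x = 0
  · rw [h0, map_zero] at h
    exact absurd (by linarith : angle f N x ^ 2 = 1) hx
  · rw [← h]
    exact metricForm_pos _ h0

theorem mdifferentiableAt_comp_normalS (hf : IsOrientedHypersurface f N) {x : S} {p₀ : M}
    (hx : angle f N x ^ 2 ≠ 1)
    (hp : proj f x ∈ (extChartAt (𝓡 n) p₀).source) :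
    MDifferentiableAt (𝓡 n) 𝓘(ℝ, EuclideanSpace ℝ (Fin n))
      (fun z => (-(√(1 - angle f N z ^ 2))⁻¹) • comp p₀ (proj f z) (normalH N z)) x := by
  have hpos := hf.one_sub_angle_sq_pos hx
  have h1 : DifferentiableAt ℝ (fun t : ℝ => -(√(1 - t ^ 2))⁻¹) (angle f N x) := by
    refine DifferentiableAt.neg (DifferentiableAt.inv (DifferentiableAt.sqrt ?_ hpos.ne') ?_)
    · fun_prop
    · exact (Real.sqrt_pos.2 hpos).ne'
  have h2 : MDifferentiableAt (𝓡 n) 𝓘(ℝ, ℝ) (fun z => -(√(1 - angle f N z ^ 2))⁻¹) x :=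
    h1.mdifferentiableAt.comp x ((hf.contMDiff_angle x).mdifferentiableAt (by simp))
  exact h2.smul ((hf.contMDiffAt_comp hp).mdifferentiableAt (by simp))

theorem comp_normalS_eventuallyEq (hf : IsOrientedHypersurface f N) {x : S} {p₀ : M}
    (hp : proj f x ∈ (extChartAt (𝓡 n) p₀).source) :
    (fun z => comp p₀ (proj f z) (normalS N z)) =ᶠ[𝓝 x]
      fun z => (-(√(1 - angle f N z ^ 2))⁻¹) • comp p₀ (proj f z) (normalH N z) := by
  have h1 := (hf.contMDiff_proj x).continuousAt.preimage_mem_nhds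
    ((isOpen_extChartAt_source (I := 𝓡 n) p₀).mem_nhds hp)
  filter_upwards [h1] with z hz
  rw [comp_eq_dchart hz, comp_eq_dchart hz, normalS, map_smul]

end IsOrientedHypersurface

namespace IsLocalSection

variable {x : S} {U : Set (EuclideanSpace ℝ (Fin n))} {σ : EuclideanSpace ℝ (Fin n) → S}
  {y : EuclideanSpace ℝ (Fin n)}

theorem dproj_dsection_self (hf : IsOrientedHypersurface f N)
    (hσ : IsLocalSection f (proj f x) U σ) (hy : extChartAt (𝓡 n) (proj f x) (proj f x) = y)
    (hU : y ∈ U) (hx : σ y = x) (a : EuclideanSpace ℝ (Fin n)) :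
    dproj f x (dsection σ y a) = a := by
  have h := hσ.dproj_dsection hf hU a
  rw [hx] at h
  rw [h, ← hy, dchartSymm_self]

theorem sectionY_self (hσ : IsLocalSection f (proj f x) U σ) (hU : y ∈ U) (hx : σ y = x) :
    sectionY N (proj f x) σ y = normalH N x := by
  rw [hσ.sectionY_eq hU, hx, dchart_self]

/-- The normal is η = -(1 - θ²)^(-1/2) Y. When η is differentiated, the derivative of the scalar
factor multiplies Y and disappears against b ⊥ Y; the sign of η cancels the one in A = -∇η. -/
theorem sectionShape_dsection (hf : IsOrientedHypersurface f N) (hθ1 : angle f N x ^ 2 ≠ 1)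
    (hσ : IsLocalSection f (proj f x) U σ) (hy : extChartAt (𝓡 n) (proj f x) (proj f x) = y)
    (hU : y ∈ U) (hx : σ y = x) (a b : EuclideanSpace ℝ (Fin n))
    (hb : gram (proj f x) y (sectionY N (proj f x) σ y) b = 0) :
    sectionShape N x (dsection σ y a) (dsection σ y b)
      = (√(1 - angle f N x ^ 2))⁻¹ * (gram (proj f x) y
        (fderiv ℝ (sectionY N (proj f x) σ) y a) b
        + chris (gram (proj f x)) y a (sectionY N (proj f x) σ y) b) := by
  have hsrc : proj f x ∈ (extChartAt (𝓡 n) (proj f x)).source := mem_extChartAt_source _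
  have hpos := hf.one_sub_angle_sq_pos hθ1
  have hYd : DifferentiableAt ℝ (sectionY N (proj f x) σ) y :=
    ((hσ.contDiffOn_Y hf).contDiffAt (hσ.isOpen.mem_nhds hU)).differentiableAt (by simp)
  have hθd : DifferentiableAt ℝ (fun z => angle f N (σ z)) y :=
    ((hσ.contDiffOn_angle hf).contDiffAt (hσ.isOpen.mem_nhds hU)).differentiableAt (by simp)
  have hσd : MDifferentiableAt 𝓘(ℝ, EuclideanSpace ℝ (Fin n)) (𝓡 n) σ y :=
    (hσ.contMDiffAt hU).mdifferentiableAt (by simp)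
  have hC : dsectionComp N x (dsection σ y a) = fderiv ℝ
      (fun z => (-(√(1 - angle f N (σ z) ^ 2))⁻¹) • sectionY N (proj f x) σ z) y a := by
    have h1 := (hf.comp_normalS_eventuallyEq hsrc).mfderiv_eq (I := 𝓡 n)
      (I' := 𝓘(ℝ, EuclideanSpace ℝ (Fin n)))
    have h2 : dsectionComp N x = _ := h1
    rw [h2]
    have h3 := hf.mdifferentiableAt_comp_normalS hθ1 hsrc
    rw [← hx] at h3
    have h4 := mfderiv_dsection h3 hσd a
    rw [hx] at h4
    exact h4
  have hk : DifferentiableAt ℝ (fun z => -(√(1 - angle f N (σ z) ^ 2))⁻¹) y := by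
    refine DifferentiableAt.neg (DifferentiableAt.inv (DifferentiableAt.sqrt ?_ ?_) ?_)
    · fun_prop
    · rw [hx]; exact hpos.ne'
    · rw [hx]; exact (Real.sqrt_pos.2 hpos).ne'
  have hD : fderiv ℝ
      (fun z => (-(√(1 - angle f N (σ z) ^ 2))⁻¹) • sectionY N (proj f x) σ z) y a
      = (-(√(1 - angle f N x ^ 2))⁻¹) • fderiv ℝ (sectionY N (proj f x) σ) y a
        + (fderiv ℝ (fun z => -(√(1 - angle f N (σ z) ^ 2))⁻¹) y a)
          • sectionY N (proj f x) σ y := by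
    have h1 := (hk.hasFDerivAt.smul hYd.hasFDerivAt).fderiv
    have h2 : fderiv ℝ
      (fun z => (-(√(1 - angle f N (σ z) ^ 2))⁻¹) • sectionY N (proj f x) σ z) y = _ := h1
    rw [h2, ← hx]
    simp
  have hm : ∀ v w, metricForm (proj f x) v w = gram (proj f x) y v w := by
    intro v w
    rw [← hy, gram_self]
  rw [sectionShape_eq, hσ.dproj_dsection_self hf hy hU hx, hσ.dproj_dsection_self hf hy hU hx, hC,
    hD, hm, hy, normalS, ← hσ.sectionY_self hU hx]
  simp only [map_add, map_smul, add_apply, smul_apply, smul_eq_mul, hb]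
  unfold chris
  simp only [map_smul, smul_apply, smul_eq_mul]
  ring

end IsLocalSection

end Killing

/-! ### The Killing equation on the projected hypersurface, and existence of local sections. -/

section KillingField

set_option linter.unusedSectionVars false
set_option synthInstance.maxHeartbeats 200000

open Metric Filter Topology

variable {n : ℕ} {M : Type*} [TopologicalSpace M] [ChartedSpace (EuclideanSpace ℝ (Fin n)) M]
  [IsManifold (𝓡 n) ∞ M] [RiemannianBundle (fun p : M => TangentSpace (𝓡 n) p)]
  [IsContMDiffRiemannianBundle (𝓡 n) ∞ (EuclideanSpace ℝ (Fin n))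
    (fun p : M => TangentSpace (𝓡 n) p)]
  {S : Type*} [TopologicalSpace S] [ChartedSpace (EuclideanSpace ℝ (Fin n)) S]
  [IsManifold (𝓡 n) ∞ S]
  {f : S → M × ℝ} {N : ∀ x : S, TangentSpace ((𝓡 n).prod 𝓘(ℝ, ℝ)) (f x)}

/-- The differential of the components of the horizontal part of the normal. -/
def dnormalH (N : ∀ x : S, TangentSpace ((𝓡 n).prod 𝓘(ℝ, ℝ)) (f x)) (x : S) :
    EuclideanSpace ℝ (Fin n) →L[ℝ] EuclideanSpace ℝ (Fin n) :=
  mfderiv (𝓡 n) 𝓘(ℝ, EuclideanSpace ℝ (Fin n))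
    (fun z => comp (proj f x) (proj f z) (normalH N z)) x

/-- The differential of the angle function. -/
def dangle (N : ∀ x : S, TangentSpace ((𝓡 n).prod 𝓘(ℝ, ℝ)) (f x)) (x : S) :
    EuclideanSpace ℝ (Fin n) →L[ℝ] ℝ := mfderiv (𝓡 n) 𝓘(ℝ, ℝ) (angle f N) x

/-- In the product chart N has the components (Y, θ), and the Christoffel term is the one of M; so
the ambient shape form splits into a term of M and the product dθ · dξ. -/
theorem IsOrientedHypersurface.shapeForm_eq (hf : IsOrientedHypersurface f N) (x : S)
    (v w : EuclideanSpace ℝ (Fin n)) :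
    shapeForm ((𝓡 n).prod 𝓘(ℝ, ℝ)) (𝓡 n) prodMetric f N x v w
      = -(metricForm (proj f x) (dnormalH N x v) (dproj f x w) + dangle N x v * dheight f x w
        + chris (gram (proj f x)) (extChartAt (𝓡 n) (proj f x) (proj f x)) (dproj f x v)
          (normalH N x) (dproj f x w)) := by
  have hsrc : proj f x ∈ (extChartAt (𝓡 n) (proj f x)).source := mem_extChartAt_source _
  have h1 : (fun z => (trivializationAt (EuclideanSpace ℝ (Fin n) × ℝ)
      (TangentSpace ((𝓡 n).prod 𝓘(ℝ, ℝ)) : M × ℝ → Type _) (f x) ⟨f z, N z⟩).2) =ᶠ[𝓝 x]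
      fun z => (comp (proj f x) (proj f z) (normalH N z), angle f N z) := by
    filter_upwards [(hf.contMDiff_proj x).continuousAt.preimage_mem_nhds
      ((isOpen_extChartAt_source (I := 𝓡 n) (proj f x)).mem_nhds hsrc)] with z hz
    rw [trivializationAt_prod hz, angle_eq]
    rfl
  have h2 := (hasMFDerivAt_prodMk_space
    ((hf.contMDiffAt_comp hsrc).mdifferentiableAt (by simp)).hasMFDerivAt
    ((hf.contMDiff_angle x).mdifferentiableAt (by simp)).hasMFDerivAt).mfderiv
  have h3 := (h1.mfderiv_eq (I := 𝓡 n) (I' := 𝓘(ℝ, EuclideanSpace ℝ (Fin n) × ℝ))).trans h2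
  have h4 : ((mfderiv (𝓡 n) 𝓘(ℝ, EuclideanSpace ℝ (Fin n) × ℝ)
      (fun z => (trivializationAt (EuclideanSpace ℝ (Fin n) × ℝ)
      (TangentSpace ((𝓡 n).prod 𝓘(ℝ, ℝ)) : M × ℝ → Type _) (f x) ⟨f z, N z⟩).2) x :
      EuclideanSpace ℝ (Fin n) →L[ℝ] EuclideanSpace ℝ (Fin n) × ℝ)) v
      = (dnormalH N x v, dangle N x v) :=
    congrArg (fun A : EuclideanSpace ℝ (Fin n) →L[ℝ] EuclideanSpace ℝ (Fin n) × ℝ => A v) h3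
  have key : ∀ c d e : EuclideanSpace ℝ (Fin n) × ℝ,
      c = (dnormalH N x v, dangle N x v) → d = (dproj f x v, dheight f x v) →
      e = (dproj f x w, dheight f x w) →
      -(prodMetric (f x) c e + christoffel ((𝓡 n).prod 𝓘(ℝ, ℝ)) prodMetric (f x) d (N x) e)
        = -(metricForm (proj f x) (dnormalH N x v) (dproj f x w) + dangle N x v * dheight f x w
        + chris (gram (proj f x)) (extChartAt (𝓡 n) (proj f x) (proj f x)) (dproj f x v)
          (normalH N x) (dproj f x w)) := by
    rintro c d e rfl rfl rfl
    exact congrArg₂ (fun s t : ℝ => -(s + t)) rfl (christoffel_prod (f x) _ (N x) _)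
  exact key _ _ _ h4 (hf.mfderiv_eq x v) (hf.mfderiv_eq x w)

namespace IsLocalSection

variable {x : S} {U : Set (EuclideanSpace ℝ (Fin n))} {σ : EuclideanSpace ℝ (Fin n) → S}
  {y : EuclideanSpace ℝ (Fin n)}

theorem fderiv_angle_Y (hf : IsVerticalHelicoid f N) (hθ : angle f N x ≠ 0)
    (hσ : IsLocalSection f (proj f x) U σ) (hy : extChartAt (𝓡 n) (proj f x) (proj f x) = y)
    (hU : y ∈ U) (hx : σ y = x) :
    fderiv ℝ (fun z => angle f N (σ z)) y (sectionY N (proj f x) σ y) = 0 := by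
  have hh := hf.hypersurface
  have hsrc : proj f x ∈ (extChartAt (𝓡 n) (proj f x)).source := mem_extChartAt_source _
  have hUn := hσ.isOpen.mem_nhds hU
  have hYd : DifferentiableAt ℝ (sectionY N (proj f x) σ) y :=
    ((hσ.contDiffOn_Y hh).contDiffAt hUn).differentiableAt (by simp)
  have hθd : DifferentiableAt ℝ (fun z => angle f N (σ z)) y :=
    ((hσ.contDiffOn_angle hh).contDiffAt hUn).differentiableAt (by simp)
  have hGd : DifferentiableAt ℝ (gram (proj f x)) y :=
    (((contDiffOn_gram (proj f x)).mono hσ.subset).contDiffAt hUn).differentiableAt (by simp)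
  have hσd : MDifferentiableAt 𝓘(ℝ, EuclideanSpace ℝ (Fin n)) (𝓡 n) σ y :=
    (hσ.contMDiffAt hU).mdifferentiableAt (by simp)
  have hYy := hσ.sectionY_self (N := N) hU hx
  -- The gradient ∇ξ = ∂_t - θN has horizontal part -θY and vertical part 1 - θ². The vector v of
  -- the hypersurface over -θY is shown to have this height derivative and to represent dξ.
  set a : EuclideanSpace ℝ (Fin n) := -angle f N x • normalH N x with ha
  set v := dsection σ y a with hv
  have hdv : dproj f x v = a := hσ.dproj_dsection_self hh hy hU hx a
  have hhv : dheight f x v = 1 - angle f N x ^ 2 := by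
    have h := hh.metricForm_normalH_dproj x v
    rw [hdv, ha, map_smul, hh.metricForm_normalH, smul_eq_mul] at h
    exact mul_left_cancel₀ hθ (by linarith)
  have hgrad : IsHeightGradient f x v := by
    intro w
    have h := hh.metricForm_normalH_dproj x w
    have h1 : ∀ c d : EuclideanSpace ℝ (Fin n) × ℝ, c = (dproj f x v, dheight f x v) →
        d = (dproj f x w, dheight f x w) → prodMetric (f x) c d = dheight f x w := by
      rintro c d rfl rfl
      change metricForm (proj f x) (dproj f x v) (dproj f x w)
        + dheight f x v * dheight f x w = dheight f x w
      rw [hdv, hhv, ha, map_smul, LinearMap.smul_apply, smul_eq_mul]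
      linear_combination -angle f N x * h
    exact h1 _ _ (hh.mfderiv_eq x v) (hh.mfderiv_eq x w)
  have hA := hf.asymptotic x v hgrad
  have hA' := (hh.shapeForm_eq x v v).symm.trans hA
  rw [hdv, hhv] at hA'
  have e1 : dnormalH N x v = fderiv ℝ (sectionY N (proj f x) σ) y a := by
    have h3 := (hh.contMDiffAt_comp hsrc).mdifferentiableAt (by simp)
    rw [← hx] at h3
    have h4 := mfderiv_dsection h3 hσd a
    rw [hx] at h4
    exact h4
  have e2 : dangle N x v = fderiv ℝ (fun z => angle f N (σ z)) y a := by
    have h4 := mfderiv_dsection ((hh.contMDiff_angle (σ y)).mdifferentiableAt (by simp)) hσd a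
    rw [hx] at h4
    exact h4
  rw [e1, e2, ← gram_self, hy] at hA'
  refine fderiv_angle_eq_zero hGd hYd hθd (gram_symm _ _) ?_ (by rwa [hx]) ?_
  · filter_upwards [hUn] with z hz using hσ.gram_Y_Y hh hz
  · rw [hx, hYy, ← ha]
    linarith

/-- The quadratic forms of the sections vanish. -/
theorem lieForm_eq_zero_self (hf : IsVerticalHelicoid f N) (hθ : angle f N x ≠ 0)
    (hsec : ∀ v, dheight f x v = 0 → sectionShape N x v v = 0)
    (hσ : IsLocalSection f (proj f x) U σ) (hy : extChartAt (𝓡 n) (proj f x) (proj f x) = y)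
    (hU : y ∈ U) (hx : σ y = x) (a b : EuclideanSpace ℝ (Fin n)) :
    lieForm (gram (proj f x)) (killing (fun z => angle f N (σ z)) (sectionY N (proj f x) σ))
      y a b = 0 := by
  have hh := hf.hypersurface
  have hUn := hσ.isOpen.mem_nhds hU
  have hYd : DifferentiableAt ℝ (sectionY N (proj f x) σ) y :=
    ((hσ.contDiffOn_Y hh).contDiffAt hUn).differentiableAt (by simp)
  have hθd : DifferentiableAt ℝ (fun z => angle f N (σ z)) y :=
    ((hσ.contDiffOn_angle hh).contDiffAt hUn).differentiableAt (by simp)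
  have hud : ContDiffAt ℝ 2 (fun z => height f (σ z)) y :=
    ((hσ.contDiffOn_height hh).contDiffAt hUn).of_le (WithTop.coe_le_coe.2 le_top)
  have hGd : DifferentiableAt ℝ (gram (proj f x)) y :=
    (((contDiffOn_gram (proj f x)).mono hσ.subset).contDiffAt hUn).differentiableAt (by simp)
  have hθ1 := hf.no_horizontal_point x
  have hpos := hh.one_sub_angle_sq_pos hθ1
  have hsy : ∀ᶠ z in 𝓝 y, ∀ a b, gram (proj f x) z a b = gram (proj f x) z b a :=
    Eventually.of_forall fun z => gram_symm _ z
  -- For a ⊥ Y, the value L_Y g(a, a) is 2⟨∇_a Y, a⟩, a multiple of the quadratic form of the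
  -- section. Polarization then gives the bilinear form on the complement of Y.
  have hquad : ∀ a, gram (proj f x) y (sectionY N (proj f x) σ y) a = 0 →
      lieForm (gram (proj f x)) (sectionY N (proj f x) σ) y a a = 0 := by
    intro a ha
    have h1 := hσ.sectionShape_dsection hh hθ1 hy hU hx a a ha
    have h2 : dheight f x (dsection σ y a) = 0 := by
      have h := hσ.dheight_dsection hh hU a
      have h' := hσ.gram_Y hh hU a
      rw [ha, zero_add, hx] at h'
      rw [hx] at h
      exact h.trans ((mul_eq_zero.1 h').resolve_left hθ)
    rw [hsec _ h2] at h1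
    have h3 := (mul_eq_zero.1 h1.symm).resolve_left (inv_ne_zero (Real.sqrt_pos.2 hpos).ne')
    rw [lieForm_eq_add hGd hsy, h3, add_zero]
  refine lieForm_killing hGd hYd hθd hud hsy ?_ ?_ (by rwa [hx]) (by rw [hx]; exact hpos.ne')
    (hσ.fderiv_angle_Y hf hθ hy hU hx) ?_ a b
  · filter_upwards [hUn] with z hz using hσ.gram_Y_Y hh hz
  · filter_upwards [hUn] with z hz using hσ.gram_Y hh hz
  · intro a b ha hb
    have h1 := hquad (a + b) (by rw [map_add, ha, hb, add_zero])
    have h2 := hquad a ha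
    have h3 := hquad b hb
    have h4 : lieForm (gram (proj f x)) (sectionY N (proj f x) σ) y a b
        = lieForm (gram (proj f x)) (sectionY N (proj f x) σ) y b a := by
      rw [lieForm_eq_add hGd hsy, lieForm_eq_add hGd hsy, add_comm]
    have h5 : lieForm (gram (proj f x)) (sectionY N (proj f x) σ) y (a + b) (a + b)
        = lieForm (gram (proj f x)) (sectionY N (proj f x) σ) y a a
        + lieForm (gram (proj f x)) (sectionY N (proj f x) σ) y a b
        + lieForm (gram (proj f x)) (sectionY N (proj f x) σ) y b a
        + lieForm (gram (proj f x)) (sectionY N (proj f x) σ) y b b := by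
      unfold lieForm
      simp only [map_add, add_apply]
      ring
    linarith

/-- A local section, read in the preferred chart at another point. -/
theorem transition_section {p₀ q : M} (hσ : IsLocalSection f p₀ U σ) :
    IsLocalSection f q (((extChartAt (𝓡 n) q).target ∩ (extChartAt (𝓡 n) q).symm ⁻¹'
      (extChartAt (𝓡 n) p₀).source)
        ∩ transition q p₀ ⁻¹' U) (fun z => σ (transition q p₀ z)) := by
  have ho : IsOpen ((extChartAt (𝓡 n) q).target ∩
      (extChartAt (𝓡 n) q).symm ⁻¹' (extChartAt (𝓡 n) p₀).source) :=
    (continuousOn_extChartAt_symm q).isOpen_inter_preimage (isOpen_extChartAt_target q)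
      (isOpen_extChartAt_source p₀)
  have hc : ContinuousOn (transition q p₀) ((extChartAt (𝓡 n) q).target ∩
      (extChartAt (𝓡 n) q).symm ⁻¹' (extChartAt (𝓡 n) p₀).source) :=
    fun z hz => (contDiffAt_transition hz.1 hz.2).continuousAt.continuousWithinAt
  refine ⟨hc.isOpen_inter_preimage ho hσ.isOpen, fun z hz => hz.1.1, fun z hz => ?_,
    fun z hz => ?_⟩
  · exact ((hσ.contMDiffAt hz.2).comp z
      (contDiffAt_transition hz.1.1 hz.1.2).contMDiffAt).contMDiffWithinAt
  · rw [hσ.proj_eq _ hz.2, transition, (extChartAt (𝓡 n) p₀).left_inv hz.1.2]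

theorem contDiffOn_killing {p₀ : M} (hf : IsVerticalHelicoid f N)
    (hσ : IsLocalSection f p₀ U σ) :
    ContDiffOn ℝ ∞ (killing (fun z => angle f N (σ z)) (sectionY N p₀ σ)) U := by
  have hθ := hσ.contDiffOn_angle hf.hypersurface
  refine ContDiffOn.smul (ContDiffOn.div hθ.neg (contDiffOn_const.sub (hθ.pow 2)) fun z _ => ?_)
    (hσ.contDiffOn_Y hf.hypersurface)
  exact (hf.hypersurface.one_sub_angle_sq_pos (hf.no_horizontal_point _)).ne'

theorem differentiableAt_killing {p₀ : M} (hf : IsVerticalHelicoid f N)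
    (hσ : IsLocalSection f p₀ U σ) (hy : y ∈ U) :
    DifferentiableAt ℝ (killing (fun z => angle f N (σ z)) (sectionY N p₀ σ)) y :=
  ((hσ.contDiffOn_killing hf).contDiffAt (hσ.isOpen.mem_nhds hy)).differentiableAt (by simp)

theorem differentiableAt_gram {p₀ : M} (hσ : IsLocalSection f p₀ U σ) (hy : y ∈ U) :
    DifferentiableAt ℝ (gram p₀) y :=
  (((contDiffOn_gram p₀).mono hσ.subset).contDiffAt (hσ.isOpen.mem_nhds hy)).differentiableAt
    (by simp)

/-- The preceding identity is available only at the centre of a chart. At a general point of U, the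
field and the metric are read in the chart centred there and the Lie form is carried over by
`lieForm_change`. -/
theorem lieForm_killing_eq_zero {p₀ : M} (hf : IsVerticalHelicoid f N)
    (hθ : ∀ x, angle f N x ≠ 0)
    (hsec : ∀ x v, dheight f x v = 0 → sectionShape N x v v = 0)
    (hσ : IsLocalSection f p₀ U σ) (hy : y ∈ U) (a b : EuclideanSpace ℝ (Fin n)) :
    lieForm (gram p₀) (killing (fun z => angle f N (σ z)) (sectionY N p₀ σ)) y a b = 0 := by
  have hh := hf.hypersurface
  set q := proj f (σ y) with hq
  have hσ' := hσ.transition_section (q := q)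
  set U' := ((extChartAt (𝓡 n) q).target ∩
    (extChartAt (𝓡 n) q).symm ⁻¹' (extChartAt (𝓡 n) p₀).source) ∩ transition q p₀ ⁻¹' U with hU'
  have hqs : q ∈ (extChartAt (𝓡 n) q).source := mem_extChartAt_source q
  have hτy : transition p₀ q y = extChartAt (𝓡 n) q q := by
    rw [transition, ← hσ.proj_eq y hy]
  have hmem : ∀ z ∈ U, proj f (σ z) ∈ (extChartAt (𝓡 n) q).source →
      transition q p₀ (transition p₀ q z) = z := by
    intro z hz hzq
    rw [transition, transition, ← hσ.proj_eq z hz, (extChartAt (𝓡 n) q).left_inv hzq,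
      hσ.chart_proj hz]
  have hback : transition q p₀ (extChartAt (𝓡 n) q q) = y := by
    rw [← hτy]
    exact hmem y hy hqs
  have hyU' : extChartAt (𝓡 n) q q ∈ U' := by
    refine ⟨⟨mem_extChartAt_target q, ?_⟩, ?_⟩
    · rw [mem_preimage, extChartAt_to_inv]
      exact hσ.proj_mem hy
    · rw [mem_preimage, hback]
      exact hy
  have hnear : ∀ᶠ z in 𝓝 y, z ∈ U ∧ proj f (σ z) ∈ (extChartAt (𝓡 n) q).source := by
    have hc : ContinuousAt (fun z => proj f (σ z)) y :=
      ((hh.contMDiff_proj (σ y)).comp y (hσ.contMDiffAt hy)).continuousAt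
    filter_upwards [hσ.isOpen.mem_nhds hy,
      hc.preimage_mem_nhds ((isOpen_extChartAt_source (I := 𝓡 n) q).mem_nhds hqs)] with z h1 h2
    exact ⟨h1, h2⟩
  have hyq : (extChartAt (𝓡 n) p₀).symm y ∈ (extChartAt (𝓡 n) q).source := by
    rw [← hσ.proj_eq y hy]
    exact hqs
  -- The metrics correspond under the change of charts by `gram_transition`; the fields do because
  -- both are components of the same tangent vector of M.
  rw [lieForm_change (G' := gram q) (τ := transition p₀ q)
    (X' := killing (fun z => angle f N (σ (transition q p₀ z)))
      (sectionY N q fun z => σ (transition q p₀ z)))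
    ((contDiffAt_transition (hσ.subset hy) hyq).of_le (WithTop.coe_le_coe.2 le_top))
    (by rw [hτy]; exact hσ'.differentiableAt_gram hyU') (hσ.differentiableAt_killing hf hy)
    (hσ.differentiableAt_gram hy) (by rw [hτy]; exact hσ'.differentiableAt_killing hf hyU')
    ?_ ?_ a b, hτy]
  · exact lieForm_eq_zero_self hf (hθ _) (hsec _) hσ' rfl hyU' (by rw [hback]) _ _
  · filter_upwards [hnear] with z hz a b
    refine gram_transition (hσ.subset hz.1) ?_ a b
    rw [← hσ.proj_eq z hz.1]
    exact hz.2
  · filter_upwards [hnear] with z hz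
    have hzq : (extChartAt (𝓡 n) p₀).symm z ∈ (extChartAt (𝓡 n) q).source := by
      rw [← hσ.proj_eq z hz.1]
      exact hz.2
    have h1 := dchartSymm_dchart (hσ.proj_mem hz.1) (normalH N (σ z))
    rw [hσ.chart_proj hz.1] at h1
    simp only [killing, sectionY, hmem z hz.1 hz.2]
    rw [map_smul, comp_eq_dchart (hσ.proj_mem hz.1), fderiv_transition (hσ.subset hz.1) hzq, h1,
      comp_eq_dchart hz.2, hσ.proj_eq z hz.1]

end IsLocalSection

/-- Where the angle function does not vanish, the hypersurface is locally a graph over `M`. -/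
theorem IsOrientedHypersurface.exists_isLocalSection (hf : IsOrientedHypersurface f N) {x₀ : S}
    (hθ : angle f N x₀ ≠ 0) :
    ∃ (U : Set (EuclideanSpace ℝ (Fin n))) (σ : EuclideanSpace ℝ (Fin n) → S),
      IsLocalSection f (proj f x₀) U σ ∧ extChartAt (𝓡 n) (proj f x₀) (proj f x₀) ∈ U ∧
      σ (extChartAt (𝓡 n) (proj f x₀) (proj f x₀)) = x₀ ∧
      ∀ V ⊆ U, IsOpen V → IsOpen (σ '' V) := by
  set p₀ := proj f x₀ with hp₀
  set φ := extChartAt (𝓡 n) x₀ with hφ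
  set ψ := extChartAt (𝓡 n) p₀ with hψ
  have hc : ContinuousOn (fun z => proj f (φ.symm z)) φ.target :=
    hf.contMDiff_proj.continuous.comp_continuousOn (continuousOn_extChartAt_symm x₀)
  set s := φ.target ∩ (fun z => proj f (φ.symm z)) ⁻¹' ψ.source with hs
  have hso : IsOpen s := hc.isOpen_inter_preimage (isOpen_extChartAt_target x₀)
    (isOpen_extChartAt_source p₀)
  have hxs : φ x₀ ∈ s := by
    refine ⟨mem_extChartAt_target x₀, ?_⟩
    rw [mem_preimage, hφ, extChartAt_to_inv]
    exact mem_extChartAt_source p₀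
  let F : EuclideanSpace ℝ (Fin n) → EuclideanSpace ℝ (Fin n) := fun z => ψ (proj f (φ.symm z))
  have hFm : ∀ z ∈ s, ContMDiffAt 𝓘(ℝ, EuclideanSpace ℝ (Fin n)) 𝓘(ℝ, EuclideanSpace ℝ (Fin n)) ∞
      F z := fun z hz => (contMDiffAt_extChartAt_of_mem hz.2).comp z
    ((hf.contMDiff_proj _).comp z (contMDiffAt_extChartAt_symm hz.1))
  have hF : ContDiffOn ℝ ∞ F s := fun z hz =>
    (contMDiffAt_iff_contDiffAt.1 (hFm z hz)).contDiffWithinAt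
  -- An injective endomorphism of a finite-dimensional space is invertible, so the inverse function
  -- theorem applies to the projection read in charts.
  let L : EuclideanSpace ℝ (Fin n) ≃L[ℝ] EuclideanSpace ℝ (Fin n) :=
    (LinearEquiv.ofInjectiveEndo (dproj f x₀).toLinearMap
      (hf.dproj_injective hθ)).toContinuousLinearEquiv
  have hL : HasFDerivAt F (L : EuclideanSpace ℝ (Fin n) →L[ℝ] EuclideanSpace ℝ (Fin n))
      (φ x₀) := by
    have h1 := ((hF.contDiffAt (hso.mem_nhds hxs)).differentiableAt (by simp)).hasFDerivAt
    refine h1.congr_fderiv ?_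
    ext1 v
    have h2 := mfderiv_comp (φ x₀) ((contMDiffAt_extChartAt_of_mem hxs.2).mdifferentiableAt
      (by simp)) (((hf.contMDiff_proj _).comp (φ x₀)
        (contMDiffAt_extChartAt_symm hxs.1)).mdifferentiableAt (by simp))
    have h3 := mfderiv_comp (φ x₀) ((hf.contMDiff_proj (φ.symm (φ x₀))).mdifferentiableAt (by simp))
      ((contMDiffAt_extChartAt_symm hxs.1).mdifferentiableAt (by simp))
    have h4 : fderiv ℝ F (φ x₀) v = dchart p₀ (proj f (φ.symm (φ x₀)))
        (dproj f (φ.symm (φ x₀)) (dchartSymm x₀ (φ x₀) v)) := by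
      have h5 : fderiv ℝ F (φ x₀) = _ := mfderiv_eq_fderiv.symm.trans h2
      rw [h5]
      exact congrArg (fun A : EuclideanSpace ℝ (Fin n) →L[ℝ] EuclideanSpace ℝ (Fin n) =>
        dchart p₀ (proj f (φ.symm (φ x₀))) (A v)) h3
    rw [h4, hφ, dchartSymm_self, extChartAt_to_inv, hp₀, dchart_self]
    rfl
  obtain ⟨h, hx, hsub, hh, hsm⟩ := exists_openPartialHomeomorph_contDiffOn hso hF hxs hL
  have hinv : ∀ y ∈ h.target, ψ (proj f (φ.symm (h.symm y))) = y := by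
    intro y hy
    have := h.right_inv hy
    rwa [hh] at this
  have hsrc : ∀ y ∈ h.target, h.symm y ∈ s := fun y hy => hsub (h.map_target hy)
  have hFx : F (φ x₀) = ψ p₀ := by
    simp only [F, hφ, extChartAt_to_inv, ← hp₀]
  refine ⟨h.target, fun y => φ.symm (h.symm y), ⟨h.open_target, ?_, ?_, ?_⟩, ?_, ?_, ?_⟩
  · intro y hy
    rw [← hinv y hy]
    exact ψ.map_source (hsrc y hy).2
  · intro y hy
    exact ((contMDiffAt_extChartAt_symm (hsrc y hy).1).comp y
      ((hsm.contDiffAt (h.open_target.mem_nhds hy)).contMDiffAt)).contMDiffWithinAt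
  · intro y hy
    have := congrArg ψ.symm (hinv y hy)
    rwa [ψ.left_inv (hsrc y hy).2] at this
  · have := h.map_source hx
    rwa [hh, hFx] at this
  · have := h.left_inv hx
    rw [hh, hFx] at this
    change φ.symm (h.symm (ψ p₀)) = x₀
    rw [this, hφ, extChartAt_to_inv]
  · intro V hV hVo
    have h1 : IsOpen (h.symm '' V) := h.symm.isOpen_image_of_subset_source hVo hV
    -- Described as a preimage inside the chart domain, the image of V under the section is visibly
    -- open in the hypersurface.
    have h2 : (fun y => φ.symm (h.symm y)) '' V = φ.source ∩ φ ⁻¹' (h.symm '' V) := by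
      ext x
      constructor
      · rintro ⟨y, hy, rfl⟩
        have := (hsrc y (hV hy)).1
        exact ⟨φ.map_target this, ⟨y, hy, by rw [φ.right_inv this]⟩⟩
      · rintro ⟨hxs, y, hy, hyx⟩
        exact ⟨y, hy, (congrArg φ.symm hyx).trans (φ.left_inv hxs)⟩
    rw [h2]
    exact (continuousOn_extChartAt x₀).isOpen_inter_preimage (isOpen_extChartAt_source x₀) h1

end KillingField

/-! ### Flow boxes and the growth of the height along the flow. -/

section FlowBox

open Metric Filter Topology

variable {E K : Type*} [NormedAddCommGroup E] [NormedSpace ℝ E]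
  [NormedAddCommGroup K] [NormedSpace ℝ K]

/-- Along the flow of a field `X` with `du(X) = 1`, the function `u` grows at unit speed. -/
theorem flow_height {U B : Set E} {X : E → E} {u : E → ℝ} {Fl : ℝ → E → E} {a : ℝ}
    (hU : IsOpen U) (hu : DifferentiableOn ℝ u U) (huX : ∀ y ∈ U, fderiv ℝ u y (X y) = 1)
    (h0 : ∀ y ∈ B, Fl 0 y = y) (hin : ∀ y ∈ B, ∀ t ∈ Ioo (-a) a, Fl t y ∈ U)
    (hd : ∀ y ∈ B, ∀ t ∈ Ioo (-a) a, HasDerivAt (fun t => Fl t y) (X (Fl t y)) t)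
    {y : E} (hy : y ∈ B) {t : ℝ} (ht : t ∈ Ioo (-a) a) : u (Fl t y) = u y + t := by
  have hda : ∀ s ∈ Ioo (-a) a, HasDerivAt (fun s => u (Fl s y) - s) 0 s := by
    intro s hs
    have hm := hin y hy s hs
    have h1 := ((hu.differentiableAt (hU.mem_nhds hm)).hasFDerivAt.comp_hasDerivAt s
      (hd y hy s hs)).sub (hasDerivAt_id s)
    rw [huX _ hm, sub_self] at h1
    exact h1
  have h0m : (0 : ℝ) ∈ Ioo (-a) a := by
    constructor <;> linarith [ht.1, ht.2]
  have h := isOpen_Ioo.is_const_of_deriv_eq_zero isPreconnected_Ioo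
    (fun s hs => (hda s hs).differentiableAt.differentiableWithinAt)
    (fun s hs => (hda s hs).deriv) ht h0m
  simp only [h0 y hy] at h
  linarith

/-- Near a point, the flow of `X` straightens a neighborhood into the product of an interval and a
transversal slice. -/
theorem exists_flow_box [CompleteSpace E] [CompleteSpace K] {X : E → E}
    {Fl : ℝ → E → E} {a r ρ : ℝ} {y₀ : E} {c : K → E} (ha : 0 < a) (hr : 0 < r) (hρ : 0 < ρ)
    (hsm : ContDiffOn ℝ ∞ (fun q : ℝ × E => Fl q.1 q.2) (Ioo (-a) a ×ˢ ball y₀ r))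
    (h0 : ∀ y ∈ ball y₀ r, Fl 0 y = y)
    (hd : HasDerivAt (fun t => Fl t y₀) (X y₀) 0)
    (hc : ContDiffOn ℝ ∞ c (ball 0 ρ)) (hc0 : c 0 = y₀) (e : (ℝ × K) ≃L[ℝ] E)
    (he : ∀ q : ℝ × K, e q = q.1 • X y₀ + fderiv ℝ c 0 q.2) :
    ∃ ε > 0, ∃ δ > 0, ε ≤ a ∧ δ ≤ ρ ∧ (∀ z ∈ ball (0 : K) δ, c z ∈ ball y₀ r) ∧
      IsOpen ((fun q : ℝ × K => Fl q.1 (c q.2)) '' (Ioo (-ε) ε ×ˢ ball 0 δ)) ∧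
      ((fun q : ℝ × K => Fl q.1 (c q.2)) '' (Ioo (-ε) ε ×ˢ ball 0 δ)) ⊆ ball y₀ r ∧
      IsConnected ((fun q : ℝ × K => Fl q.1 (c q.2)) '' (Ioo (-ε) ε ×ˢ ball 0 δ)) := by
  set Φ : ℝ × K → E := fun q => Fl q.1 (c q.2) with hΦ
  set W : Set K := ball 0 ρ ∩ c ⁻¹' ball y₀ r with hW
  have hWo : IsOpen W := hc.continuousOn.isOpen_inter_preimage isOpen_ball isOpen_ball
  have h0W : (0 : K) ∈ W := ⟨mem_ball_self hρ, by rw [mem_preimage, hc0]; exact mem_ball_self hr⟩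
  have hI0 : (0 : ℝ) ∈ Ioo (-a) a := ⟨neg_lt_zero.2 ha, ha⟩
  have hso : IsOpen (Ioo (-a) a ×ˢ W) := isOpen_Ioo.prod hWo
  have hs0 : ((0 : ℝ), (0 : K)) ∈ Ioo (-a) a ×ˢ W := ⟨hI0, h0W⟩
  have hΦs : ContDiffOn ℝ ∞ Φ (Ioo (-a) a ×ˢ W) :=
    hsm.comp (contDiffOn_fst.prodMk ((hc.mono inter_subset_left).comp contDiffOn_snd
      fun q hq => hq.2)) fun q hq => ⟨hq.1, hq.2.2⟩
  have hΦ00 : Φ (0, 0) = y₀ := by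
    simp only [hΦ, hc0]
    exact h0 _ (mem_ball_self hr)
  have hΦd : HasFDerivAt Φ (e : ℝ × K →L[ℝ] E) (0, 0) := by
    have hD := ((hΦs.contDiffAt (hso.mem_nhds hs0)).differentiableAt (by simp)).hasFDerivAt
    refine hD.congr_fderiv ?_
    have e1 : ∀ s : ℝ, fderiv ℝ Φ (0, 0) (s, 0) = s • X y₀ := by
      have hl : HasDerivAt (fun t : ℝ => (t, (0 : K))) (1, 0) 0 :=
        (hasDerivAt_id (0 : ℝ)).prodMk (hasDerivAt_const (0 : ℝ) (0 : K))
      have h1 : HasDerivAt (fun t : ℝ => Φ (t, 0)) (fderiv ℝ Φ (0, 0) (1, 0)) 0 :=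
        HasFDerivAt.comp_hasDerivAt (l := Φ) (0 : ℝ) hD hl
      have h2 : HasDerivAt (fun t : ℝ => Φ (t, 0)) (X y₀) 0 := by
        simp only [hΦ, hc0]
        exact hd
      intro s
      rw [← h1.unique h2, ← map_smul, Prod.smul_mk, smul_eq_mul, mul_one, smul_zero]
    have e2 : ∀ k : K, fderiv ℝ Φ (0, 0) (0, k) = fderiv ℝ c 0 k := by
      have hl : HasFDerivAt (fun z : K => ((0 : ℝ), z)) (ContinuousLinearMap.inr ℝ ℝ K) 0 :=
        hasFDerivAt_prodMk_right 0 0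
      have h1 : HasFDerivAt (fun z : K => Φ (0, z))
          ((fderiv ℝ Φ (0, 0)).comp (ContinuousLinearMap.inr ℝ ℝ K)) 0 := hD.comp (0 : K) hl
      have h2 : (fun z : K => Φ (0, z)) =ᶠ[𝓝 0] c := by
        filter_upwards [hWo.mem_nhds h0W] with z hz using h0 _ hz.2
      intro k
      rw [← h2.fderiv_eq, h1.fderiv]
      rfl
    refine ContinuousLinearMap.ext fun q => ?_
    change fderiv ℝ Φ (0, 0) q = e q
    rw [he, ← e1, ← e2, ← map_add, Prod.mk_add_mk, add_zero, zero_add]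
  -- The derivative of (t, z) ↦ Fl_t(c(z)) at the origin is `e`: the time direction gives X, the
  -- slice gives the derivative of c. A small product box is then mapped diffeomorphically onto an
  -- open set, and is connected.
  obtain ⟨h, hx, hsub, hh, -⟩ := exists_openPartialHomeomorph_contDiffOn hso hΦs hs0 hΦd
  have hV : IsOpen (h.source ∩ h ⁻¹' ball y₀ r) := h.isOpen_inter_preimage isOpen_ball
  have hV0 : ((0 : ℝ), (0 : K)) ∈ h.source ∩ h ⁻¹' ball y₀ r := by
    refine ⟨hx, ?_⟩
    rw [mem_preimage, hh, hΦ00]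
    exact mem_ball_self hr
  obtain ⟨η, hη, hball⟩ := Metric.isOpen_iff.1 hV _ hV0
  rw [← ball_prod_same] at hball
  have hsubs : Ioo (-min η a) (min η a) ×ˢ ball (0 : K) (min η ρ) ⊆
      h.source ∩ h ⁻¹' ball y₀ r := by
    refine (Set.prod_mono ?_ (ball_subset_ball (min_le_left _ _))).trans hball
    rw [Real.ball_eq_Ioo, zero_sub, zero_add]
    exact Ioo_subset_Ioo (neg_le_neg (min_le_left _ _)) (min_le_left _ _)
  have hfun : (h : ℝ × K → E) = Φ := funext hh
  have hpε : 0 < min η a := lt_min hη ha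
  have hpδ : 0 < min η ρ := lt_min hη hρ
  refine ⟨min η a, hpε, min η ρ, hpδ, min_le_right _ _, min_le_right _ _, fun z hz => ?_,
    ?_, ?_, ?_⟩
  · have := hsub (hsubs (⟨⟨neg_lt_zero.2 hpε, hpε⟩, hz⟩ :
      ((0 : ℝ), z) ∈ Ioo (-min η a) (min η a) ×ˢ ball (0 : K) (min η ρ))).1
    exact this.2.2
  · rw [← hfun]
    exact h.isOpen_image_of_subset_source (isOpen_Ioo.prod isOpen_ball)
      (hsubs.trans inter_subset_left)
  · rintro _ ⟨q, hq, rfl⟩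
    rw [← hfun]
    exact (hsubs hq).2
  · refine IsConnected.image (s := Ioo (-min η a) (min η a) ×ˢ ball (0 : K) (min η ρ))
      ⟨⟨(0, 0), ⟨neg_lt_zero.2 hpε, hpε⟩, mem_ball_self hpδ⟩,
      isPreconnected_Ioo.prod (convex_ball _ _).isPreconnected⟩ _ ?_
    exact hΦs.continuousOn.mono ((hsubs.trans inter_subset_left).trans hsub)

end FlowBox

/-! ### Coordinate maps as maps of M. -/

section Assembly

set_option linter.unusedSectionVars false
set_option synthInstance.maxHeartbeats 200000

open Metric Filter Topology

variable {n : ℕ} {M : Type*} [TopologicalSpace M] [ChartedSpace (EuclideanSpace ℝ (Fin n)) M]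
  [IsManifold (𝓡 n) ∞ M] [RiemannianBundle (fun p : M => TangentSpace (𝓡 n) p)]
  [IsContMDiffRiemannianBundle (𝓡 n) ∞ (EuclideanSpace ℝ (Fin n))
    (fun p : M => TangentSpace (𝓡 n) p)]
  {S : Type*} [TopologicalSpace S] [ChartedSpace (EuclideanSpace ℝ (Fin n)) S]
  [IsManifold (𝓡 n) ∞ S]
  {f : S → M × ℝ} {N : ∀ x : S, TangentSpace ((𝓡 n).prod 𝓘(ℝ, ℝ)) (f x)}

/-- A map of `M`, read in the preferred chart at `p₀`. -/
def chartConj (p₀ : M) (F : EuclideanSpace ℝ (Fin n) → EuclideanSpace ℝ (Fin n)) (p : M) : M :=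
  (extChartAt (𝓡 n) p₀).symm (F (extChartAt (𝓡 n) p₀ p))

theorem mfderiv_chartConj {p₀ p : M} {F : EuclideanSpace ℝ (Fin n) → EuclideanSpace ℝ (Fin n)}
    (hp : p ∈ (extChartAt (𝓡 n) p₀).source)
    (hF : DifferentiableAt ℝ F (extChartAt (𝓡 n) p₀ p))
    (hFp : F (extChartAt (𝓡 n) p₀ p) ∈ (extChartAt (𝓡 n) p₀).target)
    (v : EuclideanSpace ℝ (Fin n)) : mfderiv (𝓡 n) (𝓡 n) (chartConj p₀ F) p v
      = dchartSymm p₀ (F (extChartAt (𝓡 n) p₀ p))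
          (fderiv ℝ F (extChartAt (𝓡 n) p₀ p) (dchart p₀ p v)) := by
  have hc := (contMDiffAt_extChartAt_of_mem hp).mdifferentiableAt (n := ∞) (by simp)
  have h1 := mfderiv_comp p (hF.mdifferentiableAt) hc
  have h2 := mfderiv_comp p ((contMDiffAt_extChartAt_symm hFp).mdifferentiableAt (by simp))
    (hF.mdifferentiableAt.comp p hc)
  rw [mfderiv_eq_fderiv] at h1
  have h3 : (mfderiv (𝓡 n) (𝓡 n) (chartConj p₀ F) p :
      EuclideanSpace ℝ (Fin n) →L[ℝ] EuclideanSpace ℝ (Fin n)) = _ := h2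
  refine (congrArg (fun A : EuclideanSpace ℝ (Fin n) →L[ℝ] EuclideanSpace ℝ (Fin n) => A v)
    h3).trans ?_
  exact congrArg (fun A : EuclideanSpace ℝ (Fin n) →L[ℝ] EuclideanSpace ℝ (Fin n) =>
    dchartSymm p₀ (F (extChartAt (𝓡 n) p₀ p)) (A v)) h1

theorem metric_mfderiv_chartConj {p₀ p : M}
    {F : EuclideanSpace ℝ (Fin n) → EuclideanSpace ℝ (Fin n)}
    (hp : p ∈ (extChartAt (𝓡 n) p₀).source)
    (hF : DifferentiableAt ℝ F (extChartAt (𝓡 n) p₀ p))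
    (hFp : F (extChartAt (𝓡 n) p₀ p) ∈ (extChartAt (𝓡 n) p₀).target)
    (hiso : ∀ a b, gram p₀ (F (extChartAt (𝓡 n) p₀ p)) (fderiv ℝ F (extChartAt (𝓡 n) p₀ p) a)
      (fderiv ℝ F (extChartAt (𝓡 n) p₀ p) b) = gram p₀ (extChartAt (𝓡 n) p₀ p) a b)
    (v w : EuclideanSpace ℝ (Fin n)) :
    metric (chartConj p₀ F p) (mfderiv (𝓡 n) (𝓡 n) (chartConj p₀ F) p v)
      (mfderiv (𝓡 n) (𝓡 n) (chartConj p₀ F) p w) = metricForm p v w := by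
  have h := hiso (dchart p₀ p v) (dchart p₀ p w)
  rw [gram_dchart hp, gram_apply] at h
  refine Eq.trans ?_ h
  have key : ∀ a b : EuclideanSpace ℝ (Fin n),
      a = dchartSymm p₀ (F (extChartAt (𝓡 n) p₀ p))
          (fderiv ℝ F (extChartAt (𝓡 n) p₀ p) (dchart p₀ p v)) →
      b = dchartSymm p₀ (F (extChartAt (𝓡 n) p₀ p))
          (fderiv ℝ F (extChartAt (𝓡 n) p₀ p) (dchart p₀ p w)) →
      metricForm (chartConj p₀ F p) a b = metricForm
        ((extChartAt (𝓡 n) p₀).symm (F (extChartAt (𝓡 n) p₀ p)))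
        (dchartSymm p₀ (F (extChartAt (𝓡 n) p₀ p))
          (fderiv ℝ F (extChartAt (𝓡 n) p₀ p) (dchart p₀ p v)))
        (dchartSymm p₀ (F (extChartAt (𝓡 n) p₀ p))
          (fderiv ℝ F (extChartAt (𝓡 n) p₀ p) (dchart p₀ p w))) := by
    rintro a b rfl rfl
    rfl
  exact key _ _ (mfderiv_chartConj hp hF hFp v) (mfderiv_chartConj hp hF hFp w)

namespace IsLocalSection

variable {U : Set (EuclideanSpace ℝ (Fin n))} {σ : EuclideanSpace ℝ (Fin n) → S} {p₀ : M}
  {y : EuclideanSpace ℝ (Fin n)}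

/-- From -θ du(Y) = g(Y, Y) = 1 - θ². The value 1 is the pitch of the twisting: the flow of X raises
the height at unit speed. -/
theorem fderiv_height_killing (hf : IsVerticalHelicoid f N)
    (hσ : IsLocalSection f p₀ U σ) (hy : y ∈ U) :
    fderiv ℝ (fun z => height f (σ z)) y
      (killing (fun z => angle f N (σ z)) (sectionY N p₀ σ) y) = 1 := by
  have h1 := hσ.gram_Y hf.hypersurface hy (sectionY N p₀ σ y)
  rw [hσ.gram_Y_Y hf.hypersurface hy] at h1
  have hpos := hf.hypersurface.one_sub_angle_sq_pos (hf.no_horizontal_point (σ y))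
  rw [killing, map_smul, smul_eq_mul, div_mul_eq_mul_div, div_eq_one_iff_eq hpos.ne']
  linarith

/-- A smooth function in the preferred chart at `p₀`, as a function on `M`. -/
theorem mfderiv_comp_chart {p : M} {u : EuclideanSpace ℝ (Fin n) → ℝ}
    (hp : p ∈ (extChartAt (𝓡 n) p₀).source) (hu : DifferentiableAt ℝ u (extChartAt (𝓡 n) p₀ p))
    (v : EuclideanSpace ℝ (Fin n)) :
    (mfderiv (𝓡 n) 𝓘(ℝ, ℝ) (fun q => u (extChartAt (𝓡 n) p₀ q)) p :
      EuclideanSpace ℝ (Fin n) →L[ℝ] ℝ) v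
      = fderiv ℝ u (extChartAt (𝓡 n) p₀ p) (dchart p₀ p v) := by
  have hc := (contMDiffAt_extChartAt_of_mem hp).mdifferentiableAt (n := ∞) (by simp)
  have h1 := mfderiv_comp p (hu.mdifferentiableAt) hc
  rw [mfderiv_eq_fderiv] at h1
  exact congrArg (fun A : EuclideanSpace ℝ (Fin n) →L[ℝ] ℝ => A v) h1

end IsLocalSection

end Assembly

/-! ### Parametrization of a regular level set. -/

section LevelSlice

open Metric Filter Topology

variable {E : Type*} [NormedAddCommGroup E] [NormedSpace ℝ E]

/-- A regular level set of `u` through `y₀` is parametrized by the kernel of `du`, by flowing along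
a field `X` with `du(X) = 1`. -/
theorem exists_level_slice [FiniteDimensional ℝ E] {U : Set E} {X : E → E} {u : E → ℝ}
    (hU : IsOpen U) (hX : ContDiffOn ℝ ∞ X U) (hu : ContDiffOn ℝ ∞ u U)
    (huX : ∀ y ∈ U, fderiv ℝ u y (X y) = 1) {y₀ : E} (hy₀ : y₀ ∈ U) :
    ∃ ρ > 0, ∃ c : (fderiv ℝ u y₀).ker → E, ContDiffOn ℝ ∞ c (ball 0 ρ) ∧ c 0 = y₀ ∧
      (∀ z ∈ ball 0 ρ, u (c z) = u y₀) ∧ ∀ k, fderiv ℝ c 0 k = k := by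
  obtain ⟨a, ha, r, hr, Fl, hB, hsm, h0, hin, hd, -, -⟩ := exists_local_flow hU hX hy₀
  set K := (fderiv ℝ u y₀).ker with hK
  -- From y₀ + k the flow of X reaches the level of y₀ after exactly the time u(y₀) - u(y₀ + k).
  -- This time has zero derivative at k = 0, because k lies in the kernel of du; hence c has the
  -- inclusion as its derivative there.
  let g : K → ℝ × E := fun k => (u y₀ - u (y₀ + k), y₀ + k)
  have hI0 : (0 : ℝ) ∈ Ioo (-a) a := ⟨neg_lt_zero.2 ha, ha⟩
  have hyB : y₀ ∈ ball y₀ r := mem_ball_self hr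
  have hud := hu.differentiableOn (by simp)
  have htr : ContDiff ℝ ∞ (fun k : K => y₀ + (k : E)) := contDiff_const.add K.subtypeL.contDiff
  have hT : IsOpen ((fun k : K => y₀ + (k : E)) ⁻¹' ball y₀ r) :=
    isOpen_ball.preimage htr.continuous
  have hgT : ContDiffOn ℝ ∞ g ((fun k : K => y₀ + (k : E)) ⁻¹' ball y₀ r) :=
    (contDiffOn_const.sub (hu.comp htr.contDiffOn fun k hk => hB hk)).prodMk htr.contDiffOn
  have hO : IsOpen (((fun k : K => y₀ + (k : E)) ⁻¹' ball y₀ r) ∩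
      g ⁻¹' (Ioo (-a) a ×ˢ ball y₀ r)) :=
    hgT.continuousOn.isOpen_inter_preimage hT (isOpen_Ioo.prod isOpen_ball)
  have hg0 : g 0 = (0, y₀) := by simp [g]
  have h0O : (0 : K) ∈ ((fun k : K => y₀ + (k : E)) ⁻¹' ball y₀ r) ∩
      g ⁻¹' (Ioo (-a) a ×ˢ ball y₀ r) := by
    refine ⟨?_, ?_⟩
    · simpa using hr
    · rw [mem_preimage, hg0]
      exact ⟨hI0, hyB⟩
  obtain ⟨ρ, hρ, hsub⟩ := Metric.isOpen_iff.1 hO _ h0O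
  refine ⟨ρ, hρ, fun k => Fl (g k).1 (g k).2, ?_, ?_, ?_, ?_⟩
  · exact hsm.comp (hgT.mono fun k hk => (hsub hk).1) fun k hk => (hsub hk).2
  · simp only [hg0]
    exact h0 _ hyB
  · intro z hz
    obtain ⟨hz1, hz2⟩ := (hsub hz).2
    rw [flow_height hU hud huX h0 hin hd hz2 hz1]
    simp [g]
  · intro k
    have hF := ((hsm.contDiffAt ((isOpen_Ioo.prod isOpen_ball).mem_nhds
      (⟨hI0, hyB⟩ : ((0 : ℝ), y₀) ∈ Ioo (-a) a ×ˢ ball y₀ r))).differentiableAt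
      (by simp)).hasFDerivAt
    have hFv : ∀ v, fderiv ℝ (fun q : ℝ × E => Fl q.1 q.2) (0, y₀) (0, v) = v := by
      have hl : HasFDerivAt (fun z : E => ((0 : ℝ), z)) (ContinuousLinearMap.inr ℝ ℝ E) y₀ :=
        hasFDerivAt_prodMk_right 0 y₀
      have h1 := HasFDerivAt.comp (g := fun q : ℝ × E => Fl q.1 q.2) y₀ hF hl
      have h2 : (fun q : ℝ × E => Fl q.1 q.2) ∘ (fun z : E => ((0 : ℝ), z)) =ᶠ[𝓝 y₀] id := by
        filter_upwards [isOpen_ball.mem_nhds hyB] with z hz using h0 z hz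
      intro v
      have h3 := h1.unique ((hasFDerivAt_id y₀).congr_of_eventuallyEq h2)
      exact congrArg (fun A : E →L[ℝ] E => A v) h3
    have hgd : HasFDerivAt g ((0 : K →L[ℝ] ℝ).prod K.subtypeL) 0 := by
      have h1 : HasFDerivAt (fun k : K => y₀ + (k : E)) K.subtypeL 0 :=
        K.subtypeL.hasFDerivAt.const_add y₀
      have hu0 : HasFDerivAt u (fderiv ℝ u y₀) (y₀ + ((0 : K) : E)) := by
        rw [ZeroMemClass.coe_zero, add_zero]
        exact (hud.differentiableAt (hU.mem_nhds hy₀)).hasFDerivAt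
      have h2 := (hu0.comp (0 : K) h1).const_sub (u y₀)
      have h3 : -((fderiv ℝ u y₀).comp K.subtypeL) = 0 := by
        ext k
        simp
      rw [h3] at h2
      exact h2.prodMk h1
    rw [← hg0] at hF
    have h4 := (HasFDerivAt.comp (g := fun q : ℝ × E => Fl q.1 q.2) (0 : K) hF hgd).fderiv
    have h5 : fderiv ℝ (fun k : K => Fl (g k).1 (g k).2) 0 = _ := h4
    rw [h5, hg0]
    exact hFv k

/-- A vector with `ℓ(x) = 1` spans a complement of the kernel of `ℓ`. -/
theorem exists_equiv_prod_ker [FiniteDimensional ℝ E] (ℓ : E →L[ℝ] ℝ) {x : E} (hx : ℓ x = 1) :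
    ∃ e : (ℝ × ℓ.ker) ≃L[ℝ] E, ∀ q, e q = q.1 • x + q.2 := by
  let T : ℝ × ℓ.ker →ₗ[ℝ] E :=
    (LinearMap.fst ℝ ℝ ℓ.ker).smulRight x + ℓ.ker.subtype ∘ₗ LinearMap.snd ℝ ℝ ℓ.ker
  have hT : ∀ q, T q = q.1 • x + q.2 := fun q => rfl
  have hk : ∀ k : ℓ.ker, ℓ k = 0 := fun k => k.2
  have hb : Function.Bijective T := by
    refine ⟨(injective_iff_map_eq_zero T).2 fun q hq => ?_, fun v => ?_⟩
    · rw [hT] at hq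
      have h1 := congrArg ℓ hq
      rw [map_add, map_smul, hx, hk, map_zero, add_zero, smul_eq_mul, mul_one] at h1
      rw [h1, zero_smul, zero_add] at hq
      exact Prod.ext h1 (Subtype.ext hq)
    · refine ⟨(ℓ v, ⟨v - ℓ v • x, ?_⟩), ?_⟩
      · change ℓ (v - ℓ v • x) = 0
        rw [map_sub, map_smul, hx, smul_eq_mul, mul_one, sub_self]
      · rw [hT]
        simp
  exact ⟨(LinearEquiv.ofBijective T hb).toContinuousLinearEquiv, hT⟩

end LevelSlice

/-! ### The twisting piece, and the totally geodesic case. -/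

section TwistingPiece

set_option linter.unusedSectionVars false
set_option synthInstance.maxHeartbeats 200000

open Metric Filter Topology

variable {n : ℕ} {M : Type*} [TopologicalSpace M] [ChartedSpace (EuclideanSpace ℝ (Fin n)) M]
  [IsManifold (𝓡 n) ∞ M] [RiemannianBundle (fun p : M => TangentSpace (𝓡 n) p)]
  [IsContMDiffRiemannianBundle (𝓡 n) ∞ (EuclideanSpace ℝ (Fin n))
    (fun p : M => TangentSpace (𝓡 n) p)]
  {S : Type*} [TopologicalSpace S] [ChartedSpace (EuclideanSpace ℝ (Fin n)) S]
  [IsManifold (𝓡 n) ∞ S]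
  {f : S → M × ℝ} {N : ∀ x : S, TangentSpace ((𝓡 n).prod 𝓘(ℝ, ℝ)) (f x)}
  {U : Set (EuclideanSpace ℝ (Fin n))} {σ : EuclideanSpace ℝ (Fin n) → S} {p₀ : M}

/-- The flow box Ω over a slice c of the level set of u does everything at once: S' is the part of
the hypersurface over Ω, Γ_t is the flow of the Killing field, and L is the slice. The parameter
space K is left free because it is the kernel of du in general, but ℝ for a surface, where the slice
has to be a geodesic. -/
theorem IsLocalSection.exists_isTwistingPiece {K : Type*} [NormedAddCommGroup K] [NormedSpace ℝ K]
    [CompleteSpace K] (hf : IsVerticalHelicoid f N) (hθ : ∀ x, angle f N x ≠ 0)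
    (hsec : ∀ x v, dheight f x v = 0 → sectionShape N x v v = 0)
    (hσ : IsLocalSection f p₀ U σ) (hopen : ∀ V ⊆ U, IsOpen V → IsOpen (σ '' V))
    {y₀ : EuclideanSpace ℝ (Fin n)} (hy₀ : y₀ ∈ U) {c : K → EuclideanSpace ℝ (Fin n)} {ρ : ℝ}
    (hρ : 0 < ρ) (hc : ContDiffOn ℝ ∞ c (ball 0 ρ)) (hc0 : c 0 = y₀)
    (hcu : ∀ z ∈ ball 0 ρ, height f (σ (c z)) = height f (σ y₀))
    (e : (ℝ × K) ≃L[ℝ] EuclideanSpace ℝ (Fin n))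
    (he : ∀ q : ℝ × K, e q = q.1 • killing (fun z => angle f N (σ z)) (sectionY N p₀ σ) y₀
      + fderiv ℝ c 0 q.2) :
    ∃ (S' : Set S) (ε : ℝ) (Γ : ℝ → M → M) (δ : ℝ), 0 < δ ∧ δ ≤ ρ ∧ σ y₀ ∈ S' ∧
      IsTwistingPiece (n := n) f S' (height f (σ y₀))
        ((fun z => (extChartAt (𝓡 n) p₀).symm (c z)) '' ball 0 δ) ε Γ := by
  have hh := hf.hypersurface
  set X := killing (fun z => angle f N (σ z)) (sectionY N p₀ σ) with hXdef
  set u : EuclideanSpace ℝ (Fin n) → ℝ := fun z => height f (σ z) with hudef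
  set ψ := extChartAt (𝓡 n) p₀ with hψ
  have hu : ContDiffOn ℝ ∞ u U := hσ.contDiffOn_height hh
  have hud := hu.differentiableOn (by simp)
  have huX : ∀ y ∈ U, fderiv ℝ u y (X y) = 1 := fun y hy => hσ.fderiv_height_killing hf hy
  obtain ⟨a, ha, r, hr, Fl, hB, hsm, h0, hin, hd, hadd, hinj⟩ :=
    exists_local_flow hσ.isOpen (hσ.contDiffOn_killing hf) hy₀
  have hI0 : (0 : ℝ) ∈ Ioo (-a) a := ⟨neg_lt_zero.2 ha, ha⟩
  have hyB : y₀ ∈ ball y₀ r := mem_ball_self hr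
  have hd0 : HasDerivAt (fun t => Fl t y₀) (X y₀) 0 := by
    have := hd y₀ hyB 0 hI0
    rwa [h0 y₀ hyB] at this
  obtain ⟨ε, hε, δ, hδ, hεa, hδρ, hcB, hΩo, hΩB, hΩc⟩ :=
    exists_flow_box (X := X) ha hr hρ hsm h0 hd0 hc hc0 e he
  set Ω := (fun q : ℝ × K => Fl q.1 (c q.2)) '' (Ioo (-ε) ε ×ˢ ball 0 δ) with hΩ
  have hIε : ∀ t ∈ Ioo (-ε) ε, t ∈ Ioo (-a) a := fun t ht =>
    Ioo_subset_Ioo (neg_le_neg hεa) hεa ht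
  have h0ε : (0 : ℝ) ∈ Ioo (-ε) ε := ⟨neg_lt_zero.2 hε, hε⟩
  have hΩU : Ω ⊆ U := hΩB.trans hB
  have hcΩ : ∀ z ∈ ball (0 : K) δ, c z ∈ Ω := fun z hz =>
    ⟨(0, z), ⟨h0ε, hz⟩, h0 _ (hcB z hz)⟩
  have hut : ∀ z ∈ ball (0 : K) δ, ∀ s ∈ Ioo (-ε) ε, u (Fl s (c z)) = u y₀ + s := by
    intro z hz s hs
    rw [flow_height hσ.isOpen hud huX h0 hin hd (hcB z hz) (hIε s hs)]
    exact congrArg (· + s) (hcu z (ball_subset_ball hδρ hz))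
  have hPi : proj f '' (σ '' Ω) = ψ.symm '' Ω := by
    rw [image_image]
    exact image_congr fun y hy => hσ.proj_eq y (hΩU hy)
  have hP : ∀ p, p ∈ proj f '' (σ '' Ω) ↔ p ∈ ψ.source ∧ ψ p ∈ Ω := by
    intro p
    rw [hPi]
    constructor
    · rintro ⟨y, hy, rfl⟩
      have := hσ.subset (hΩU hy)
      refine ⟨ψ.map_target this, ?_⟩
      rwa [ψ.right_inv this]
    · rintro ⟨h1, h2⟩
      exact ⟨ψ p, h2, ψ.left_inv h1⟩
  have hPo : IsOpen (proj f '' (σ '' Ω)) := by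
    have : proj f '' (σ '' Ω) = ψ.source ∩ ψ ⁻¹' Ω := Set.ext hP
    rw [this]
    exact (continuousOn_extChartAt p₀).isOpen_inter_preimage (isOpen_extChartAt_source p₀) hΩo
  have hfσ : ∀ y ∈ Ω, f (σ y) = (ψ.symm y, u y) := fun y hy =>
    Prod.ext (hσ.proj_eq y (hΩU hy)) rfl
  have hFlT : ∀ t ∈ Ioo (-ε) ε, ∀ y ∈ Ω, Fl t y ∈ ψ.target := fun t ht y hy =>
    hσ.subset (hin y (hΩB hy) t (hIε t ht))
  have hFld : ∀ t ∈ Ioo (-ε) ε, ∀ y ∈ Ω,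
      ContDiffAt ℝ ∞ (fun q : ℝ × EuclideanSpace ℝ (Fin n) => Fl q.1 q.2) (t, y) :=
    fun t ht y hy => hsm.contDiffAt ((isOpen_Ioo.prod isOpen_ball).mem_nhds ⟨hIε t ht, hΩB hy⟩)
  refine ⟨σ '' Ω, ε, fun t => chartConj p₀ (Fl t), δ, hδ, hδρ, ⟨y₀, ?_, rfl⟩,
    ⟨hopen Ω hΩU hΩo, hΩc.image σ (hσ.smooth.continuousOn.mono hΩU), ?_, hε, ?_, ?_,
      ⟨hPo, ?_, ?_, ?_, ?_, ?_⟩, ?_⟩⟩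
  · rw [← hc0]
    exact hcΩ 0 (mem_ball_self hδ)
  -- Over Ω the projection of the section is the inverse chart, which is injective.
  · rintro _ ⟨y, hy, rfl⟩ _ ⟨y', hy', rfl⟩ heq
    rw [hfσ y hy, hfσ y' hy'] at heq
    rw [ψ.symm.injOn (hσ.subset (hΩU hy)) (hσ.subset (hΩU hy')) (Prod.ext_iff.1 heq).1]
  · rintro p ⟨z, hz, rfl⟩
    have hmem : ψ.symm (c z) ∈ proj f '' (σ '' Ω) := by
      rw [hPi]
      exact ⟨c z, hcΩ z hz, rfl⟩
    have hdu : ∀ y ∈ U, DifferentiableAt ℝ (fun y => u y - u y₀) y := fun y hy =>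
      (hud.differentiableAt (hσ.isOpen.mem_nhds hy)).sub_const _
    -- The defining function is u - u(y₀), regular since du(X) = 1. In the box, u(Fl_s(c(z))) =
    -- u(y₀) + s, so its zeros are exactly the points with s = 0, the slice.
    refine ⟨_, fun q => u (ψ q) - u y₀, hPo, hmem, ?_, ?_, ?_⟩
    · intro q hq
      obtain ⟨h1, h2⟩ := (hP q).1 hq
      have h3 : ContDiffAt ℝ ∞ (fun y => u y - u y₀) (ψ q) :=
        (hu.contDiffAt (hσ.isOpen.mem_nhds (hΩU h2))).sub contDiffAt_const
      exact (h3.contMDiffAt.comp q (contMDiffAt_extChartAt_of_mem h1)).contMDiffWithinAt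
    · intro q hq heq
      obtain ⟨h1, h2⟩ := (hP q).1 hq
      have h3 := mfderiv_comp_chart (u := fun y => u y - u y₀) h1 (hdu _ (hΩU h2))
        (dchartSymm p₀ (ψ q) (X (ψ q)))
      have h4 : (mfderiv (𝓡 n) 𝓘(ℝ, ℝ) (fun q => u (ψ q) - u y₀) q :
        EuclideanSpace ℝ (Fin n) →L[ℝ] ℝ) = 0 := heq
      have h5 := dchart_dchartSymm (hσ.subset (hΩU h2)) (X (ψ q))
      rw [← hψ, ψ.left_inv h1] at h5
      rw [h5, fderiv_sub_const, huX _ (hΩU h2)] at h3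
      refine zero_ne_one (α := ℝ) (Eq.trans ?_ h3)
      exact (congrArg (fun A : EuclideanSpace ℝ (Fin n) →L[ℝ] ℝ =>
        A (dchartSymm p₀ (ψ q) (X (ψ q)))) h4).symm
    · ext q
      constructor
      · rintro ⟨⟨z', hz', rfl⟩, hq⟩
        refine ⟨hq, ?_⟩
        simp only [ψ.right_inv (hσ.subset (hΩU (hcΩ z' hz')))]
        exact sub_eq_zero.2 (hcu z' (ball_subset_ball hδρ hz'))
      · rintro ⟨hq, hq0⟩
        refine ⟨?_, hq⟩
        obtain ⟨h1, ⟨s, z'⟩, ⟨hs, hz'⟩, h3⟩ := (hP q).1 hq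
        simp only at h3 hs hz' hq0
        rw [← h3, hut z' hz' s hs, add_sub_cancel_left] at hq0
        rw [hq0, h0 _ (hcB z' hz')] at h3
        exact ⟨z', hz', by simp only [h3, ψ.left_inv h1]⟩
  · rintro _ ⟨z, hz, rfl⟩
    rw [hPi]
    exact ⟨c z, hcΩ z hz, rfl⟩
  · rintro ⟨t, p⟩ ⟨ht, hp⟩
    obtain ⟨h1, h2⟩ := (hP p).1 hp
    have h3 : ContMDiffAt (𝓘(ℝ, ℝ).prod (𝓡 n)) 𝓘(ℝ, ℝ × EuclideanSpace ℝ (Fin n)) ∞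
        (fun q : ℝ × M => (q.1, ψ q.2)) (t, p) :=
      contMDiffAt_fst.prodMk_space
        (ContMDiffAt.comp (t, p) (contMDiffAt_extChartAt_of_mem h1) contMDiffAt_snd)
    have h4 := ContMDiffAt.comp (t, p) (hFld t ht _ h2).contMDiffAt h3
    exact (ContMDiffAt.comp (t, p) (contMDiffAt_extChartAt_symm (hFlT t ht _ h2))
      h4).contMDiffWithinAt
  · intro t ht p hp q hq heq
    obtain ⟨h1, h2⟩ := (hP p).1 hp
    obtain ⟨h3, h4⟩ := (hP q).1 hq
    exact ψ.injOn h1 h3 (hinj t (hIε t ht) (hΩB h2) (hΩB h4)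
      (ψ.symm.injOn (hFlT t ht _ h2) (hFlT t ht _ h4) heq))
  · intro t ht p hp v w
    obtain ⟨h1, h2⟩ := (hP p).1 hp
    have h3 : DifferentiableAt ℝ (Fl t) (ψ p) := by
      have h4 : DifferentiableAt ℝ (fun q : ℝ × EuclideanSpace ℝ (Fin n) => Fl q.1 q.2) (t, ψ p) :=
        (hFld t ht _ h2).differentiableAt (by simp)
      exact DifferentiableAt.comp (g := fun q : ℝ × EuclideanSpace ℝ (Fin n) => Fl q.1 q.2)
        (ψ p) h4 ((differentiableAt_const t).prodMk differentiableAt_id)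
    refine metric_mfderiv_chartConj h1 h3 (hFlT t ht _ h2) (fun b b' => ?_) v w
    exact flow_isometry hσ.isOpen isOpen_ball
      (fun y hy => (hσ.differentiableAt_gram hy).differentiableWithinAt)
      (fun y hy => (hσ.differentiableAt_killing hf hy).differentiableWithinAt)
      (fun y hy => hσ.lieForm_killing_eq_zero hf hθ hsec hy) hsm h0 hin hd (hIε t ht) (hΩB h2) b b'
  · intro p hp
    obtain ⟨h1, h2⟩ := (hP p).1 hp
    simp only [chartConj]
    rw [h0 _ (hΩB h2), ψ.left_inv h1]
  · intro s hs t ht hst p hp htp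
    obtain ⟨h1, h2⟩ := (hP p).1 hp
    obtain ⟨h3, h4⟩ := (hP _).1 htp
    simp only [chartConj] at h4 ⊢
    rw [ψ.right_inv (hFlT t ht _ h2)] at h4 ⊢
    rw [hadd _ (hΩB h2) s (hIε s hs) t (hIε t ht) (hIε _ hst) (hΩB h4)]
  -- A point Fl_s(c(z)) of Ω lifts to the hypersurface at height u(y₀) + s, and it is Γ_s of the
  -- point of L with parameter z.
  · have hΓ : ∀ z ∈ ball (0 : K) δ, ∀ s, chartConj p₀ (Fl s) (ψ.symm (c z))
        = ψ.symm (Fl s (c z)) := by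
      intro z hz s
      simp only [chartConj]
      rw [ψ.right_inv (hσ.subset (hΩU (hcΩ z hz)))]
    ext q
    constructor
    · rintro ⟨_, ⟨y, ⟨⟨s, z⟩, ⟨hs, hz⟩, rfl⟩, rfl⟩, rfl⟩
      refine ⟨_, ⟨z, hz, rfl⟩, s, hs, ?_⟩
      rw [hfσ _ ⟨(s, z), ⟨hs, hz⟩, rfl⟩]
      simp only
      rw [hΓ z hz s, hut z hz s hs, one_mul]
    · rintro ⟨_, ⟨z, hz, rfl⟩, s, hs, rfl⟩
      refine ⟨_, ⟨_, ⟨(s, z), ⟨hs, hz⟩, rfl⟩, rfl⟩, ?_⟩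
      rw [hfσ _ ⟨(s, z), ⟨hs, hz⟩, rfl⟩]
      simp only
      rw [hΓ z hz s, hut z hz s hs, one_mul]

theorem exists_twistingPiece_of_totallyGeodesic (hf : IsVerticalHelicoid f N)
    (hθ : ∀ x, angle f N x ≠ 0) (hsec : TotallyGeodesicSections f N) (x₀ : S) :
    ∃ (S' : Set S) (L : Set M) (ε : ℝ) (Γ : ℝ → M → M), x₀ ∈ S' ∧
      IsTwistingPiece (n := n) f S' (height f x₀) L ε Γ := by
  obtain ⟨U, σ, hσ, hyU, hx, hopen⟩ := hf.hypersurface.exists_isLocalSection (hθ x₀)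
  have huX := fun y hy => hσ.fderiv_height_killing hf (y := y) hy
  obtain ⟨ρ, hρ, c, hc, hc0, hcu, hcd⟩ := exists_level_slice hσ.isOpen
    (hσ.contDiffOn_killing hf) (hσ.contDiffOn_height hf.hypersurface) huX hyU
  obtain ⟨e, he⟩ := exists_equiv_prod_ker _ (huX _ hyU)
  obtain ⟨S', ε, Γ, δ, -, -, hmem, hpiece⟩ := hσ.exists_isTwistingPiece hf hθ
    (fun x v hv => hsec x v v hv hv) hopen hyU hρ hc hc0 hcu e
    (fun q => by rw [he, hcd])
  rw [hx] at hmem hpiece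
  exact ⟨S', _, ε, Γ, hmem, hpiece⟩

end TwistingPiece

/-! ### The geodesic equation in dimension two. -/

section PlaneCurves

set_option synthInstance.maxHeartbeats 200000

open Metric Filter Topology

variable {E : Type*} [NormedAddCommGroup E] [NormedSpace ℝ E]

/-- A basis of a two-dimensional space, from a linear form that separates the two vectors. -/
theorem exists_equiv_prod_real [FiniteDimensional ℝ E] (hE : Module.finrank ℝ E = 2)
    (ℓ : E →L[ℝ] ℝ) {x w : E} (hx : ℓ x ≠ 0) (hw : ℓ w = 0) (hw0 : w ≠ 0) :
    ∃ e : (ℝ × ℝ) ≃L[ℝ] E, ∀ q, e q = q.1 • x + q.2 • w := by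
  let T : ℝ × ℝ →ₗ[ℝ] E :=
    (LinearMap.fst ℝ ℝ ℝ).smulRight x + (LinearMap.snd ℝ ℝ ℝ).smulRight w
  have hT : ∀ q, T q = q.1 • x + q.2 • w := fun q => rfl
  have hi : Function.Injective T := by
    refine (injective_iff_map_eq_zero T).2 fun q hq => ?_
    rw [hT] at hq
    have h1 := congrArg ℓ hq
    rw [map_add, map_smul, map_smul, hw, map_zero, smul_zero, add_zero, smul_eq_mul] at h1
    have h2 := (mul_eq_zero.1 h1).resolve_right hx
    rw [h2, zero_smul, zero_add] at hq
    exact Prod.ext h2 ((smul_eq_zero.1 hq).resolve_right hw0)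
  have hfr : Module.finrank ℝ (ℝ × ℝ) = Module.finrank ℝ E := by
    rw [hE, Module.finrank_prod, Module.finrank_self]
  exact ⟨(LinearEquiv.ofInjectiveOfFinrankEq T hi hfr).toContinuousLinearEquiv, hT⟩

/-- A unit speed curve in a surface that is orthogonal to a field `Y` whose derivative along the
curve has no component along the curve satisfies the geodesic equation. -/
theorem geodesic_equation [FiniteDimensional ℝ E] (hE : Module.finrank ℝ E = 2)
    {G : E → E →L[ℝ] E →L[ℝ] ℝ} {Y : E → E} {c v : ℝ → E} {v' : E} {t : ℝ}
    (hG : DifferentiableAt ℝ G (c t)) (hsymm : ∀ z a b, G z a b = G z b a)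
    (hY : DifferentiableAt ℝ Y (c t)) (hc : HasDerivAt c (v t) t) (hv : HasDerivAt v v' t)
    (hunit : ∀ᶠ s in 𝓝 t, G (c s) (v s) (v s) = 1)
    (horth : ∀ᶠ s in 𝓝 t, G (c s) (Y (c s)) (v s) = 0)
    (hY0 : G (c t) (Y (c t)) (Y (c t)) ≠ 0)
    (hshape : G (c t) (fderiv ℝ Y (c t) (v t)) (v t) + chris G (c t) (v t) (Y (c t)) (v t) = 0)
    (z : E) : G (c t) v' z + chris G (c t) (v t) (v t) z = 0 := by
  have hs := fderiv_bilin_symm hG (Eventually.of_forall hsymm)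
  have h1 := (hasDerivAt_bilin hG hc hv hv).unique
    ((hasDerivAt_const t (1 : ℝ)).congr_of_eventuallyEq hunit)
  have hYc : HasDerivAt (fun s => Y (c s)) (fderiv ℝ Y (c t) (v t)) t :=
    HasFDerivAt.comp_hasDerivAt (l := Y) t hY.hasFDerivAt hc
  have h2 := (hasDerivAt_bilin hG hc hYc hv).unique
    ((hasDerivAt_const t (0 : ℝ)).congr_of_eventuallyEq horth)
  have hv0 : v t ≠ 0 := by
    intro h
    have := hunit.self_of_nhds
    rw [h, map_zero] at this
    exact zero_ne_one this
  -- Y and the velocity span the plane, so ∇_v v is tested against these two only. Against v, the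
  -- derivative of |v|² = 1 gives zero. Against Y, the derivative of ⟨Y, v⟩ = 0 gives ⟨∇_v v, Y⟩ =
  -- -⟨∇_v Y, v⟩, which vanishes by `hshape`.
  obtain ⟨e, he⟩ := exists_equiv_prod_real hE (G (c t) (Y (c t))) hY0 horth.self_of_nhds hv0
  obtain ⟨q, rfl⟩ := e.surjective z
  rw [he]
  unfold chris at hshape ⊢
  rw [hsymm _ (v t) v'] at h1
  rw [hsymm _ (Y (c t)) v', hs _ (Y (c t)) (v t)] at h2
  rw [hs _ (Y (c t)) (v t)] at hshape
  simp only [map_add, map_smul, add_apply, smul_apply, smul_eq_mul]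
  linear_combination q.2 / 2 * h1 + q.1 * h2 - q.1 * hshape

end PlaneCurves

/-! ### Horizontal sections of a surface as geodesics of M. -/

section Curves

set_option linter.unusedSectionVars false
set_option synthInstance.maxHeartbeats 200000

open Metric Filter Topology

variable {n : ℕ} {M : Type*} [TopologicalSpace M] [ChartedSpace (EuclideanSpace ℝ (Fin n)) M]
  [IsManifold (𝓡 n) ∞ M] [RiemannianBundle (fun p : M => TangentSpace (𝓡 n) p)]
  [IsContMDiffRiemannianBundle (𝓡 n) ∞ (EuclideanSpace ℝ (Fin n))
    (fun p : M => TangentSpace (𝓡 n) p)]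
  {S : Type*} [TopologicalSpace S] [ChartedSpace (EuclideanSpace ℝ (Fin n)) S]
  [IsManifold (𝓡 n) ∞ S]
  {f : S → M × ℝ} {N : ∀ x : S, TangentSpace ((𝓡 n).prod 𝓘(ℝ, ℝ)) (f x)}

/-- The velocity of a curve, as a vector of the model space. -/
def modelVelocity (γ : ℝ → M) (t : ℝ) : EuclideanSpace ℝ (Fin n) := velocity (n := n) γ t

theorem hasDerivAt_chart_curve {γ : ℝ → M} {t : ℝ} {q : M}
    (hγ : MDifferentiableAt 𝓘(ℝ, ℝ) (𝓡 n) γ t)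
    (hq : γ t ∈ (extChartAt (𝓡 n) q).source) :
    HasDerivAt (fun s => extChartAt (𝓡 n) q (γ s)) (dchart q (γ t) (modelVelocity (n := n) γ t)) t
      := by
  have h1 := ((contMDiffAt_extChartAt_of_mem hq).mdifferentiableAt (n := ∞)
    (by simp)).hasMFDerivAt.comp t hγ.hasMFDerivAt
  have h2 : HasFDerivAt (fun s => extChartAt (𝓡 n) q (γ s)) ((dchart q (γ t)).comp
      (mfderiv 𝓘(ℝ, ℝ) (𝓡 n) γ t : ℝ →L[ℝ] EuclideanSpace ℝ (Fin n))) t :=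
    hasMFDerivAt_iff_hasFDerivAt.1 h1
  exact h2.hasDerivAt

theorem covAlong_velocity_eq {γ : ℝ → M} {t : ℝ}
    (hγ : ContinuousAt γ t) (z : EuclideanSpace ℝ (Fin n)) :
    covAlong (𝓡 n) 𝓘(ℝ, ℝ) metric γ (velocity (n := n) γ) t (1 : ℝ) z
      = gram (γ t) (extChartAt (𝓡 n) (γ t) (γ t))
          (deriv (fun s => dchart (γ t) (γ s) (modelVelocity (n := n) γ s)) t) z
        + chris (gram (γ t)) (extChartAt (𝓡 n) (γ t) (γ t))
          (dchart (γ t) (γ t) (modelVelocity (n := n) γ t))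
            (dchart (γ t) (γ t) (modelVelocity (n := n) γ t)) z := by
  have h1 : (fun s => comp (γ t) (γ s) (modelVelocity (n := n) γ s)) =ᶠ[𝓝 t]
      fun s => dchart (γ t) (γ s) (modelVelocity (n := n) γ s) := by
    filter_upwards [hγ.preimage_mem_nhds
      ((isOpen_extChartAt_source (I := 𝓡 n) (γ t)).mem_nhds (mem_extChartAt_source _))] with s hs
    exact comp_eq_dchart hs _
  rw [gram_self, ← christoffel_eq_chris, dchart_self, ← h1.deriv_eq, ← fderiv_apply_one_eq_deriv,
    ← mfderiv_eq_fderiv]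
  rfl

namespace IsLocalSection

variable {U : Set (EuclideanSpace ℝ (Fin n))} {σ : EuclideanSpace ℝ (Fin n) → S} {p₀ : M}

/-- On a surface, a unit speed curve in a horizontal section is a geodesic if the section is
totally geodesic. -/
theorem isGeodesic (hn : n = 2) (hf : IsVerticalHelicoid f N)
    (hsec : ∀ x v, dheight f x v = 0 → sectionShape N x v v = 0)
    (hσ : IsLocalSection f p₀ U σ) {c : ℝ → EuclideanSpace ℝ (Fin n)} {a h₀ : ℝ}
    (hc : ContDiffOn ℝ ∞ c (Ioo (-a) a)) (hcU : ∀ t ∈ Ioo (-a) a, c t ∈ U)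
    (hunit : ∀ t ∈ Ioo (-a) a, gram p₀ (c t) (deriv c t) (deriv c t) = 1)
    (hcu : ∀ t ∈ Ioo (-a) a, height f (σ (c t)) = h₀) :
    IsGeodesic (n := n) (fun t => proj f (σ (c t))) a := by
  have hh := hf.hypersurface
  set γ : ℝ → M := fun t => proj f (σ (c t)) with hγdef
  have hI : ∀ t ∈ Ioo (-a) a, Ioo (-a) a ∈ 𝓝 t := fun t ht => isOpen_Ioo.mem_nhds ht
  have hγ : ∀ t ∈ Ioo (-a) a, ContMDiffAt 𝓘(ℝ, ℝ) (𝓡 n) ∞ γ t := fun t ht =>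
    (hh.contMDiff_proj _).comp t ((hσ.contMDiffAt (hcU t ht)).comp t
      (hc.contDiffAt (hI t ht)).contMDiffAt)
  have hγd : ∀ t ∈ Ioo (-a) a, MDifferentiableAt 𝓘(ℝ, ℝ) (𝓡 n) γ t := fun t ht =>
    (hγ t ht).mdifferentiableAt (by simp)
  have hmet : ∀ t ∈ Ioo (-a) a,
      metricForm (γ t) (modelVelocity (n := n) γ t) (modelVelocity (n := n) γ t) = 1 := by
    intro t ht
    have hp := hσ.proj_mem (hcU t ht)
    have h1 := hasDerivAt_chart_curve (hγd t ht) hp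
    have h2 : c =ᶠ[𝓝 t] fun s => extChartAt (𝓡 n) p₀ (γ s) := by
      filter_upwards [hI t ht] with s hs using (hσ.chart_proj (hcU s hs)).symm
    have h3 := gram_dchart hp (modelVelocity (n := n) γ t) (modelVelocity (n := n) γ t)
    have h4 := hunit t ht
    rw [h2.deriv_eq, h1.deriv] at h4
    rw [hσ.chart_proj (hcU t ht)] at h3
    exact h3.symm.trans h4
  refine ⟨fun t ht => (hγ t ht).contMDiffWithinAt, fun t ht h0 => ?_, fun t ht z => ?_⟩
  · have h1 : modelVelocity (n := n) γ t = 0 := h0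
    have h2 := hmet t ht
    rw [h1, map_zero] at h2
    exact zero_ne_one h2
  have hqs : γ t ∈ (extChartAt (𝓡 n) (γ t)).source := mem_extChartAt_source _
  -- The covariant derivative at time t uses the chart centred at γ(t). Section and curve are
  -- therefore read in that chart: `b` is the curve there and `v` its velocity.
  have hσ' := hσ.transition_section (q := γ t)
  set σ' := fun z => σ (transition (γ t) p₀ z) with hσdef
  set U' := ((extChartAt (𝓡 n) (γ t)).target ∩ (extChartAt (𝓡 n) (γ t)).symm ⁻¹'
    (extChartAt (𝓡 n) p₀).source) ∩ transition (γ t) p₀ ⁻¹' U with hU'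
  set b : ℝ → EuclideanSpace ℝ (Fin n) := fun s => extChartAt (𝓡 n) (γ t) (γ s) with hb
  set v : ℝ → EuclideanSpace ℝ (Fin n) :=
    fun s => dchart (γ t) (γ s) (modelVelocity (n := n) γ s) with hv
  have hnear : ∀ᶠ s in 𝓝 t, s ∈ Ioo (-a) a ∧ γ s ∈ (extChartAt (𝓡 n) (γ t)).source := by
    filter_upwards [hI t ht, (hγ t ht).continuousAt.preimage_mem_nhds
      ((isOpen_extChartAt_source (I := 𝓡 n) (γ t)).mem_nhds hqs)] with s h1 h2 using ⟨h1, h2⟩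
  have hback : ∀ s, s ∈ Ioo (-a) a ∧ γ s ∈ (extChartAt (𝓡 n) (γ t)).source →
      transition (γ t) p₀ (b s) = c s := by
    rintro s ⟨h1, h2⟩
    simp only [hb, transition]
    rw [(extChartAt (𝓡 n) (γ t)).left_inv h2]
    exact hσ.chart_proj (hcU s h1)
  have hbU : ∀ s, s ∈ Ioo (-a) a ∧ γ s ∈ (extChartAt (𝓡 n) (γ t)).source → b s ∈ U' := by
    rintro s ⟨h1, h2⟩
    refine ⟨⟨(extChartAt (𝓡 n) (γ t)).map_source h2, ?_⟩, ?_⟩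
    · rw [mem_preimage]
      simp only [hb]
      rw [(extChartAt (𝓡 n) (γ t)).left_inv h2]
      exact hσ.proj_mem (hcU s h1)
    · rw [mem_preimage, hback s ⟨h1, h2⟩]
      exact hcU s h1
  have hbd : ∀ s, s ∈ Ioo (-a) a ∧ γ s ∈ (extChartAt (𝓡 n) (γ t)).source →
      HasDerivAt b (v s) s := fun s hs => hasDerivAt_chart_curve (hγd s hs.1) hs.2
  have htt := hnear.self_of_nhds
  have hbt : b t ∈ U' := hbU t htt
  have hvd : HasDerivAt v (deriv v t) t := by
    have h1 : ContDiffAt ℝ ∞ b t := contMDiffAt_iff_contDiffAt.1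
      ((contMDiffAt_extChartAt_of_mem hqs).comp t (hγ t ht))
    have h2 : DifferentiableAt ℝ (fderiv ℝ b) t :=
      (h1.fderiv_right (m := 1) (WithTop.coe_le_coe.2 le_top)).differentiableAt (by simp)
    have h3 : v =ᶠ[𝓝 t] fun s => fderiv ℝ b s 1 := by
      filter_upwards [hnear] with s hs
      rw [fderiv_apply_one_eq_deriv, (hbd s hs).deriv]
    exact ((h2.clm_apply (differentiableAt_const 1)).congr_of_eventuallyEq h3).hasDerivAt
  have hbunit : ∀ᶠ s in 𝓝 t, gram (γ t) (b s) (v s) (v s) = 1 := by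
    filter_upwards [hnear] with s hs
    exact (gram_dchart hs.2 _ _).trans (hmet s hs.1)
  have hdu : ∀ᶠ s in 𝓝 t, fderiv ℝ (fun z => height f (σ' z)) (b s) (v s) = 0 := by
    filter_upwards [hnear, eventually_eventually_nhds.2 hnear] with s hs hss
    have h1 := ((hσ'.contDiffOn_height hh).contDiffAt
      (hσ'.isOpen.mem_nhds (hbU s hs))).differentiableAt (by simp)
    have h2 : HasDerivAt (fun r => height f (σ' (b r)))
        (fderiv ℝ (fun z => height f (σ' z)) (b s) (v s)) s :=
      HasFDerivAt.comp_hasDerivAt (l := fun z => height f (σ' z)) s h1.hasFDerivAt (hbd s hs)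
    refine h2.unique ((hasDerivAt_const s h₀).congr_of_eventuallyEq ?_)
    filter_upwards [hss] with r hr
    simp only [hσdef]
    rw [hback r hr, hcu r hr.1]
  -- The height is constant along the curve, so du(v) = 0, and Y is proportional to ∇u.
  have horth : ∀ᶠ s in 𝓝 t, gram (γ t) (b s) (sectionY N (γ t) σ' (b s)) (v s) = 0 := by
    filter_upwards [hnear, hdu] with s hs hs0
    have h1 := hσ'.gram_Y hh (hbU s hs) (v s)
    rwa [hs0, mul_zero, add_zero] at h1
  have hx : σ' (b t) = σ (c t) := congrArg σ (hback t htt)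
  have hpos := hh.one_sub_angle_sq_pos (hf.no_horizontal_point (σ (c t)))
  refine (covAlong_velocity_eq (hγ t ht).continuousAt z).trans
    (geodesic_equation (c := b) (v := v) (Y := sectionY N (γ t) σ')
    (by rw [finrank_euclideanSpace_fin, hn]) (hσ'.differentiableAt_gram hbt) (gram_symm (γ t))
    (((hσ'.contDiffOn_Y hh).contDiffAt (hσ'.isOpen.mem_nhds hbt)).differentiableAt (by simp))
    (hbd t htt) hvd hbunit horth ?_ ?_ z)
  · rw [hσ'.gram_Y_Y hh hbt, hx]
    exact hpos.ne'
  · have h1 := sectionShape_dsection hh (hf.no_horizontal_point (σ (c t))) hσ' rfl hbt hx (v t)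
      (v t) horth.self_of_nhds
    have h2 : dheight f (σ (c t)) (dsection σ' (b t) (v t)) = 0 := by
      have h3 := hσ'.dheight_dsection hh hbt (v t)
      rw [hdu.self_of_nhds, hx] at h3
      exact h3
    rw [hsec _ _ h2] at h1
    exact (mul_eq_zero.1 h1.symm).resolve_left (inv_ne_zero (Real.sqrt_pos.2 hpos).ne')

end IsLocalSection

end Curves

/-! ### The case n = 2. -/

section Surfaces

set_option linter.unusedSectionVars false
set_option synthInstance.maxHeartbeats 200000

open Metric Filter Topology

/-- The rotated gradient of a linear form on the plane, which spans its kernel. -/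
def planeRot : (EuclideanSpace ℝ (Fin 2) →L[ℝ] ℝ) →ₗ[ℝ] EuclideanSpace ℝ (Fin 2) where
  toFun ℓ := !₂[-ℓ (EuclideanSpace.single 1 1), ℓ (EuclideanSpace.single 0 1)]
  map_add' ℓ ℓ' := by
    ext i
    fin_cases i <;> simp [add_comm]
  map_smul' r ℓ := by
    ext i
    fin_cases i <;> simp

theorem apply_eq_plane (ℓ : EuclideanSpace ℝ (Fin 2) →L[ℝ] ℝ) (v : EuclideanSpace ℝ (Fin 2)) :
    ℓ v = v 0 * ℓ (EuclideanSpace.single 0 1) + v 1 * ℓ (EuclideanSpace.single 1 1) := by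
  have h : v = v 0 • EuclideanSpace.single 0 (1 : ℝ) + v 1 • EuclideanSpace.single 1 (1 : ℝ) := by
    ext i
    fin_cases i <;> simp
  conv_lhs => rw [h]
  simp

theorem apply_planeRot (ℓ : EuclideanSpace ℝ (Fin 2) →L[ℝ] ℝ) : ℓ (planeRot ℓ) = 0 := by
  rw [apply_eq_plane]
  simp [planeRot]
  ring

theorem planeRot_ne_zero {ℓ : EuclideanSpace ℝ (Fin 2) →L[ℝ] ℝ} (hℓ : ℓ ≠ 0) :
    planeRot ℓ ≠ 0 := by
  intro h
  refine hℓ (ContinuousLinearMap.ext fun v => ?_)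
  have h0 := congrArg (fun w : EuclideanSpace ℝ (Fin 2) => w 0) h
  have h1 := congrArg (fun w : EuclideanSpace ℝ (Fin 2) => w 1) h
  simp [planeRot] at h0 h1
  rw [apply_eq_plane, h0, h1]
  simp

variable {M : Type*} [TopologicalSpace M] [ChartedSpace (EuclideanSpace ℝ (Fin 2)) M]
  [IsManifold (𝓡 2) ∞ M] [RiemannianBundle (fun p : M => TangentSpace (𝓡 2) p)]
  [IsContMDiffRiemannianBundle (𝓡 2) ∞ (EuclideanSpace ℝ (Fin 2))
    (fun p : M => TangentSpace (𝓡 2) p)]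
  {S : Type*} [TopologicalSpace S] [ChartedSpace (EuclideanSpace ℝ (Fin 2)) S]
  [IsManifold (𝓡 2) ∞ S]
  {f : S → M × ℝ} {N : ∀ x : S, TangentSpace ((𝓡 2).prod 𝓘(ℝ, ℝ)) (f x)}

/-- Over a surface, minimal sections are totally geodesic. -/
theorem sectionShape_eq_zero_of_minimal (hf : IsOrientedHypersurface f N)
    (hθ : ∀ x, angle f N x ≠ 0) (hmin : MinimalSections f N) (x : S)
    (v : EuclideanSpace ℝ (Fin 2)) (hv : dheight f x v = 0) : sectionShape N x v v = 0 := by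
  by_cases hv0 : v = 0
  · rw [hv0]
    have h := sectionShape_smul (N := N) x 0 0
    rw [smul_zero, zero_pow two_ne_zero, zero_mul] at h
    exact h
  have hd0 : dproj f x v ≠ 0 := fun h => hv0 (hf.dproj_injective (hθ x) (h.trans (map_zero _).symm))
  have hpos := metricForm_pos (proj f x) hd0
  set κ := metricForm (proj f x) (dproj f x v) (dproj f x v) with hκ
  -- Normalized to unit length, v is an orthonormal basis of the one-dimensional tangent space of
  -- the section, so the trace has the single summand A(e, e).
  set e : EuclideanSpace ℝ (Fin 2) := (√κ)⁻¹ • v with he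
  have hde : dheight f x e = 0 := by
    have h1 : dheight f x e = (√κ)⁻¹ • dheight f x v :=
      map_smul (mfderiv (𝓡 2) 𝓘(ℝ, ℝ) (height f) x) _ _
    rw [h1, hv, smul_zero]
  have hee : ∀ c : EuclideanSpace ℝ (Fin 2) × ℝ, c = (dproj f x e, dheight f x e) →
      prodMetric (f x) c c = 1 := by
    rintro c rfl
    change metricForm (proj f x) (dproj f x e) (dproj f x e) + dheight f x e * dheight f x e = 1
    rw [hde, he, map_smul, map_smul, map_smul, LinearMap.smul_apply, ← hκ, smul_eq_mul, smul_eq_mul,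
      mul_zero, add_zero, ← mul_assoc, ← mul_inv, Real.mul_self_sqrt hpos.le,
      inv_mul_cancel₀ hpos.ne']
  have h := hmin x (fun _ => e) (fun _ => hde) (fun i j => by
    rw [if_pos (Subsingleton.elim (α := Fin 1) i j)]
    exact hee _ (hf.mfderiv_eq x e))
  have h2 : sectionShape N x e e = 0 := by
    rw [Fin.sum_const] at h
    exact (one_smul ℕ (sectionShape N x e e)).symm.trans h
  rw [he, sectionShape_smul] at h2
  have hκ0 : (√κ)⁻¹ ≠ 0 := (inv_pos.2 (Real.sqrt_pos.2 hpos)).ne'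
  exact (mul_eq_zero.1 h2).resolve_left (pow_ne_zero 2 hκ0)

/-- Over a surface, the horizontal section through a point has a local unit speed
parametrization. -/
theorem IsLocalSection.exists_unit_speed_curve {p₀ : M} {U : Set (EuclideanSpace ℝ (Fin 2))}
    {σ : EuclideanSpace ℝ (Fin 2) → S} {y₀ : EuclideanSpace ℝ (Fin 2)}
    (hf : IsVerticalHelicoid f N) (hσ : IsLocalSection f p₀ U σ) (hy₀ : y₀ ∈ U) :
    ∃ a > 0, ∃ c : ℝ → EuclideanSpace ℝ (Fin 2), ContDiffOn ℝ ∞ c (Ioo (-a) a) ∧ c 0 = y₀ ∧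
      (∀ t ∈ Ioo (-a) a, c t ∈ U) ∧
      (∀ t ∈ Ioo (-a) a, gram p₀ (c t) (deriv c t) (deriv c t) = 1) ∧
      (∀ t ∈ Ioo (-a) a, height f (σ (c t)) = height f (σ y₀)) ∧
      fderiv ℝ (fun z => height f (σ z)) y₀ (deriv c 0) = 0 := by
  set u : EuclideanSpace ℝ (Fin 2) → ℝ := fun z => height f (σ z) with hu
  have hus : ContDiffOn ℝ ∞ u U := hσ.contDiffOn_height hf.hypersurface
  set k : EuclideanSpace ℝ (Fin 2) → EuclideanSpace ℝ (Fin 2) :=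
    fun y => planeRot (fderiv ℝ u y) with hk
  have hks : ContDiffOn ℝ ∞ k U :=
    (LinearMap.toContinuousLinearMap planeRot).contDiff.comp_contDiffOn
      (hus.fderiv_of_isOpen hσ.isOpen (by simp))
  have hpos : ∀ y ∈ U, 0 < gram p₀ y (k y) (k y) := by
    intro y hy
    refine gram_pos (hσ.subset hy) (planeRot_ne_zero fun h0 => ?_)
    have h1 := hσ.fderiv_height_killing hf hy
    have h2 : fderiv ℝ (fun z => height f (σ z)) y = 0 := h0
    rw [h2] at h1
    exact zero_ne_one h1
  -- The rotated gradient spans the kernel of du and never vanishes since du(X) = 1. Its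
  -- normalization is a smooth unit field tangent to the level curves, so its orbit through y₀ is
  -- the required curve.
  set T : EuclideanSpace ℝ (Fin 2) → EuclideanSpace ℝ (Fin 2) :=
    fun y => (√(gram p₀ y (k y) (k y)))⁻¹ • k y with hT
  have hTs : ContDiffOn ℝ ∞ T U := by
    have h1 : ContDiffOn ℝ ∞ (fun y => gram p₀ y (k y) (k y)) U :=
      (((contDiffOn_gram p₀).mono hσ.subset).clm_apply hks).clm_apply hks
    exact ((h1.sqrt fun y hy => (hpos y hy).ne').inv
      fun y hy => (Real.sqrt_pos.2 (hpos y hy)).ne').smul hks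
  have hTu : ∀ y, fderiv ℝ u y (T y) = 0 := by
    intro y
    simp only [hT, hk]
    rw [map_smul, apply_planeRot, smul_zero]
  have hT1 : ∀ y ∈ U, gram p₀ y (T y) (T y) = 1 := by
    intro y hy
    simp only [hT, map_smul, smul_apply, smul_eq_mul]
    rw [← mul_assoc, ← mul_inv, Real.mul_self_sqrt (hpos y hy).le,
      inv_mul_cancel₀ (hpos y hy).ne']
  obtain ⟨a, ha, r, hr, Fl, -, hsm, h0, hin, hd, -, -⟩ := exists_local_flow hσ.isOpen hTs hy₀
  have hyB : y₀ ∈ ball y₀ r := mem_ball_self hr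
  have hI0 : (0 : ℝ) ∈ Ioo (-a) a := ⟨neg_lt_zero.2 ha, ha⟩
  have hder : ∀ t ∈ Ioo (-a) a, deriv (fun t => Fl t y₀) t = T (Fl t y₀) := fun t ht =>
    (hd y₀ hyB t ht).deriv
  refine ⟨a, ha, fun t => Fl t y₀, ?_, h0 y₀ hyB, hin y₀ hyB, ?_, ?_, ?_⟩
  · exact hsm.comp (contDiffOn_id.prodMk contDiffOn_const) fun t ht => ⟨ht, hyB⟩
  · intro t ht
    rw [hder t ht]
    exact hT1 _ (hin y₀ hyB t ht)
  · intro t ht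
    have hda : ∀ s ∈ Ioo (-a) a, HasDerivAt (fun s => u (Fl s y₀)) 0 s := by
      intro s hs
      have h1 := ((hus.contDiffAt (hσ.isOpen.mem_nhds
        (hin y₀ hyB s hs))).differentiableAt (by simp)).hasFDerivAt
      have h2 := HasFDerivAt.comp_hasDerivAt (l := u) s h1 (hd y₀ hyB s hs)
      rw [hTu] at h2
      exact h2
    have h := isOpen_Ioo.is_const_of_deriv_eq_zero isPreconnected_Ioo
      (fun s hs => (hda s hs).differentiableAt.differentiableWithinAt)
      (fun s hs => (hda s hs).deriv) ht hI0
    simp only [h0 y₀ hyB] at h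
    exact h
  · rw [hder 0 hI0, h0 y₀ hyB]
    exact hTu y₀

theorem exists_twistingPiece_of_surface (hf : IsVerticalHelicoid f N)
    (hθ : ∀ x, angle f N x ≠ 0) (x₀ : S) :
    ∃ (S' : Set S) (L : Set M) (ε : ℝ) (Γ : ℝ → M → M), x₀ ∈ S' ∧
      IsTwistingPiece (n := 2) f S' (height f x₀) L ε Γ ∧
      ∃ (γ : ℝ → M) (δ : ℝ), 0 < δ ∧ IsGeodesic (n := 2) γ δ ∧ L = γ '' Ioo (-δ) δ := by
  have hsec := sectionShape_eq_zero_of_minimal hf.hypersurface hθ hf.minimal_sections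
  obtain ⟨U, σ, hσ, hyU, hx, hopen⟩ := hf.hypersurface.exists_isLocalSection (hθ x₀)
  obtain ⟨a, ha, c, hc, hc0, hcU, hunit, hcu, hdu⟩ := hσ.exists_unit_speed_curve hf hyU
  have hball : ∀ δ : ℝ, ball (0 : ℝ) δ = Ioo (-δ) δ := fun δ => by
    rw [Real.ball_eq_Ioo, zero_sub, zero_add]
  have hI0 : (0 : ℝ) ∈ Ioo (-a) a := ⟨neg_lt_zero.2 ha, ha⟩
  have hd0 : deriv c 0 ≠ 0 := by
    intro h
    have h1 := hunit 0 hI0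
    rw [h, map_zero] at h1
    exact zero_ne_one h1
  have huX := hσ.fderiv_height_killing hf hyU
  -- The linear form du is 1 on X and 0 on the velocity of the curve, so these two vectors form a
  -- basis; the slice is the curve itself, with parameter space ℝ.
  obtain ⟨e, he⟩ := exists_equiv_prod_real finrank_euclideanSpace_fin _
    (by rw [huX]; exact one_ne_zero) hdu hd0
  obtain ⟨S', ε, Γ, δ, hδ, hδa, hmem, hpiece⟩ := hσ.exists_isTwistingPiece hf hθ hsec hopen hyU ha
    (by rwa [hball]) hc0 (by rwa [hball]) e (fun q => by
      rw [he, fderiv_eq_smul_deriv])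
  rw [hx] at hmem hpiece
  have hsub : Ioo (-δ) δ ⊆ Ioo (-a) a := Ioo_subset_Ioo (neg_le_neg hδa) hδa
  refine ⟨S', _, ε, Γ, hmem, hpiece, fun t => proj f (σ (c t)), δ, hδ,
    hσ.isGeodesic rfl hf hsec (hc.mono hsub) (fun t ht => hcU t (hsub ht))
      (fun t ht => hunit t (hsub ht)) (fun t ht => hcu t (hsub ht)), ?_⟩
  rw [hball]
  exact image_congr fun t ht => (hσ.proj_eq _ (hcU t (hsub ht))).symm

end Surfaces

end VerticalHelicoid

end

theorem mainTheorem4 {n : ℕ} (hn : 2 ≤ n)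
    {M : Type*} [TopologicalSpace M] [T2Space M] [ChartedSpace (EuclideanSpace ℝ (Fin n)) M]
    [IsManifold (𝓡 n) ∞ M] [RiemannianBundle (fun p : M => TangentSpace (𝓡 n) p)]
    [IsContMDiffRiemannianBundle (𝓡 n) ∞ (EuclideanSpace ℝ (Fin n))
      (fun p : M => TangentSpace (𝓡 n) p)]
    {S : Type*} [TopologicalSpace S] [T2Space S] [ChartedSpace (EuclideanSpace ℝ (Fin n)) S]
    [IsManifold (𝓡 n) ∞ S]
    (f : S → M × ℝ) (N : ∀ x : S, TangentSpace ((𝓡 n).prod 𝓘(ℝ, ℝ)) (f x))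
    (hf : VerticalHelicoid.IsVerticalHelicoid f N)
    (hθ : ∀ x, VerticalHelicoid.angle f N x ≠ 0) :
    (VerticalHelicoid.TotallyGeodesicSections f N →
      ∀ x₀ : S, ∃ (S' : Set S) (L : Set M) (ε : ℝ) (Γ : ℝ → M → M), x₀ ∈ S' ∧
        VerticalHelicoid.IsTwistingPiece (n := n) f S' (VerticalHelicoid.height f x₀) L ε Γ) ∧
    (n = 2 →
      ∀ x₀ : S, ∃ (S' : Set S) (L : Set M) (ε : ℝ) (Γ : ℝ → M → M), x₀ ∈ S' ∧
        VerticalHelicoid.IsTwistingPiece (n := n) f S' (VerticalHelicoid.height f x₀) L ε Γ ∧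
        ∃ (γ : ℝ → M) (δ : ℝ), 0 < δ ∧ VerticalHelicoid.IsGeodesic (n := n) γ δ ∧
          L = γ '' Ioo (-δ) δ) := by
  refine ⟨fun hsec => VerticalHelicoid.exists_twistingPiece_of_totallyGeodesic hf hθ hsec, ?_⟩
  rintro rfl
  exact VerticalHelicoid.exists_twistingPiece_of_surface hf hθ
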